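/- **Setting.** Let $d\ge 1$. Let $J=(J_x)_{x\in\mathbb Z^d}$ be nonnegative reals with $J_x=J_{-x}$, with $J_x=0$ for $|x|>R$ for some finite $R>0$, and with $J_x>0$ whenever $|x|=1$ ($|\cdot|$ is the Euclidean norm). Bonds are the unordered pairs $\{x,y\}$ of distinct sites with $J_{y-x}>0$; let $\mathcal E$ be the set of bonds and $\mathcal E^\Lambda$ the set of bonds with both endpoints in $\Lambda$. For $\omega\in\{0,1\}^{\mathcal E}$ the open clusters are the connected components of the graph on $\mathbb Z^d$ with edge set $\{e:\omega(e)=1\}$, and $x\leftrightarrow y$ means that $x$ and $y$ lie in the same open cluster. Let $q\ge1$ and $\beta>0$. For finite $\Lambda\subset\mathbb Z^d$ and $\eta\in\{0,1\}^{\mathcal E}$, let $\mathbb P_\Lambda^\eta$ be the probability measure on the configurations $\omega$ that agree with $\eta$ off $\mathcal E^\Lambda$, with weights proportional to $$\prod_{e\in\mathcal E^\Lambda}p_e^{\omega(e)}(1-p_e)^{1-\omega(e)}\;q^{\mathfrak N_\Lambda(\omega)},\qquad p_{\{x,y\}}=1-e^{-2\beta J_{y-x}},$$ where $\mathfrak N_\Lambda(\omega)$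 is the number of open clusters of $\omega$ that intersect $\Lambda$. Let $\mathbb P_\Lambda^{\rm w}$ be the case $\eta\equiv1$. A random cluster measure is a probability measure $\mathbb P$ on $\{0,1\}^{\mathcal E}$ (with the product $\sigma$-algebra) such that, for every finite $\Lambda$ and every measurable $A$, $\mathbb P(A\mid\mathcal T_\Lambda)(\eta)=\mathbb P_\Lambda^\eta(A)$ for $\mathbb P$-a.e. $\eta$, where $\mathcal T_\Lambda$ is generated by the states of the bonds outside $\mathcal E^\Lambda$. Let $\hat\beta_c\in[0,\infty]$ be the supremum of the $\beta\ge0$ for which there are $\nu_0,\nu_1>0$ with $\mathbb P^{\rm w}_{\Lambda_N}(0\leftrightarrow\mathbb Z^d\setminus\Lambda_N)\le\nu_0e^{-\nu_1N}$ for all $N\ge 0$, where $\Lambda_N=\{-N,\dots,N\}^d$. For $\beta<\hat\beta_c$ there is a unique random cluster measure $\mathbb P$. Put, for $x,y,t\in\mathbb R^d$, with $[\cdot]$ the component-wise integer part and $(\cdot,\cdot)$ the scalar product, $$\xi(x)=-\lim_{k\to\infty}\tfrac1k\log\mathbb P(0\leftrightarrow[kx]),\qquad \mathbf K_\xi=\bigcap_{|n|=1}\{t\in\mathbb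 R^d:(t,n)\le\xi(n)\},\qquad \mathfrak s_t(y)=\xi(y)-(t,y),$$ and $Y_\delta(t)=\{y\in\mathbb Z^d:\mathfrak s_t(y)<\delta\,\xi(y)\}$. A vector $t\in\partial\mathbf K_\xi$ is dual to $x$ if $(t,x)=\xi(x)$. On $\{0\leftrightarrow x\}$ let $\mathbf C_{0,x}$ be the common open cluster of $0$ and $x$. A vertex $y\in\mathbf C_{0,x}$ is a $(t,\delta)$-cone point of $\mathbf C_{0,x}$ if $$\mathbf C_{0,x}\setminus\{y\}\subseteq\big(y-Y_{3\delta}(t)\big)\cup\big(y+Y_{3\delta}(t)\big),$$ and $\#^{\rm cone}_{t,\delta}(\mathbf C_{0,x})$ denotes the number of $(t,\delta)$-cone points. **Theorem 2.2.** Let $0<\beta<\hat\beta_c$. There exist $\delta\in(0,\frac13)$ and $\nu_5,\nu_6>0$, depending only on $d$, $J$, $\beta$ and $q$, such that for every $x\in\mathbb Z^d$ and every $t\in\partial\mathbf K_\xi$ dual to $x$, $$\mathbb P\big(\#^{\rm cone}_{t,\delta}(\mathbf C_{0,x})<\nu_5|x|\;\big|\;0\leftrightarrow x\big)\le e^{-\nu_6|x|}.$$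 -/

import Mathlib

open MeasureTheory Filter Topology

noncomputable section

namespace FK

variable {d : ℕ}

/-- The inclusion of `ℤ^d` in Euclidean space. -/
def emb (x : Fin d → ℤ) : EuclideanSpace ℝ (Fin d) := WithLp.toLp 2 (fun i => (x i : ℝ))

/-- Coupling constants on `ℤ^d`: nonnegative, symmetric, finite range, and positive on
the nearest neighbours of the origin (`|·|` is the Euclidean norm). -/
structure Coupling (d : ℕ) where
  J : (Fin d → ℤ) → ℝ
  nonneg : ∀ x, 0 ≤ J x
  symm : ∀ x, J (-x) = J x
  finite_range : ∃ R : ℝ, 0 < R ∧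
    ∀ x, R < ‖emb x‖ → J x = 0
  pos_of_norm_one : ∀ x,
    ‖emb x‖ = 1 → 0 < J x

/-- The component-wise integer part of a vector of `ℝ^d`. -/
def intPart (y : EuclideanSpace ℝ (Fin d)) : Fin d → ℤ := fun i => ⌊y i⌋

/-- The graph on `ℤ^d` whose edges are the pairs of distinct sites with `J_{y-x} > 0`. -/
def bondGraph (J : Coupling d) : SimpleGraph (Fin d → ℤ) :=
  SimpleGraph.fromRel (fun x y => 0 < J.J (y - x))

/-- The set of bonds. -/
abbrev Bond (J : Coupling d) : Type := (bondGraph J).edgeSet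

/-- Bond configurations (`true` is open, `false` is closed); the `σ`-algebra is the product one. -/
abbrev Config (J : Coupling d) : Type := Bond J → Bool

/-- The graph of open bonds of a configuration, on the vertex set `ℤ^d`. -/
def openGraph {J : Coupling d} (ω : Config J) : SimpleGraph (Fin d → ℤ) :=
  SimpleGraph.fromEdgeSet {e | ∃ h : e ∈ (bondGraph J).edgeSet, ω ⟨e, h⟩ = true}

/-- The open cluster of `x`. -/
def cluster {J : Coupling d} (ω : Config J) (x : Fin d → ℤ) : Set (Fin d → ℤ) :=
  {y | (openGraph ω).Reachable x y}

/-- The event that `x` and `y` belong to the same open cluster. -/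
def connected (J : Coupling d) (x y : Fin d → ℤ) : Set (Config J) :=
  {ω | y ∈ cluster ω x}

open Classical in
/-- The (finite) set of bonds with both endpoints in `Λ`. -/
def bondsIn (J : Coupling d) (Λ : Finset (Fin d → ℤ)) : Finset (Bond J) :=
  Λ.sym2.subtype (fun e => e ∈ (bondGraph J).edgeSet)

/-- `p_e = 1 - exp (-2 β J_e)`, with `J_e = J_{y-x}` for `e = {x, y}`. -/
def bondProb (J : Coupling d) (β : ℝ) (e : Sym2 (Fin d → ℤ)) : ℝ :=
  Sym2.lift ⟨fun x y => 1 - Real.exp (-2 * β * J.J (y - x)), fun x y => by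
    simp only [← J.symm (y - x), neg_sub]⟩ e

/-- The number of open clusters of `ω` that intersect `Λ`. -/
def numClusters {J : Coupling d} (Λ : Finset (Fin d → ℤ)) (ω : Config J) : ℕ :=
  ((openGraph ω).connectedComponentMk '' (Λ : Set (Fin d → ℤ))).ncard

/-- The unnormalized random cluster weight in `Λ`. -/
def weight (J : Coupling d) (β q : ℝ) (Λ : Finset (Fin d → ℤ)) (ω : Config J) : ℝ :=
  (∏ e ∈ bondsIn J Λ, if ω e = true then bondProb J β e.1 else 1 - bondProb J β e.1) *
    q ^ numClusters Λ ω

open Classical in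
/-- The configuration equal to `η` off the bonds inside `Λ`, whose open bonds inside `Λ` are
those of `S`. As `S` runs through the sets of bonds inside `Λ`, this runs once through all
configurations that agree with `η` off the bonds inside `Λ`. -/
def glue {J : Coupling d} (Λ : Finset (Fin d → ℤ)) (η : Config J) (S : Finset (Bond J)) :
    Config J :=
  fun e => if e ∈ bondsIn J Λ then decide (e ∈ S) else η e

/-- The partition function with boundary condition `η`. -/
def partitionFn (J : Coupling d) (β q : ℝ) (Λ : Finset (Fin d → ℤ)) (η : Config J) : ℝ :=
  ∑ S ∈ (bondsIn J Λ).powerset, weight J β q Λ (glue Λ η S)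

/-- The finite-volume random cluster measure with boundary condition `η`. -/
def finVolMeasure (J : Coupling d) (β q : ℝ) (Λ : Finset (Fin d → ℤ)) (η : Config J) :
    Measure (Config J) :=
  ∑ S ∈ (bondsIn J Λ).powerset,
    ENNReal.ofReal (weight J β q Λ (glue Λ η S) / partitionFn J β q Λ η) •
      Measure.dirac (glue Λ η S)

/-- The `σ`-algebra generated by the states of the bonds that do not have both endpoints in `Λ`. -/
@[reducible] def outsideSigma (J : Coupling d) (Λ : Finset (Fin d → ℤ)) : MeasurableSpace (Config J) :=
  ⨆ e : {e : Bond J // e ∉ bondsIn J Λ},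
    MeasurableSpace.comap (fun ω : Config J => ω e.1) (inferInstance : MeasurableSpace Bool)

/-- Random cluster measures: the probability measures that satisfy the DLR equations
`P(A | 𝒯_Λ)(η) = P_Λ^η(A)` for `P`-almost every `η`. -/
structure IsRandomCluster (J : Coupling d) (β q : ℝ) (P : Measure (Config J)) : Prop where
  isProb : IsProbabilityMeasure P
  dlr : ∀ (Λ : Finset (Fin d → ℤ)) (A : Set (Config J)), MeasurableSet A →
    condExp (outsideSigma J Λ) P (A.indicator (fun _ => (1 : ℝ)))
      =ᵐ[P] fun η => (finVolMeasure J β q Λ η).real A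

/-- The box `{-N, …, N}^d`. -/
def box (d N : ℕ) : Finset (Fin d → ℤ) := Finset.Icc (fun _ => -(N : ℤ)) (fun _ => (N : ℤ))

/-- Exponential decay in wired boxes: for some `ν₀, ν₁ > 0` and all `N`,
`P_{Λ_N}^w (0 ↔ ℤ^d \ Λ_N) ≤ ν₀ exp (-ν₁ N)`. -/
def WiredDecay (J : Coupling d) (β q : ℝ) : Prop :=
  ∃ ν₀ ν₁ : ℝ, 0 < ν₀ ∧ 0 < ν₁ ∧ ∀ N : ℕ,
    (finVolMeasure J β q (box d N) (fun _ => true)).real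
      {ω | ∃ y, y ∉ box d N ∧ y ∈ cluster ω 0} ≤ ν₀ * Real.exp (-ν₁ * N)

/-- The critical point `β̂_c` (possibly `+∞`): the supremum of all `β ≥ 0` with exponential decay
in wired boxes. -/
def betaHat (J : Coupling d) (q : ℝ) : EReal :=
  sSup ((fun β : ℝ => (β : EReal)) '' {β | 0 ≤ β ∧ WiredDecay J β q})

/-- The inverse correlation length `ξ(x) = - lim_k (1/k) log P(0 ↔ [k x])`. -/
def xi {J : Coupling d} (P : Measure (Config J)) (x : EuclideanSpace ℝ (Fin d)) : ℝ :=
  - limUnder atTop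
      (fun k : ℕ => (1 / (k : ℝ)) * Real.log (P.real (connected J 0 (intPart ((k : ℝ) • x)))))

/-- The Wulff shape `K_ξ`. -/
def wulff {J : Coupling d} (P : Measure (Config J)) : Set (EuclideanSpace ℝ (Fin d)) :=
  ⋂ n ∈ Metric.sphere (0 : EuclideanSpace ℝ (Fin d)) 1, {t | inner ℝ t n ≤ xi P n}

/-- The surcharge function `𝔰_t(y) = ξ(y) - (t, y)`. -/
def surcharge {J : Coupling d} (P : Measure (Config J)) (t y : EuclideanSpace ℝ (Fin d)) : ℝ :=
  xi P y - inner ℝ t y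

/-- The forward cone `{y ∈ ℤ^d : 𝔰_t(y) < δ ξ(y)}`; the backward cone is its negative. -/
def fwdCone {J : Coupling d} (P : Measure (Config J)) (δ : ℝ) (t : EuclideanSpace ℝ (Fin d)) :
    Set (Fin d → ℤ) :=
  {y | surcharge P t (emb y) < δ * xi P (emb y)}

/-- The `(t, δ)`-cone points of a set `C` of sites: the `y ∈ C` such that every other point of
`C` lies in `y - Y` or in `y + Y`, where `Y` is the forward cone of opening `3 δ`. The apex
itself is exempted, because `0 ∉ Y`. -/
def conePoints {J : Coupling d} (P : Measure (Config J)) (δ : ℝ) (t : EuclideanSpace ℝ (Fin d))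
    (C : Set (Fin d → ℤ)) : Set (Fin d → ℤ) :=
  {y | y ∈ C ∧ ∀ z ∈ C, z ≠ y → y - z ∈ fwdCone P (3 * δ) t ∨ z - y ∈ fwdCone P (3 * δ) t}

end FK

end

open MeasureTheory Filter Topology

noncomputable section

namespace FK

section
variable {d : ℕ} {J : Coupling d}

/-! ### Components of a graph and the addition of one edge -/

section Graph

/-! The proof is a coarse-graining argument followed by a local surgery. Write `ζ` for `ξ` on the
lattice; it is a norm-like function comparable to the supremum norm, and the height `(t, ·)` is at
most `ζ`, with equality at `x`.

Decoupling. Monotonicity in `β` and in the boundary condition (`finVolMeasure_mono`) turns decay in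
wired boxes into decay for every boundary condition. So a finite set `D` is unlikely to be joined to
the outside of a neighbourhood of width of order `ρ`; when it is not joined, revealing the clusters
that come from outside leaves a closed boundary condition around `D` (`real_inter_blocked_le`).
Since the cost of a connection is bounded conditionally on everything else, the error in
`decoupling` is a small multiple of `P (G ∩ A)` itself and can be absorbed. For increasing `A` this
gives `P (G ∩ A) ≤ 2 P(A) P(G)`. The same comparison with closed boundary conditions gives
uniqueness (`unique`), translation invariance of the two-point function and its
supermultiplicativity, hence the existence and the basic properties of `ζ`.

Skeletons. At a large scale `K` the cluster of `0` is explored depth first: a site is recorded when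
it has a connection to `ζ`-distance more than `K` that avoids the balls around the sites already
recorded. By decoupling each record costs about `exp (-K)`, and the entropy per record is only
polynomial in `K`. A skeleton with more than `1.01 ζ(x) / K` records is therefore exponentially less
likely than `0 ↔ x`, whose probability is `exp (-ζ(x))` up to a small exponential error
(`exists_nlog_le_zeta_add`). Otherwise a skeleton with hardly more sites than the height of `x`
demands covers the cluster. Nearly every level of height then contains a single site, and a
one-sided maximal inequality (`card_crowded_le`), applied upwards and downwards, produces of order
`ζ(x) / K` sites from which everything at distance more than `62 K` is seen in a double cone
(`exists_coarse_conePoints`, `exists_coarse_bound`).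

Surgery. Around such a site `u` the bonds of a ball of fixed radius are changed so that inside the
ball only a set remains on which the height differs from that of `u`, except at `u`. The cluster
outside the ball is unchanged and `u` becomes a genuine cone point (`patch_facts`). The condition
that makes `u` eligible is formulated so that surgeries in disjoint balls do not interfere: each one
adds exactly one selected point (`patch_selection`). As the surgery costs only a constant factor,
comparing the events with `s` and with `s + 1` selected points shows that their probabilities at
least double with `s` as long as `s` is a small fraction of the number of eligible balls, so that
few selected points are exponentially unlikely (`exists_selection_bound`). Bounded `x` are treated
by finite energy (`exists_sharp_bound_near`). -/

lemma reachable_add_edge {V : Type*} {G G' : SimpleGraph V} {x y : V}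
    (hG' : ∀ a b, G'.Adj a b → G.Adj a b ∨ (a = x ∧ b = y) ∨ (a = y ∧ b = x)) {a b : V}
    (hab : G'.Reachable a b) :
    G.Reachable a b ∨ (G.Reachable a x ∧ G.Reachable y b) ∨ (G.Reachable a y ∧ G.Reachable x b) := by
  obtain ⟨w⟩ := hab
  induction w with
  | nil => exact Or.inl (SimpleGraph.Reachable.refl _)
  | @cons u v w h p ih =>
    rcases hG' _ _ h with h1 | ⟨rfl, rfl⟩ | ⟨rfl, rfl⟩
    · rcases ih with h2 | ⟨h2, h3⟩ | ⟨h2, h3⟩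
      · exact Or.inl (h1.reachable.trans h2)
      · exact Or.inr (Or.inl ⟨h1.reachable.trans h2, h3⟩)
      · exact Or.inr (Or.inr ⟨h1.reachable.trans h2, h3⟩)
    · rcases ih with h2 | ⟨h2, h3⟩ | ⟨h2, h3⟩
      · exact Or.inr (Or.inl ⟨SimpleGraph.Reachable.refl _, h2⟩)
      · exact Or.inr (Or.inl ⟨SimpleGraph.Reachable.refl _, h3⟩)
      · exact Or.inl h3
    · rcases ih with h2 | ⟨h2, h3⟩ | ⟨h2, h3⟩
      · exact Or.inr (Or.inr ⟨SimpleGraph.Reachable.refl _, h2⟩)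
      · exact Or.inl h3
      · exact Or.inr (Or.inr ⟨SimpleGraph.Reachable.refl _, h3⟩)

open Classical in
/-- Adding an edge between two vertices of `Λ` decreases the number of components that meet `Λ`
by one if it joins two different components, and does not change it otherwise. -/
lemma ncard_components_add_edge {V : Type*} {G G' : SimpleGraph V} {x y : V} (hle : G ≤ G')
    (hxy : G'.Adj x y)
    (hG' : ∀ a b, G'.Adj a b → G.Adj a b ∨ (a = x ∧ b = y) ∨ (a = y ∧ b = x))
    (Λ : Finset V) (hx : x ∈ Λ) (hy : y ∈ Λ) :
    (G.connectedComponentMk '' (Λ : Set V)).ncard =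
      (G'.connectedComponentMk '' (Λ : Set V)).ncard + if G.Reachable x y then 0 else 1 := by
  have key : ∀ {a b : V}, G'.Reachable a b → G.Reachable a b ∨
      (G.Reachable a x ∧ G.Reachable y b) ∨ (G.Reachable a y ∧ G.Reachable x b) :=
    reachable_add_edge hG'
  set φ : G.ConnectedComponent → G'.ConnectedComponent :=
    SimpleGraph.ConnectedComponent.map (SimpleGraph.Hom.ofLE hle) with hφ
  have hφmk : ∀ v, φ (G.connectedComponentMk v) = G'.connectedComponentMk v := fun v => rfl
  have himg : G'.connectedComponentMk '' (Λ : Set V) =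
      φ '' (G.connectedComponentMk '' (Λ : Set V)) := by
    rw [Set.image_image]; rfl
  have hfin : (G.connectedComponentMk '' (Λ : Set V)).Finite := Λ.finite_toSet.image _
  by_cases h : G.Reachable x y
  · rw [if_pos h, add_zero, himg]
    refine (Set.InjOn.ncard_image ?_).symm
    rintro _ ⟨a, -, rfl⟩ _ ⟨b, -, rfl⟩ hab
    rw [hφmk, hφmk, SimpleGraph.ConnectedComponent.eq] at hab
    rw [SimpleGraph.ConnectedComponent.eq]
    rcases key hab with h1 | ⟨h1, h2⟩ | ⟨h1, h2⟩
    · exact h1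
    · exact h1.trans (h.trans h2)
    · exact h1.trans (h.symm.trans h2)
  · rw [if_neg h]
    have hymem : G.connectedComponentMk y ∈ G.connectedComponentMk '' (Λ : Set V) :=
      ⟨y, hy, rfl⟩
    have himg2 : G'.connectedComponentMk '' (Λ : Set V) =
        φ '' ((G.connectedComponentMk '' (Λ : Set V)) \ {G.connectedComponentMk y}) := by
      rw [himg]
      apply Set.Subset.antisymm
      · rintro _ ⟨_, ⟨a, ha, rfl⟩, rfl⟩
        by_cases hay : G.connectedComponentMk a = G.connectedComponentMk y
        · refine ⟨G.connectedComponentMk x, ⟨⟨x, hx, rfl⟩, ?_⟩, ?_⟩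
          · rw [Set.mem_singleton_iff, SimpleGraph.ConnectedComponent.eq]; exact h
          · rw [hay, hφmk, hφmk, SimpleGraph.ConnectedComponent.eq]
            exact hxy.reachable
        · exact ⟨_, ⟨⟨a, ha, rfl⟩, hay⟩, rfl⟩
      · exact Set.image_mono Set.sdiff_subset
    suffices hinj : Set.InjOn φ
        ((G.connectedComponentMk '' (Λ : Set V)) \ {G.connectedComponentMk y}) by
      rw [himg2, hinj.ncard_image, Set.ncard_sdiff_singleton_add_one hymem hfin]
    rintro _ ⟨⟨a, -, rfl⟩, ha⟩ _ ⟨⟨b, -, rfl⟩, hb⟩ hab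
    rw [Set.mem_singleton_iff, SimpleGraph.ConnectedComponent.eq] at ha hb
    rw [hφmk, hφmk, SimpleGraph.ConnectedComponent.eq] at hab
    rw [SimpleGraph.ConnectedComponent.eq]
    rcases key hab with h1 | ⟨h1, h2⟩ | ⟨h1, h2⟩
    · exact h1
    · exact absurd h2.symm hb
    · exact absurd h1 ha

end Graph

/-! ### Open clusters and supermodularity of their number -/

section Cluster

lemma bondGraph_adj {x y : Fin d → ℤ} :
    (bondGraph J).Adj x y ↔ x ≠ y ∧ 0 < J.J (y - x) := by
  have : J.J (x - y) = J.J (y - x) := by rw [← J.symm (y - x), neg_sub]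
  simp [bondGraph, SimpleGraph.fromRel_adj, this]

lemma openGraph_adj {ω : Config J} {x y : Fin d → ℤ} :
    (openGraph ω).Adj x y ↔ ∃ h : s(x, y) ∈ (bondGraph J).edgeSet, ω ⟨s(x, y), h⟩ = true := by
  rw [openGraph, SimpleGraph.fromEdgeSet_adj]
  constructor
  · exact fun h => h.1
  · rintro ⟨h, h'⟩
    exact ⟨⟨h, h'⟩, (SimpleGraph.mem_edgeSet _).1 h |>.ne⟩

lemma openGraph_le_bondGraph (ω : Config J) : openGraph ω ≤ bondGraph J := by
  intro x y h
  obtain ⟨h, -⟩ := openGraph_adj.1 h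
  exact h

lemma openGraph_mono {ω ω' : Config J} (h : ω ≤ ω') : openGraph ω ≤ openGraph ω' := by
  intro x y hxy
  obtain ⟨h1, h2⟩ := openGraph_adj.1 hxy
  refine openGraph_adj.2 ⟨h1, ?_⟩
  have := h ⟨s(x, y), h1⟩
  rw [h2] at this
  exact top_le_iff.1 this

lemma cluster_mono {ω ω' : Config J} (h : ω ≤ ω') (x : Fin d → ℤ) :
    cluster ω x ⊆ cluster ω' x := fun _ hy => SimpleGraph.Reachable.mono (openGraph_mono h) hy

lemma mem_cluster_self (ω : Config J) (x : Fin d → ℤ) : x ∈ cluster ω x :=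
  SimpleGraph.Reachable.refl _

lemma mem_cluster_comm {ω : Config J} {x y : Fin d → ℤ} : y ∈ cluster ω x ↔ x ∈ cluster ω y :=
  ⟨SimpleGraph.Reachable.symm, SimpleGraph.Reachable.symm⟩

lemma cluster_eq_of_mem {ω : Config J} {x y : Fin d → ℤ} (h : y ∈ cluster ω x) :
    cluster ω y = cluster ω x := by
  ext z
  exact ⟨fun hz => SimpleGraph.Reachable.trans h hz,
    fun hz => SimpleGraph.Reachable.trans (SimpleGraph.Reachable.symm h) hz⟩

lemma mem_cluster_of_adj {ω : Config J} {x y z : Fin d → ℤ} (h : y ∈ cluster ω x)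
    (h' : (openGraph ω).Adj y z) : z ∈ cluster ω x :=
  SimpleGraph.Reachable.trans h h'.reachable

/-- Induction along the cluster. -/
lemma cluster_induction {ω : Config J} {x : Fin d → ℤ} {p : (Fin d → ℤ) → Prop} (h0 : p x)
    (h1 : ∀ y z, y ∈ cluster ω x → p y → (openGraph ω).Adj y z → p z) {y : Fin d → ℤ}
    (hy : y ∈ cluster ω x) : p y := by
  obtain ⟨w⟩ : (openGraph ω).Reachable x y := hy
  suffices H : ∀ u v (w : (openGraph ω).Walk u v), u ∈ cluster ω x → p u → p v from
    H _ _ w (mem_cluster_self _ _) h0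
  intro u v w
  induction w with
  | nil => exact fun _ h => h
  | cons h _ ih => exact fun hu hp => ih (mem_cluster_of_adj hu h) (h1 _ _ hu hp h)

/-- If `p` holds at the origin of a cluster and fails somewhere in it, then it fails for the
first time along an open bond. -/
lemma exists_adj_of_mem_cluster {ω : Config J} {x y : Fin d → ℤ} {p : (Fin d → ℤ) → Prop}
    (hy : y ∈ cluster ω x) (hx : p x) (hny : ¬ p y) :
    ∃ a b, a ∈ cluster ω x ∧ p a ∧ (openGraph ω).Adj a b ∧ ¬ p b := by
  by_contra hcon
  push Not at hcon
  exact hny (cluster_induction (p := p) hx (fun a b ha hpa hab => hcon a b ha hpa hab) hy)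

/-- Components of the open graphs of two configurations live in different types; clusters as sets of
sites can be compared between configurations and translated. -/
lemma numClusters_eq (Λ : Finset (Fin d → ℤ)) (ω : Config J) :
    numClusters Λ ω = (cluster ω '' (Λ : Set (Fin d → ℤ))).ncard := by
  have : cluster ω '' (Λ : Set (Fin d → ℤ)) =
      SimpleGraph.ConnectedComponent.supp '' ((openGraph ω).connectedComponentMk '' Λ) := by
    rw [Set.image_image]
    refine Set.image_congr fun x _ => ?_
    ext y
    rw [SimpleGraph.ConnectedComponent.mem_supp_iff, SimpleGraph.ConnectedComponent.eq]
    exact ⟨SimpleGraph.Reachable.symm, SimpleGraph.Reachable.symm⟩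
  rw [this, Set.ncard_image_of_injective _ SimpleGraph.ConnectedComponent.supp_injective]
  rfl

lemma numClusters_le_card (Λ : Finset (Fin d → ℤ)) (ω : Config J) : numClusters Λ ω ≤ Λ.card := by
  rw [numClusters, ← Set.ncard_coe_finset Λ]
  exact Set.ncard_image_le Λ.finite_toSet

lemma mem_bondsIn {Λ : Finset (Fin d → ℤ)} {e : Bond J} :
    e ∈ bondsIn J Λ ↔ ∀ v ∈ e.1, v ∈ Λ := by
  classical
  simp only [bondsIn, Finset.mem_subtype, Finset.mem_sym2_iff]

lemma mk_mem_bondsIn {Λ : Finset (Fin d → ℤ)} {x y : Fin d → ℤ}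
    {h : s(x, y) ∈ (bondGraph J).edgeSet} :
    (⟨s(x, y), h⟩ : Bond J) ∈ bondsIn J Λ ↔ x ∈ Λ ∧ y ∈ Λ := by
  simp [mem_bondsIn]

lemma bondsIn_mono {Λ Λ' : Finset (Fin d → ℤ)} (h : Λ ⊆ Λ') : bondsIn J Λ ⊆ bondsIn J Λ' :=
  fun _ he => mem_bondsIn.2 fun v hv => h (mem_bondsIn.1 he v hv)

open Classical in
/-- The configuration `ω` with the bonds of `F` opened. -/
def openBonds (ω : Config J) (F : Finset (Bond J)) : Config J := fun e => ω e || decide (e ∈ F)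

lemma openBonds_empty (ω : Config J) : openBonds ω ∅ = ω := by
  funext e; simp [openBonds]

open Classical in
lemma openBonds_insert (ω : Config J) (F : Finset (Bond J)) (e : Bond J) :
    openBonds ω (insert e F) = openBonds (openBonds ω F) {e} := by
  funext e'
  by_cases h : e' = e <;> simp [openBonds, h, Bool.or_comm]

lemma openBonds_mono {ω ω' : Config J} (h : ω ≤ ω') (F : Finset (Bond J)) :
    openBonds ω F ≤ openBonds ω' F := by
  intro e
  have := h e
  simp only [openBonds]
  revert this
  cases ω e <;> cases ω' e <;> simp

lemma le_openBonds (ω : Config J) (F : Finset (Bond J)) : ω ≤ openBonds ω F := by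
  intro e
  simp only [openBonds]
  cases ω e <;> simp

open Classical in
lemma numClusters_openBonds_singleton (Λ : Finset (Fin d → ℤ)) (ω : Config J) {x y : Fin d → ℤ}
    (h : s(x, y) ∈ (bondGraph J).edgeSet) (hx : x ∈ Λ) (hy : y ∈ Λ) :
    numClusters Λ ω = numClusters Λ (openBonds ω {⟨s(x, y), h⟩}) +
      if y ∈ cluster ω x then 0 else 1 := by
  refine ncard_components_add_edge (openGraph_mono (le_openBonds _ _)) ?_ ?_ Λ hx hy
  · exact openGraph_adj.2 ⟨h, by simp [openBonds]⟩
  · intro a b hab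
    obtain ⟨h1, h2⟩ := openGraph_adj.1 hab
    by_cases hab' : s(a, b) = s(x, y)
    · right
      rwa [Sym2.eq_iff] at hab'
    · left
      refine openGraph_adj.2 ⟨h1, ?_⟩
      simpa [openBonds, hab'] using h2

/-- The drop of the number of clusters when bonds are opened is a decreasing function of the
configuration. -/
lemma numClusters_supermodular (Λ : Finset (Fin d → ℤ)) {ω ω' : Config J} (h : ω ≤ ω')
    {F : Finset (Bond J)} (hF : F ⊆ bondsIn J Λ) :
    numClusters Λ ω' + numClusters Λ (openBonds ω F) ≤
      numClusters Λ ω + numClusters Λ (openBonds ω' F) := by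
  classical
  -- One bond at a time: opening a bond lowers the number of clusters by one exactly when its
  -- endpoints are not yet joined, and endpoints joined below `ω` are joined below `ω'`.
  induction F using Finset.induction_on with
  | empty => simp [openBonds_empty, add_comm]
  | @insert e F he ih =>
    have ih := ih (fun _ h => hF (Finset.mem_insert_of_mem h))
    obtain ⟨e, heb⟩ := e
    induction e using Sym2.ind with
    | _ x y =>
      have hxy := mk_mem_bondsIn.1 (hF (Finset.mem_insert_self _ F))
      have h1 := numClusters_openBonds_singleton Λ (openBonds ω F) heb hxy.1 hxy.2
      have h2 := numClusters_openBonds_singleton Λ (openBonds ω' F) heb hxy.1 hxy.2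
      rw [openBonds_insert, openBonds_insert]
      have h3 : y ∈ cluster (openBonds ω F) x → y ∈ cluster (openBonds ω' F) x :=
        fun hy => cluster_mono (openBonds_mono h F) x hy
      split_ifs at h1 h2 <;> first | omega | tauto

end Cluster

end

section
variable {d : ℕ} {J : Coupling d}

/-! ### Configurations with prescribed exterior -/

section Glue

lemma glue_apply_of_mem {Λ : Finset (Fin d → ℤ)} (η : Config J) {S : Finset (Bond J)} {e : Bond J}
    (he : e ∈ bondsIn J Λ) : glue Λ η S e = true ↔ e ∈ S := by
  simp [glue, he]

lemma glue_apply_of_notMem {Λ : Finset (Fin d → ℤ)} (η : Config J) (S : Finset (Bond J))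
    {e : Bond J} (he : e ∉ bondsIn J Λ) : glue Λ η S e = η e := by
  simp [glue, he]

lemma glue_mono {Λ : Finset (Fin d → ℤ)} {η η' : Config J} (h : η ≤ η') {S S' : Finset (Bond J)}
    (hS : S ⊆ S') : glue Λ η S ≤ glue Λ η' S' := by
  intro e
  by_cases he : e ∈ bondsIn J Λ
  · by_cases heS : e ∈ S
    · simp [glue, he, heS, hS heS]
    · simp [glue, he, heS]
  · simpa [glue, he] using h e

open Classical in
lemma glue_union {Λ : Finset (Fin d → ℤ)} (η : Config J) {S T : Finset (Bond J)}
    (hS : S ⊆ bondsIn J Λ) : glue Λ η (T ∪ S) = openBonds (glue Λ η T) S := by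
  funext e
  by_cases he : e ∈ bondsIn J Λ
  · simp [glue, openBonds, he]
  · have : e ∉ S := fun h => he (hS h)
    simp [glue, openBonds, he, this]

open Classical in
/-- A configuration that agrees with `η` off the bonds inside `Λ` is one of the glued ones. -/
lemma eq_glue {Λ : Finset (Fin d → ℤ)} {η ω : Config J}
    (h : ∀ e, e ∉ bondsIn J Λ → ω e = η e) :
    ω = glue Λ η ((bondsIn J Λ).filter (fun e => ω e = true)) := by
  funext e
  by_cases he : e ∈ bondsIn J Λ
  · simp [glue, he]
  · rw [glue_apply_of_notMem _ _ he, h e he]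

end Glue

/-! ### Finite-volume measures: monotonicity and FKG -/

section Weights

variable {β q : ℝ}

lemma bondProb_mk (β : ℝ) (x y : Fin d → ℤ) :
    bondProb J β s(x, y) = 1 - Real.exp (-2 * β * J.J (y - x)) := rfl

lemma bondProb_pos (hβ : 0 < β) (e : Bond J) : 0 < bondProb J β e.1 := by
  obtain ⟨e, he⟩ := e
  induction e using Sym2.ind with
  | _ x y =>
    have := (bondGraph_adj.1 ((SimpleGraph.mem_edgeSet _).1 he)).2
    rw [bondProb_mk, sub_pos, Real.exp_lt_one_iff]
    nlinarith [mul_pos hβ this]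

lemma bondProb_lt_one (e : Bond J) : 0 < 1 - bondProb J β e.1 := by
  obtain ⟨e, he⟩ := e
  induction e using Sym2.ind with
  | _ x y => rw [bondProb_mk]; simpa using Real.exp_pos _

lemma bondProb_mono {β' : ℝ} (h : β ≤ β') (e : Bond J) :
    bondProb J β e.1 ≤ bondProb J β' e.1 := by
  obtain ⟨e, he⟩ := e
  induction e using Sym2.ind with
  | _ x y =>
    have := J.nonneg (y - x)
    rw [bondProb_mk, bondProb_mk]
    have : Real.exp (-2 * β' * J.J (y - x)) ≤ Real.exp (-2 * β * J.J (y - x)) := by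
      apply Real.exp_le_exp.2; nlinarith
    linarith

lemma weight_pos (hβ : 0 < β) (hq : 1 ≤ q) (Λ : Finset (Fin d → ℤ)) (ω : Config J) :
    0 < weight J β q Λ ω := by
  refine mul_pos (Finset.prod_pos fun e _ => ?_) (pow_pos (by linarith) _)
  split_ifs
  · exact bondProb_pos hβ e
  · exact bondProb_lt_one e

lemma partitionFn_pos (hβ : 0 < β) (hq : 1 ≤ q) (Λ : Finset (Fin d → ℤ)) (η : Config J) :
    0 < partitionFn J β q Λ η :=
  Finset.sum_pos (fun _ _ => weight_pos hβ hq _ _) ⟨∅, by simp⟩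

instance : Countable (Bond J) := by
  have : Countable (Sym2 (Fin d → ℤ)) := by unfold Sym2; infer_instance
  infer_instance

/-- The probabilities of the finite-volume measure as sums of normalized weights. -/
lemma finVolMeasure_real (hβ : 0 < β) (hq : 1 ≤ q) (Λ : Finset (Fin d → ℤ)) (η : Config J)
    (A : Set (Config J)) [DecidablePred fun S => glue Λ η S ∈ A] :
    (finVolMeasure J β q Λ η).real A =
      (∑ S ∈ (bondsIn J Λ).powerset.filter (fun S => glue Λ η S ∈ A),
        weight J β q Λ (glue Λ η S)) / partitionFn J β q Λ η := by
  have hZ := partitionFn_pos hβ hq Λ η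
  rw [finVolMeasure, Measure.real, Measure.finsetSum_apply, ENNReal.toReal_sum, Finset.sum_filter,
    Finset.sum_div]
  · refine Finset.sum_congr rfl fun S _ => ?_
    rw [Measure.smul_apply, Measure.dirac_apply, smul_eq_mul, ENNReal.toReal_mul,
      ENNReal.toReal_ofReal (div_nonneg (weight_pos hβ hq _ _).le hZ.le)]
    by_cases h : glue Λ η S ∈ A <;> simp [h]
  · intro S _
    rw [Measure.smul_apply, Measure.dirac_apply, smul_eq_mul]
    refine ENNReal.mul_ne_top ENNReal.ofReal_ne_top ?_
    by_cases h : glue Λ η S ∈ A <;> simp [h]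

lemma finVolMeasure_isProb (hβ : 0 < β) (hq : 1 ≤ q) (Λ : Finset (Fin d → ℤ)) (η : Config J) :
    IsProbabilityMeasure (finVolMeasure J β q Λ η) := by
  have hZ := partitionFn_pos hβ hq Λ η
  have h1 : (finVolMeasure J β q Λ η).real Set.univ = 1 := by
    classical
    rw [finVolMeasure_real hβ hq]
    simp only [Set.mem_univ, Finset.filter_true]
    exact div_self hZ.ne'
  refine ⟨?_⟩
  rw [Measure.real] at h1
  exact (ENNReal.toReal_eq_one_iff _).1 h1

/-- The lattice condition behind both monotonicity and FKG. Passing from `S ∩ T` to `S` and from `T`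
to `S ∪ T` opens the same bonds `S \ T`, so supermodularity of the number of clusters and `q ≥ 1`
handle the cluster factor; the bond factors are compared one bond at a time, and differ only on `S \
T`. -/
lemma weight_glue_mul_le {β' : ℝ} (hβ : 0 < β) (hββ' : β ≤ β') (hq : 1 ≤ q)
    (Λ : Finset (Fin d → ℤ)) {η η' : Config J} (hη : η ≤ η') [DecidableEq (Bond J)]
    {S T : Finset (Bond J)} (hS : S ⊆ bondsIn J Λ) :
    weight J β q Λ (glue Λ η S) * weight J β' q Λ (glue Λ η' T) ≤
      weight J β q Λ (glue Λ η (S ∩ T)) * weight J β' q Λ (glue Λ η' (S ∪ T)) := by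
  have hST : S \ T ⊆ bondsIn J Λ := fun e he => hS (Finset.mem_sdiff.1 he).1
  have h1 : glue Λ η S = openBonds (glue Λ η (S ∩ T)) (S \ T) := by
    classical
    rw [← glue_union η hST]
    congr 1
    ext e
    simp only [Finset.mem_union, Finset.mem_inter, Finset.mem_sdiff]; tauto
  have h2 : glue Λ η' (S ∪ T) = openBonds (glue Λ η' T) (S \ T) := by
    classical
    rw [← glue_union η' hST]
    congr 1
    ext e
    simp only [Finset.mem_union, Finset.mem_sdiff]; tauto
  have hN := numClusters_supermodular Λ
    (glue_mono (Λ := Λ) hη (Finset.inter_subset_right : S ∩ T ⊆ T)) hST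
  rw [← h1, ← h2] at hN
  unfold weight
  rw [mul_mul_mul_comm, mul_mul_mul_comm (∏ e ∈ bondsIn J Λ,
    if glue Λ η (S ∩ T) e = true then bondProb J β e.1 else 1 - bondProb J β e.1), ← pow_add, ← pow_add, ← Finset.prod_mul_distrib,
    ← Finset.prod_mul_distrib]
  refine mul_le_mul ?_ (pow_le_pow_right₀ hq (by omega)) (by positivity) ?_
  · refine Finset.prod_le_prod (fun e _ => ?_) (fun e he => ?_)
    · have h1 := bondProb_pos (hβ.trans_le hββ') e
      have h2 := bondProb_pos hβ e
      have h3 := bondProb_lt_one (β := β) e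
      have h4 := bondProb_lt_one (β := β') e
      apply mul_nonneg <;> split_ifs <;> linarith
    · simp only [glue_apply_of_mem _ he, Finset.mem_inter, Finset.mem_union]
      have h1 := bondProb_mono hββ' e
      by_cases hs : e ∈ S <;> by_cases ht : e ∈ T <;> simp [hs, ht]
      nlinarith [bondProb_pos hβ e, bondProb_lt_one (β := β') e]
  · refine Finset.prod_nonneg fun e _ => ?_
    have h1 := bondProb_pos (hβ.trans_le hββ') e
    have h2 := bondProb_pos hβ e
    have h3 := bondProb_lt_one (β := β) e
    have h4 := bondProb_lt_one (β := β') e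
    apply mul_nonneg <;> split_ifs <;> linarith

/-- Monotonicity of the finite-volume measures in the inverse temperature and in the boundary
condition. -/
lemma finVolMeasure_mono {β' : ℝ} (hβ : 0 < β) (hββ' : β ≤ β') (hq : 1 ≤ q)
    (Λ : Finset (Fin d → ℤ)) {η η' : Config J} (hη : η ≤ η') {A : Set (Config J)}
    (hA : IsUpperSet A) :
    (finVolMeasure J β q Λ η).real A ≤ (finVolMeasure J β' q Λ η').real A := by
  classical
  have hβ' := hβ.trans_le hββ'
  have hZ := partitionFn_pos hβ hq Λ η
  have hZ' := partitionFn_pos hβ' hq Λ η'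
  rw [finVolMeasure_real hβ hq, finVolMeasure_real hβ' hq, div_le_div_iff₀ hZ hZ']
  -- Holley's argument: the second family consists of all sets of bonds, so unions stay in the
  -- increasing event for `η'`, and intersections are only bounded by the full partition function.
  have h4 := Finset.four_functions_theorem (f₁ := fun S => weight J β q Λ (glue Λ η S))
    (f₂ := fun S => weight J β' q Λ (glue Λ η' S)) (f₃ := fun S => weight J β q Λ (glue Λ η S))
    (f₄ := fun S => weight J β' q Λ (glue Λ η' S)) (bondsIn J Λ)
    (fun S => (weight_pos hβ hq _ _).le) (fun S => (weight_pos hβ' hq _ _).le)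
    (fun S => (weight_pos hβ hq _ _).le) (fun S => (weight_pos hβ' hq _ _).le)
    (fun S hS T hT => weight_glue_mul_le hβ hββ' hq Λ hη hS)
    (𝒜 := (bondsIn J Λ).powerset.filter (fun S => glue Λ η S ∈ A))
    (ℬ := (bondsIn J Λ).powerset) (Finset.filter_subset _ _) subset_rfl
  refine h4.trans ?_
  rw [mul_comm]
  refine mul_le_mul ?_ ?_ (Finset.sum_nonneg fun _ _ => (weight_pos hβ hq _ _).le)
    (Finset.sum_nonneg fun _ _ => (weight_pos hβ' hq _ _).le)
  · refine Finset.sum_le_sum_of_subset_of_nonneg ?_ (fun _ _ _ => (weight_pos hβ' hq _ _).le)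
    intro U hU
    obtain ⟨S, hS, T, hT, rfl⟩ := Finset.mem_sups.1 hU
    rw [Finset.mem_filter, Finset.mem_powerset] at hS
    rw [Finset.mem_powerset] at hT
    exact Finset.mem_filter.2 ⟨Finset.mem_powerset.2 (Finset.union_subset hS.1 hT),
      hA (glue_mono hη Finset.subset_union_left) hS.2⟩
  · refine Finset.sum_le_sum_of_subset_of_nonneg ?_ (fun _ _ _ => (weight_pos hβ hq _ _).le)
    intro U hU
    obtain ⟨S, hS, T, hT, rfl⟩ := Finset.mem_infs.1 hU
    rw [Finset.mem_filter, Finset.mem_powerset] at hS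
    exact Finset.mem_powerset.2 (Finset.inter_subset_left.trans hS.1)

/-- The FKG inequality in finite volume. -/
lemma finVolMeasure_fkg (hβ : 0 < β) (hq : 1 ≤ q) (Λ : Finset (Fin d → ℤ)) (η : Config J)
    {A B : Set (Config J)} (hA : IsUpperSet A) (hB : IsUpperSet B) :
    (finVolMeasure J β q Λ η).real A * (finVolMeasure J β q Λ η).real B ≤
      (finVolMeasure J β q Λ η).real (A ∩ B) := by
  classical
  have hZ := partitionFn_pos hβ hq Λ η
  rw [finVolMeasure_real hβ hq, finVolMeasure_real hβ hq, finVolMeasure_real hβ hq,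
    div_mul_div_comm, div_le_div_iff₀ (mul_pos hZ hZ) hZ, ← mul_assoc]
  refine mul_le_mul_of_nonneg_right ?_ hZ.le
  have h4 := Finset.four_functions_theorem (f₁ := fun S => weight J β q Λ (glue Λ η S))
    (f₂ := fun S => weight J β q Λ (glue Λ η S)) (f₃ := fun S => weight J β q Λ (glue Λ η S))
    (f₄ := fun S => weight J β q Λ (glue Λ η S)) (bondsIn J Λ)
    (fun S => (weight_pos hβ hq _ _).le) (fun S => (weight_pos hβ hq _ _).le)
    (fun S => (weight_pos hβ hq _ _).le) (fun S => (weight_pos hβ hq _ _).le)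
    (fun S hS T hT => weight_glue_mul_le hβ le_rfl hq Λ le_rfl hS)
    (𝒜 := (bondsIn J Λ).powerset.filter (fun S => glue Λ η S ∈ A))
    (ℬ := (bondsIn J Λ).powerset.filter (fun S => glue Λ η S ∈ B))
    (Finset.filter_subset _ _) (Finset.filter_subset _ _)
  refine h4.trans ?_
  rw [mul_comm]
  refine mul_le_mul ?_ ?_ (Finset.sum_nonneg fun _ _ => (weight_pos hβ hq _ _).le)
    (Finset.sum_nonneg fun _ _ => (weight_pos hβ hq _ _).le)
  · refine Finset.sum_le_sum_of_subset_of_nonneg ?_ (fun _ _ _ => (weight_pos hβ hq _ _).le)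
    intro U hU
    obtain ⟨S, hS, T, hT, rfl⟩ := Finset.mem_sups.1 hU
    rw [Finset.mem_filter, Finset.mem_powerset] at hS hT
    exact Finset.mem_filter.2 ⟨Finset.mem_powerset.2 (Finset.union_subset hS.1 hT.1),
      hA (glue_mono le_rfl Finset.subset_union_left) hS.2,
      hB (glue_mono le_rfl Finset.subset_union_right) hT.2⟩
  · refine Finset.sum_le_sum_of_subset_of_nonneg ?_ (fun _ _ _ => (weight_pos hβ hq _ _).le)
    intro U hU
    obtain ⟨S, hS, T, hT, rfl⟩ := Finset.mem_infs.1 hU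
    rw [Finset.mem_filter, Finset.mem_powerset] at hS
    exact Finset.mem_powerset.2 (Finset.inter_subset_left.trans hS.1)

end Weights

/-! ### Finite energy -/

section FiniteEnergy

lemma abs_apply_le_norm_emb (x : Fin d → ℤ) (i : Fin d) : |(x i : ℝ)| ≤ ‖emb x‖ := by
  have := PiLp.norm_apply_le (emb x) i
  simpa [emb] using this

/-- The range of the interaction in the supremum norm. -/
lemma exists_range (J : Coupling d) :
    ∃ R : ℕ, ∀ x y, (bondGraph J).Adj x y → ∀ i, |y i - x i| ≤ (R : ℤ) := by
  obtain ⟨R, -, hR⟩ := J.finite_range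
  refine ⟨⌈R⌉₊, fun x y hxy i => ?_⟩
  have h1 := (bondGraph_adj.1 hxy).2
  have h2 : ‖emb (y - x)‖ ≤ R := by
    by_contra hcon
    rw [hR _ (not_le.1 hcon)] at h1
    exact lt_irrefl _ h1
  have h3 := (abs_apply_le_norm_emb (y - x) i).trans (h2.trans (Nat.le_ceil R))
  rw [Pi.sub_apply] at h3
  exact_mod_cast h3

lemma mem_box {N : ℕ} {x : Fin d → ℤ} : x ∈ box d N ↔ ∀ i, |x i| ≤ (N : ℤ) := by
  rw [box, Finset.mem_Icc, Pi.le_def, Pi.le_def, ← forall_and]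
  exact forall_congr' fun i => abs_le.symm

variable {β q : ℝ}

/-- By the finite range and translation invariance of the couplings, only finitely many values of
the bond probability occur, each strictly between `0` and `1`. -/
lemma exists_bondProb_bounds (hβ : 0 < β) :
    ∃ p : ℝ, 0 < p ∧ p ≤ 1 ∧ ∀ e : Bond J, p ≤ bondProb J β e.1 ∧ p ≤ 1 - bondProb J β e.1 := by
  classical
  obtain ⟨R, hR⟩ := exists_range J
  have hfin : ∀ s : Finset (Fin d → ℤ), ∃ p : ℝ, 0 < p ∧ p ≤ 1 ∧ ∀ z ∈ s, 0 < J.J z →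
      p ≤ 1 - Real.exp (-2 * β * J.J z) ∧ p ≤ Real.exp (-2 * β * J.J z) := by
    intro s
    induction s using Finset.induction_on with
    | empty => exact ⟨1, one_pos, le_rfl, by simp⟩
    | @insert a s ha ih =>
      obtain ⟨p, hp, hp1, h⟩ := ih
      by_cases hJ : 0 < J.J a
      · have h1 : Real.exp (-2 * β * J.J a) < 1 := by
          rw [Real.exp_lt_one_iff]; nlinarith [mul_pos hβ hJ]
        refine ⟨min p (min (1 - Real.exp (-2 * β * J.J a)) (Real.exp (-2 * β * J.J a))),
          lt_min hp (lt_min (by linarith) (Real.exp_pos _)), (min_le_left _ _).trans hp1, ?_⟩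
        intro z hz hJz
        rcases Finset.mem_insert.1 hz with rfl | hz
        · exact ⟨(min_le_right _ _).trans (min_le_left _ _),
            (min_le_right _ _).trans (min_le_right _ _)⟩
        · exact ⟨(min_le_left _ _).trans (h z hz hJz).1, (min_le_left _ _).trans (h z hz hJz).2⟩
      · refine ⟨p, hp, hp1, fun z hz hJz => ?_⟩
        rcases Finset.mem_insert.1 hz with rfl | hz
        · exact absurd hJz hJ
        · exact h z hz hJz
  obtain ⟨p, hp, hp1, h⟩ := hfin (box d R)
  refine ⟨p, hp, hp1, ?_⟩
  rintro ⟨e, he⟩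
  induction e using Sym2.ind with
  | _ x y =>
    have hadj : (bondGraph J).Adj x y := he
    have := h (y - x) (mem_box.2 (hR x y hadj)) (bondGraph_adj.1 hadj).2
    rw [bondProb_mk]
    exact ⟨this.1, by linarith [this.2]⟩

lemma card_bondsIn_le (Λ : Finset (Fin d → ℤ)) :
    (bondsIn J Λ).card ≤ Λ.card * Λ.card + Λ.card := by
  classical
  calc (bondsIn J Λ).card ≤ Λ.sym2.card := by
        unfold bondsIn
        rw [Finset.card_subtype]
        exact Finset.card_filter_le _ _
    _ ≤ Λ.card * Λ.card + Λ.card := by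
        rw [Finset.card_sym2, Nat.choose_two_right, Nat.add_sub_cancel]
        refine (Nat.div_le_self _ _).trans (le_of_eq (by ring))

/-- Finite energy: every configuration inside `Λ` has a probability bounded below in terms of the
size of `Λ` only. -/
lemma finite_energy (J : Coupling d) (hβ : 0 < β) (hq : 1 ≤ q) :
    ∃ c : ℕ → ℝ, (∀ n, 0 < c n) ∧ ∀ (Λ : Finset (Fin d → ℤ)) (η : Config J) (S : Finset (Bond J)),
      S ⊆ bondsIn J Λ → ∀ A : Set (Config J), glue Λ η S ∈ A →
        c Λ.card ≤ (finVolMeasure J β q Λ η).real A := by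
  classical
  obtain ⟨p, hp, hp1, hpb⟩ := exists_bondProb_bounds (J := J) hβ
  -- There are at most `n² + n` bonds inside `n` sites. The numerator bounds one weight from below,
  -- as `q ≥ 1`; the denominator bounds the partition function by the number of configurations times
  -- `q ^ n`.
  refine ⟨fun n => p ^ (n * n + n) / (2 ^ (n * n + n) * q ^ n), fun n => by positivity, ?_⟩
  intro Λ η S hS A hA
  have hZ := partitionFn_pos hβ hq Λ η
  set n := Λ.card with hn
  have hE := card_bondsIn_le (J := J) Λ
  rw [finVolMeasure_real hβ hq]
  refine div_le_div₀ (Finset.sum_nonneg fun _ _ => (weight_pos hβ hq _ _).le) ?_ hZ ?_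
  · have h1 : weight J β q Λ (glue Λ η S) ≤
        ∑ S ∈ (bondsIn J Λ).powerset.filter (fun S => glue Λ η S ∈ A),
          weight J β q Λ (glue Λ η S) :=
      Finset.single_le_sum (f := fun S => weight J β q Λ (glue Λ η S))
        (fun _ _ => (weight_pos hβ hq _ _).le)
        (Finset.mem_filter.2 ⟨Finset.mem_powerset.2 hS, hA⟩)
    refine le_trans ?_ h1
    calc p ^ (n * n + n) ≤ p ^ (bondsIn J Λ).card := pow_le_pow_of_le_one hp.le hp1 hE
      _ = (∏ _e ∈ bondsIn J Λ, p) * 1 := by rw [Finset.prod_const, mul_one]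
      _ ≤ weight J β q Λ (glue Λ η S) := by
        refine mul_le_mul ?_ (one_le_pow₀ hq) zero_le_one ?_
        · refine Finset.prod_le_prod (fun _ _ => hp.le) (fun e _ => ?_)
          split_ifs
          · exact (hpb e).1
          · exact (hpb e).2
        · refine Finset.prod_nonneg (fun e _ => ?_)
          have h1 := bondProb_pos hβ e
          have h3 := bondProb_lt_one (β := β) e
          split_ifs <;> linarith
  · calc partitionFn J β q Λ η ≤ ∑ _S ∈ (bondsIn J Λ).powerset, q ^ n := by
          refine Finset.sum_le_sum fun S _ => ?_
          calc weight J β q Λ (glue Λ η S) ≤ 1 * q ^ n := by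
                refine mul_le_mul ?_ (pow_le_pow_right₀ hq (numClusters_le_card _ _))
                  (by positivity) zero_le_one
                refine Finset.prod_le_one (fun e _ => ?_) (fun e _ => ?_)
                · have h1 := bondProb_pos hβ e
                  have h3 := bondProb_lt_one (β := β) e
                  split_ifs <;> linarith
                · have h1 := bondProb_pos hβ e
                  have h3 := bondProb_lt_one (β := β) e
                  split_ifs <;> linarith
            _ = q ^ n := one_mul _
      _ = 2 ^ (bondsIn J Λ).card * q ^ n := by
          rw [Finset.sum_const, Finset.card_powerset, nsmul_eq_mul]; push_cast; ring
      _ ≤ 2 ^ (n * n + n) * q ^ n :=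
          mul_le_mul_of_nonneg_right (pow_le_pow_right₀ one_le_two hE) (by positivity)

end FiniteEnergy

/-! ### Measurability of connection events -/

section Measurability

/-- Reachability in exactly `n` steps. -/
def stepReach (ω : Config J) : ℕ → (Fin d → ℤ) → (Fin d → ℤ) → Prop
  | 0, x, y => x = y
  | n + 1, x, y => ∃ z, (openGraph ω).Adj x z ∧ stepReach ω n z y

/-- This writes connection by countable operations on the states of single bonds, from which
measurability follows. -/
lemma mem_cluster_iff_stepReach {ω : Config J} {x y : Fin d → ℤ} :
    y ∈ cluster ω x ↔ ∃ n, stepReach ω n x y := by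
  constructor
  · rintro ⟨w⟩
    induction w with
    | nil => exact ⟨0, rfl⟩
    | cons h _ ih => obtain ⟨n, hn⟩ := ih; exact ⟨n + 1, _, h, hn⟩
  · rintro ⟨n, hn⟩
    induction n generalizing x with
    | zero => rw [stepReach] at hn; rw [hn]; exact mem_cluster_self _ _
    | succ n ih =>
      obtain ⟨z, hz, h⟩ := hn
      exact SimpleGraph.Reachable.trans hz.reachable (ih h)

lemma measurable_adj (x y : Fin d → ℤ) : Measurable fun ω : Config J => (openGraph ω).Adj x y := by
  by_cases h : s(x, y) ∈ (bondGraph J).edgeSet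
  · have : (fun ω : Config J => (openGraph ω).Adj x y) = fun ω => ω ⟨s(x, y), h⟩ = true := by
      funext ω
      rw [openGraph_adj]
      exact propext ⟨fun ⟨_, h⟩ => h, fun h' => ⟨h, h'⟩⟩
    rw [this]
    have h1 : MeasurableSet ((fun ω : Config J => ω ⟨s(x, y), h⟩) ⁻¹' {true}) :=
      measurable_pi_apply (⟨s(x, y), h⟩ : Bond J) (MeasurableSet.singleton true)
    exact measurableSet_setOfPred.1 h1
  · have : (fun ω : Config J => (openGraph ω).Adj x y) = fun ω => False := by
      funext ω
      rw [openGraph_adj]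
      exact propext ⟨fun ⟨h', _⟩ => h h', False.elim⟩
    rw [this]; exact measurable_const

lemma measurable_mem_cluster (x y : Fin d → ℤ) :
    Measurable fun ω : Config J => y ∈ cluster ω x := by
  have h : ∀ n x, Measurable fun ω : Config J => stepReach ω n x y := by
    intro n
    induction n with
    | zero => intro x; exact measurable_const
    | succ n ih => intro x; exact Measurable.exists fun z => (measurable_adj x z).and (ih z)
  simp_rw [mem_cluster_iff_stepReach]
  exact Measurable.exists fun n => h n x

lemma measurableSet_connected (x y : Fin d → ℤ) : MeasurableSet (connected J x y) :=
  measurableSet_setOfPred.2 (measurable_mem_cluster x y)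

lemma isUpperSet_connected (x y : Fin d → ℤ) : IsUpperSet (connected J x y) :=
  fun _ _ h hx => cluster_mono h x hx

end Measurability

end

section
variable {d : ℕ} {J : Coupling d}

/-! ### Translation covariance -/

section Translation

/-- The set of sites `Λ + v`. -/
def translate (v : Fin d → ℤ) (Λ : Finset (Fin d → ℤ)) : Finset (Fin d → ℤ) :=
  Λ.map (addRightEmbedding v)

lemma mem_translate {v y : Fin d → ℤ} {Λ : Finset (Fin d → ℤ)} :
    y ∈ translate v Λ ↔ y - v ∈ Λ := by
  simp only [translate, Finset.mem_map, addRightEmbedding_apply]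
  constructor
  · rintro ⟨a, ha, rfl⟩; simpa using ha
  · exact fun h => ⟨_, h, by simp⟩

lemma translate_mem_edgeSet (v : Fin d → ℤ) {e : Sym2 (Fin d → ℤ)}
    (he : e ∈ (bondGraph J).edgeSet) : e.map (· + v) ∈ (bondGraph J).edgeSet := by
  induction e using Sym2.ind with
  | _ x y =>
    have h := bondGraph_adj.1 ((SimpleGraph.mem_edgeSet _).1 he)
    rw [Sym2.map_mk, SimpleGraph.mem_edgeSet, bondGraph_adj]
    exact ⟨by simpa using h.1, by simpa using h.2⟩

/-- The translation of bonds by `v`. -/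
def shiftBond (J : Coupling d) (v : Fin d → ℤ) : Bond J ≃ Bond J where
  toFun e := ⟨e.1.map (· + v), translate_mem_edgeSet v e.2⟩
  invFun e := ⟨e.1.map (· + -v), translate_mem_edgeSet (-v) e.2⟩
  left_inv := by
    rintro ⟨e, he⟩
    apply Subtype.ext
    induction e using Sym2.ind with
    | _ x y => simp
  right_inv := by
    rintro ⟨e, he⟩
    apply Subtype.ext
    induction e using Sym2.ind with
    | _ x y => simp

/-- The configuration seen from `v`. -/
def shift (v : Fin d → ℤ) (ω : Config J) : Config J := fun e => ω (shiftBond J v e)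

lemma shift_adj {v : Fin d → ℤ} {ω : Config J} {x y : Fin d → ℤ} :
    (openGraph (shift v ω)).Adj x y ↔ (openGraph ω).Adj (x + v) (y + v) := by
  rw [openGraph_adj, openGraph_adj]
  constructor
  · rintro ⟨h, h'⟩; exact ⟨translate_mem_edgeSet v h, h'⟩
  · rintro ⟨h, h'⟩
    have h1 : s(x, y) ∈ (bondGraph J).edgeSet := by
      have := translate_mem_edgeSet (-v) h
      simpa using this
    exact ⟨h1, h'⟩

lemma mem_cluster_shift {v : Fin d → ℤ} {ω : Config J} {x y : Fin d → ℤ} :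
    y ∈ cluster (shift v ω) x ↔ y + v ∈ cluster ω (x + v) := by
  constructor
  · intro h
    exact cluster_induction (p := fun y => y + v ∈ cluster ω (x + v)) (mem_cluster_self _ _)
      (fun a b _ ha hab => mem_cluster_of_adj ha (shift_adj.1 hab)) h
  · intro h
    have := cluster_induction (p := fun y => y - v ∈ cluster (shift v ω) x)
      (by simpa using mem_cluster_self _ _)
      (fun a b _ ha hab => mem_cluster_of_adj ha (shift_adj.2 (by simpa using hab))) h
    simpa using this

lemma shift_connected (v x y : Fin d → ℤ) :
    {ω : Config J | shift v ω ∈ connected J x y} = connected J (x + v) (y + v) := by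
  ext ω; exact mem_cluster_shift

lemma bondProb_shiftBond (β : ℝ) (v : Fin d → ℤ) (e : Bond J) :
    bondProb J β (shiftBond J v e).1 = bondProb J β e.1 := by
  obtain ⟨e, he⟩ := e
  induction e using Sym2.ind with
  | _ x y =>
    change bondProb J β s(x + v, y + v) = _
    rw [bondProb_mk, bondProb_mk, add_sub_add_right_eq_sub]

lemma shiftBond_mem_bondsIn {v : Fin d → ℤ} {Λ : Finset (Fin d → ℤ)} {e : Bond J} :
    shiftBond J v e ∈ bondsIn J (translate v Λ) ↔ e ∈ bondsIn J Λ := by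
  obtain ⟨e, he⟩ := e
  induction e using Sym2.ind with
  | _ x y =>
    rw [mem_bondsIn, mem_bondsIn]
    simp [shiftBond, mem_translate]

lemma numClusters_translate (v : Fin d → ℤ) (Λ : Finset (Fin d → ℤ)) (ω : Config J) :
    numClusters (translate v Λ) ω = numClusters Λ (shift v ω) := by
  rw [numClusters_eq, numClusters_eq]
  have hinj : Function.Injective (fun s : Set (Fin d → ℤ) => (· + v) '' s) :=
    Set.image_injective.2 (add_left_injective v)
  rw [← Set.ncard_image_of_injective (cluster (shift v ω) '' _) hinj, Set.image_image]
  congr 1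
  have h : ∀ x, (· + v) '' cluster (shift v ω) x = cluster ω (x + v) := by
    intro x
    ext y
    constructor
    · rintro ⟨z, hz, rfl⟩; exact mem_cluster_shift.1 hz
    · exact fun hy => ⟨y - v, mem_cluster_shift.2 (by simpa using hy), by simp⟩
  ext s
  simp only [Set.mem_image, h, Finset.mem_coe, mem_translate]
  constructor
  · rintro ⟨x, hx, rfl⟩; exact ⟨x - v, hx, by simp⟩
  · rintro ⟨x, hx, rfl⟩; exact ⟨x + v, by simpa using hx, rfl⟩

lemma weight_translate (β q : ℝ) (v : Fin d → ℤ) (Λ : Finset (Fin d → ℤ)) (ω : Config J) :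
    weight J β q (translate v Λ) ω = weight J β q Λ (shift v ω) := by
  unfold weight
  rw [numClusters_translate]
  congr 1
  symm
  refine Finset.prod_equiv (shiftBond J v) (fun e => shiftBond_mem_bondsIn.symm) fun e _ => ?_
  rw [bondProb_shiftBond]
  rfl

lemma shift_glue (v : Fin d → ℤ) (Λ : Finset (Fin d → ℤ)) (η : Config J) (S : Finset (Bond J)) :
    shift v (glue (translate v Λ) η (S.map (shiftBond J v).toEmbedding)) =
      glue Λ (shift v η) S := by
  funext e
  unfold shift glue
  simp only [shiftBond_mem_bondsIn, Finset.mem_map_equiv, Equiv.symm_apply_apply]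

lemma finVolMeasure_translate {β q : ℝ} (hβ : 0 < β) (hq : 1 ≤ q) (v : Fin d → ℤ)
    (Λ : Finset (Fin d → ℤ)) (η : Config J) (A : Set (Config J)) :
    (finVolMeasure J β q (translate v Λ) η).real {ω | shift v ω ∈ A} =
      (finVolMeasure J β q Λ (shift v η)).real A := by
  classical
  have hmem : ∀ S : Finset (Bond J), S ∈ (bondsIn J Λ).powerset ↔
      S.map (shiftBond J v).toEmbedding ∈ (bondsIn J (translate v Λ)).powerset := by
    intro S
    rw [Finset.mem_powerset, Finset.mem_powerset]
    constructor
    · intro h e he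
      rw [Finset.mem_map] at he
      obtain ⟨e, he, rfl⟩ := he
      exact shiftBond_mem_bondsIn.2 (h he)
    · exact fun h e he => shiftBond_mem_bondsIn.1 (h (Finset.mem_map_of_mem _ he))
  have hZ : partitionFn J β q Λ (shift v η) = partitionFn J β q (translate v Λ) η := by
    refine Finset.sum_equiv (Equiv.finsetCongr (shiftBond J v)) hmem fun S _ => ?_
    rw [weight_translate, Equiv.finsetCongr_apply, shift_glue]
  rw [finVolMeasure_real hβ hq, finVolMeasure_real hβ hq, hZ]
  congr 1
  symm
  refine Finset.sum_equiv (Equiv.finsetCongr (shiftBond J v)) (fun S => ?_) fun S _ => ?_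
  · rw [Finset.mem_filter, Finset.mem_filter, hmem, Set.mem_ofPred_eq, Equiv.finsetCongr_apply,
      shift_glue]
  · rw [weight_translate, Equiv.finsetCongr_apply, shift_glue]

end Translation

/-! ### Decay for all boundary conditions -/

section Decay

variable {β q : ℝ}

/-- The event that the cluster of `v` is not contained in `Λ`. -/
def exits (J : Coupling d) (v : Fin d → ℤ) (Λ : Finset (Fin d → ℤ)) : Set (Config J) :=
  {ω | ∃ y, y ∉ Λ ∧ y ∈ cluster ω v}

lemma isUpperSet_exits (v : Fin d → ℤ) (Λ : Finset (Fin d → ℤ)) : IsUpperSet (exits J v Λ) :=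
  fun _ _ h ⟨y, hy, hyv⟩ => ⟨y, hy, cluster_mono h v hyv⟩

lemma measurableSet_exits (v : Fin d → ℤ) (Λ : Finset (Fin d → ℤ)) :
    MeasurableSet (exits J v Λ) :=
  measurableSet_setOfPred.2
    (Measurable.exists fun y => measurable_const.and (measurable_mem_cluster v y))

/-- The supremum only provides decay at some larger `β'`; the exit event is increasing, so its wired
probability at `β` is no larger. -/
lemma wiredDecay_of_lt_betaHat (hβ : 0 < β) (hq : 1 ≤ q) (h : (β : EReal) < betaHat J q) :
    WiredDecay J β q := by
  obtain ⟨_, ⟨β', ⟨-, hβ'⟩, rfl⟩, hlt⟩ := lt_sSup_iff.1 h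
  have hlt : β < β' := EReal.coe_lt_coe_iff.1 hlt
  obtain ⟨ν₀, ν₁, h0, h1, hN⟩ := hβ'
  exact ⟨ν₀, ν₁, h0, h1, fun N => (finVolMeasure_mono hβ hlt.le hq _ le_rfl
    (isUpperSet_exits 0 (box d N))).trans (hN N)⟩

/-- Exponential decay in translated boxes, with any boundary condition. -/
lemma finVolMeasure_exits_le (hβ : 0 < β) (hq : 1 ≤ q) {ν₀ ν₁ : ℝ}
    (hdec : ∀ N : ℕ, (finVolMeasure J β q (box d N) (fun _ => true)).real
      (exits J 0 (box d N)) ≤ ν₀ * Real.exp (-ν₁ * N)) (v : Fin d → ℤ) (N : ℕ) (η : Config J) :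
    (finVolMeasure J β q (translate v (box d N)) η).real (exits J v (translate v (box d N))) ≤
      ν₀ * Real.exp (-ν₁ * N) := by
  have h1 : exits J v (translate v (box d N)) = {ω | shift v ω ∈ exits J 0 (box d N)} := by
    ext ω
    constructor
    · rintro ⟨y, hy, hyv⟩
      exact ⟨y - v, fun h => hy (mem_translate.2 h), mem_cluster_shift.2 (by simpa using hyv)⟩
    · rintro ⟨y, hy, hyv⟩
      refine ⟨y + v, fun h => hy (by simpa using mem_translate.1 h), ?_⟩
      simpa using mem_cluster_shift.1 hyv
  refine (finVolMeasure_mono hβ le_rfl hq _ (le_top : η ≤ ⊤) (isUpperSet_exits _ _)).trans ?_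
  rw [h1, finVolMeasure_translate hβ hq]
  exact hdec N

end Decay

/-! ### Events seen inside a finite set -/

section Restriction

open Classical in
/-- The configuration `ω` with all the bonds outside `D` closed. -/
def restrict (D : Finset (Fin d → ℤ)) (ω : Config J) : Config J :=
  fun e => ω e && decide (e ∈ bondsIn J D)

lemma restrict_le (D : Finset (Fin d → ℤ)) (ω : Config J) : restrict D ω ≤ ω := by
  intro e; simp only [restrict]; cases ω e <;> simp

lemma restrict_mono (D : Finset (Fin d → ℤ)) {ω ω' : Config J} (h : ω ≤ ω') :
    restrict D ω ≤ restrict D ω' := by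
  intro e
  have := h e
  simp only [restrict]
  revert this
  cases ω e <;> cases ω' e <;> simp

lemma restrict_mono_set {D D' : Finset (Fin d → ℤ)} (h : D ⊆ D') (ω : Config J) :
    restrict D ω ≤ restrict D' ω := by
  intro e
  simp only [restrict]
  by_cases he : e ∈ bondsIn J D
  · simp [he, bondsIn_mono h he]
  · simp [he]

lemma restrict_adj {D : Finset (Fin d → ℤ)} {ω : Config J} {x y : Fin d → ℤ} :
    (openGraph (restrict D ω)).Adj x y ↔ (openGraph ω).Adj x y ∧ x ∈ D ∧ y ∈ D := by
  classical
  rw [openGraph_adj, openGraph_adj]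
  constructor
  · rintro ⟨h, h'⟩
    simp only [restrict, Bool.and_eq_true, decide_eq_true_eq] at h'
    exact ⟨⟨h, h'.1⟩, mk_mem_bondsIn.1 h'.2⟩
  · rintro ⟨⟨h, h'⟩, h''⟩
    refine ⟨h, ?_⟩
    simp only [restrict, Bool.and_eq_true, decide_eq_true_eq]
    exact ⟨h', mk_mem_bondsIn.2 h''⟩

lemma measurable_restrict (D : Finset (Fin d → ℤ)) :
    Measurable (restrict D : Config J → Config J) := by
  rw [measurable_pi_iff]
  intro e
  exact (measurable_of_countable (fun b : Bool => b && _)).comp (measurable_pi_apply e)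

/-- The event `A` depends only on the bonds inside `D`. -/
def DependsOnlyOn (D : Finset (Fin d → ℤ)) (A : Set (Config J)) : Prop :=
  ∀ ω ω' : Config J, (∀ e ∈ bondsIn J D, ω e = ω' e) → (ω ∈ A ↔ ω' ∈ A)

lemma restrict_congr {D : Finset (Fin d → ℤ)} {ω ω' : Config J}
    (h : ∀ e ∈ bondsIn J D, ω e = ω' e) : restrict D ω = restrict D ω' := by
  classical
  funext e
  by_cases he : e ∈ bondsIn J D
  · simp [restrict, h e he]
  · simp [restrict, he]

lemma dependsOnlyOn_restrict (D : Finset (Fin d → ℤ)) (A : Set (Config J)) :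
    DependsOnlyOn D {ω | restrict D ω ∈ A} := by
  intro ω ω' h
  rw [Set.mem_ofPred_eq, Set.mem_ofPred_eq, restrict_congr h]

lemma isUpperSet_restrict (D : Finset (Fin d → ℤ)) {A : Set (Config J)} (hA : IsUpperSet A) :
    IsUpperSet {ω | restrict D ω ∈ A} :=
  fun _ _ h hω => hA (restrict_mono D h) hω

/-- Two connected sites are connected inside a large box. -/
lemma exists_restrict_of_mem_cluster {ω : Config J} {x y : Fin d → ℤ} (h : y ∈ cluster ω x) :
    ∃ N, y ∈ cluster (restrict (box d N) ω) x := by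
  have hbox : ∀ z : Fin d → ℤ, ∃ N, z ∈ box d N := by
    intro z
    refine ⟨∑ i, (z i).natAbs, mem_box.2 fun i => ?_⟩
    rw [Int.abs_eq_natAbs]
    exact_mod_cast Finset.single_le_sum (f := fun i => (z i).natAbs) (fun _ _ => Nat.zero_le _)
      (Finset.mem_univ i)
  have hmono : ∀ {M N : ℕ}, M ≤ N → box d M ⊆ box d N := by
    intro M N hMN z hz
    exact mem_box.2 fun i => (mem_box.1 hz i).trans (by exact_mod_cast hMN)
  refine cluster_induction (p := fun y => ∃ N, y ∈ cluster (restrict (box d N) ω) x)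
    ⟨0, mem_cluster_self _ _⟩ (fun a b _ ⟨N, hN⟩ hab => ?_) h
  obtain ⟨Na, ha⟩ := hbox a
  obtain ⟨Nb, hb⟩ := hbox b
  refine ⟨max N (max Na Nb), mem_cluster_of_adj
    (cluster_mono (restrict_mono_set (hmono (le_max_left _ _)) ω) x hN) (restrict_adj.2
      ⟨hab, hmono (le_max_of_le_right (le_max_left _ _)) ha,
        hmono (le_max_of_le_right (le_max_right _ _)) hb⟩)⟩

end Restriction

end

section
variable {d : ℕ} {J : Coupling d} {β q : ℝ} {P : Measure (Config J)}

/-! ### Consequences of the DLR equations -/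

section DLR

/-- The event `A` depends only on the bonds that are not inside `Λ`. -/
def DependsOnlyOff (Λ : Finset (Fin d → ℤ)) (A : Set (Config J)) : Prop :=
  ∀ ω ω' : Config J, (∀ e, e ∉ bondsIn J Λ → ω e = ω' e) → (ω ∈ A ↔ ω' ∈ A)

lemma DependsOnlyOff.mono {Λ Λ' : Finset (Fin d → ℤ)} (h : Λ' ⊆ Λ) {A : Set (Config J)}
    (hA : DependsOnlyOff Λ A) : DependsOnlyOff Λ' A :=
  fun ω ω' h' => hA ω ω' fun e he => h' e fun he' => he (bondsIn_mono h he')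

lemma DependsOnlyOff.inter {Λ : Finset (Fin d → ℤ)} {A B : Set (Config J)}
    (hA : DependsOnlyOff Λ A) (hB : DependsOnlyOff Λ B) : DependsOnlyOff Λ (A ∩ B) :=
  fun ω ω' h => and_congr (hA ω ω' h) (hB ω ω' h)

lemma dependsOnlyOff_univ (Λ : Finset (Fin d → ℤ)) :
    DependsOnlyOff Λ (Set.univ : Set (Config J)) := fun _ _ _ => Iff.rfl

lemma DependsOnlyOn.dependsOnlyOff {D Λ : Finset (Fin d → ℤ)} {A : Set (Config J)}
    (hA : DependsOnlyOn D A) (h : Disjoint D Λ) : DependsOnlyOff Λ A := by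
  refine fun ω ω' h' => hA ω ω' fun e he => h' e fun he' => ?_
  obtain ⟨e, heb⟩ := e
  induction e using Sym2.ind with
  | _ x y =>
    exact Finset.disjoint_left.1 h (mk_mem_bondsIn.1 he).1 (mk_mem_bondsIn.1 he').1

lemma DependsOnlyOn.mono {D D' : Finset (Fin d → ℤ)} (h : D ⊆ D') {A : Set (Config J)}
    (hA : DependsOnlyOn D A) : DependsOnlyOn D' A :=
  fun ω ω' h' => hA ω ω' fun e he => h' e (bondsIn_mono h he)

lemma outsideSigma_le (Λ : Finset (Fin d → ℤ)) :
    outsideSigma J Λ ≤ (inferInstance : MeasurableSpace (Config J)) :=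
  iSup_le fun e => (measurable_pi_apply e.1).comap_le

/-- Closing all bonds inside `Λ` is a map measurable for the outside `σ`-algebra, and an event that
ignores those bonds is its own preimage under this map. -/
lemma measurableSet_outsideSigma {Λ : Finset (Fin d → ℤ)} {A : Set (Config J)}
    (hA : MeasurableSet A) (h : DependsOnlyOff Λ A) : MeasurableSet[outsideSigma J Λ] A := by
  have h1 : Measurable[outsideSigma J Λ] (fun ω : Config J => glue Λ ω ∅) := by
    refine @measurable_pi_lambda _ _ _ (outsideSigma J Λ) _ _ fun e => ?_
    by_cases he : e ∈ bondsIn J Λ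
    · have : (fun ω : Config J => glue Λ ω ∅ e) = fun _ => false := by
        funext ω; simp [glue, he]
      rw [this]
      exact @measurable_const _ _ _ (outsideSigma J Λ) _
    · have : (fun ω : Config J => glue Λ ω ∅ e) = fun ω => ω e := by
        funext ω; rw [glue_apply_of_notMem _ _ he]
      rw [this]
      refine measurable_iff_comap_le.2 ?_
      exact le_iSup (fun e : {e : Bond J // e ∉ bondsIn J Λ} =>
        MeasurableSpace.comap (fun ω : Config J => ω e.1) (inferInstance : MeasurableSpace Bool))
        ⟨e, he⟩
  have h2 : A = (fun ω : Config J => glue Λ ω ∅) ⁻¹' A := by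
    ext ω
    exact h _ _ fun e he => (glue_apply_of_notMem _ _ he).symm
  rw [h2]
  exact h1 hA

/-- The kernel agrees almost everywhere with a conditional expectation, so its dependence on `η`
need not be examined directly. -/
lemma IsRandomCluster.integrable (hP : IsRandomCluster J β q P) (Λ : Finset (Fin d → ℤ))
    {B : Set (Config J)} (hB : MeasurableSet B) :
    Integrable (fun η => (finVolMeasure J β q Λ η).real B) P :=
  integrable_condExp.congr (hP.dlr Λ B hB)

lemma IsRandomCluster.real_inter (hP : IsRandomCluster J β q P) (Λ : Finset (Fin d → ℤ))
    {G B : Set (Config J)} (hG : MeasurableSet G) (hGΛ : DependsOnlyOff Λ G)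
    (hB : MeasurableSet B) :
    P.real (G ∩ B) = ∫ η in G, (finVolMeasure J β q Λ η).real B ∂P := by
  have := hP.isProb
  have hm := outsideSigma_le (J := J) Λ
  have h1 := setIntegral_condExp (μ := P) hm
    ((integrable_const (1 : ℝ)).indicator hB) (measurableSet_outsideSigma hG hGΛ)
  rw [← setIntegral_congr_ae hG ((hP.dlr Λ B hB).mono fun _ h _ => h), h1,
    integral_indicator hB, Measure.restrict_restrict hB]
  simp [Set.inter_comm]

lemma IsRandomCluster.real_inter_le (hP : IsRandomCluster J β q P) (Λ : Finset (Fin d → ℤ))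
    {G B : Set (Config J)} (hG : MeasurableSet G) (hGΛ : DependsOnlyOff Λ G)
    (hB : MeasurableSet B) {c : ℝ} (h : ∀ η ∈ G, (finVolMeasure J β q Λ η).real B ≤ c) :
    P.real (G ∩ B) ≤ c * P.real G := by
  have := hP.isProb
  rw [hP.real_inter Λ hG hGΛ hB]
  refine (setIntegral_mono_on (hP.integrable Λ hB).integrableOn
    (integrable_const c).integrableOn hG h).trans (le_of_eq ?_)
  simp [mul_comm]

lemma IsRandomCluster.le_real_inter (hP : IsRandomCluster J β q P) (Λ : Finset (Fin d → ℤ))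
    {G B : Set (Config J)} (hG : MeasurableSet G) (hGΛ : DependsOnlyOff Λ G)
    (hB : MeasurableSet B) {c : ℝ} (h : ∀ η ∈ G, c ≤ (finVolMeasure J β q Λ η).real B) :
    c * P.real G ≤ P.real (G ∩ B) := by
  have := hP.isProb
  rw [hP.real_inter Λ hG hGΛ hB]
  refine (le_of_eq ?_).trans (setIntegral_mono_on
    (integrable_const c).integrableOn (hP.integrable Λ hB).integrableOn hG h)
  simp [mul_comm]

/-- The closed boundary condition is the smallest, so `P` is an average of larger probabilities.
Together with the converse bound `le_of_closed_le` below, this reduces many statements about `P` to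
closed boundary conditions. -/
lemma IsRandomCluster.closed_le (hP : IsRandomCluster J β q P) (hβ : 0 < β) (hq : 1 ≤ q)
    (Λ : Finset (Fin d → ℤ)) {A : Set (Config J)} (hA : MeasurableSet A) (hAu : IsUpperSet A) :
    (finVolMeasure J β q Λ ⊥).real A ≤ P.real A := by
  have := hP.isProb
  have := hP.le_real_inter Λ MeasurableSet.univ (dependsOnlyOff_univ Λ) hA
    (c := (finVolMeasure J β q Λ ⊥).real A)
    (fun η _ => finVolMeasure_mono hβ le_rfl hq Λ bot_le hAu)
  simpa using this

/-- If any configuration in `A` can be turned into one of `A'` by changing bonds inside `Λ`, then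
`P A` is at most a constant, that depends only on the size of `Λ`, times `P A'`. -/
lemma exists_energy_const (J : Coupling d) (hβ : 0 < β) (hq : 1 ≤ q) :
    ∃ c : ℕ → ℝ, (∀ n, 0 < c n) ∧ ∀ P : Measure (Config J), IsRandomCluster J β q P →
      ∀ (Λ : Finset (Fin d → ℤ)) (A A' : Set (Config J)), MeasurableSet A → MeasurableSet A' →
        (∀ ω ∈ A, ∃ ω' ∈ A', ∀ e, e ∉ bondsIn J Λ → ω' e = ω e) →
          c Λ.card * P.real A ≤ P.real A' := by
  classical
  obtain ⟨c, hc, h⟩ := finite_energy J hβ hq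
  refine ⟨c, hc, fun P hP Λ A A' hA hA' hAA' => ?_⟩
  have := hP.isProb
  have h1 := hP.real_inter Λ MeasurableSet.univ (dependsOnlyOff_univ Λ) hA'
  rw [Set.univ_inter, setIntegral_univ] at h1
  rw [h1]
  have h2 : ∫ η in A, c Λ.card ∂P ≤ ∫ η in A, (finVolMeasure J β q Λ η).real A' ∂P := by
    refine setIntegral_mono_on (integrable_const _).integrableOn
      (hP.integrable Λ hA').integrableOn hA fun η hη => ?_
    obtain ⟨ω', hω', hωe⟩ := hAA' η hη
    -- A configuration that differs from `η` only inside `Λ` is one of the atoms of the kernel at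
    -- `η`, so finite energy bounds the kernel from below on `A`.
    rw [eq_glue hωe] at hω'
    exact h Λ η _ (Finset.filter_subset _ _) A' hω'
  refine le_trans (le_of_eq ?_) (h2.trans (setIntegral_le_integral (hP.integrable Λ hA')
    (Filter.Eventually.of_forall fun _ => measureReal_nonneg)))
  simp [mul_comm]

end DLR

/-! ### Blocking and decoupling -/

section Blocking

open Classical in
/-- The sites of `Λ` whose cluster leaves `Λ`. -/
def outer (Λ : Finset (Fin d → ℤ)) (ω : Config J) : Finset (Fin d → ℤ) :=
  Λ.filter (fun w => ω ∈ exits J w Λ)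

lemma mem_outer {Λ : Finset (Fin d → ℤ)} {ω : Config J} {w : Fin d → ℤ} :
    w ∈ outer Λ ω ↔ w ∈ Λ ∧ ∃ y, y ∉ Λ ∧ y ∈ cluster ω w := by
  classical
  unfold outer
  rw [Finset.mem_filter]
  rfl

/-- The unrevealed set `Λ \ outer Λ ω` is a union of whole clusters: no open bond leaves it. -/
lemma mem_of_adj_outer {Λ : Finset (Fin d → ℤ)} {ω : Config J} {a b : Fin d → ℤ}
    (ha : a ∈ Λ \ outer Λ ω) (hab : (openGraph ω).Adj a b) : b ∈ Λ \ outer Λ ω := by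
  rw [Finset.mem_sdiff, mem_outer] at ha ⊢
  obtain ⟨haΛ, ha⟩ := ha
  have hab' : b ∈ cluster ω a := mem_cluster_of_adj (mem_cluster_self _ _) hab
  refine ⟨?_, ?_⟩
  · by_contra hb
    exact ha ⟨haΛ, b, hb, hab'⟩
  · rintro ⟨-, y, hy, hyb⟩
    exact ha ⟨haΛ, y, hy, by rwa [← cluster_eq_of_mem hab']⟩

lemma adj_congr {V : Finset (Fin d → ℤ)} {ω ω' : Config J}
    (h : ∀ e, e ∉ bondsIn J V → ω' e = ω e) {a b : Fin d → ℤ} (ha : a ∉ V) :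
    (openGraph ω').Adj a b ↔ (openGraph ω).Adj a b := by
  rw [openGraph_adj, openGraph_adj]
  refine exists_congr fun hb => ?_
  rw [h _ fun h' => ha (mk_mem_bondsIn.1 h').1]

/-- Exploring the clusters from outside never looks at bonds inside the unrevealed set `V`. As bonds
between `V` and its complement are closed in both configurations, a change inside `V` cannot join it
to the exterior. -/
lemma outer_congr {Λ : Finset (Fin d → ℤ)} {ω ω' : Config J}
    (h : ∀ e, e ∉ bondsIn J (Λ \ outer Λ ω) → ω' e = ω e) : outer Λ ω' = outer Λ ω := by
  set V := Λ \ outer Λ ω with hV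
  have hadj : ∀ a b, a ∉ V → ((openGraph ω').Adj a b ↔ (openGraph ω).Adj a b) :=
    fun a b ha => adj_congr h ha
  have hVω : ∀ a b, a ∈ V → (openGraph ω).Adj a b → b ∈ V := fun a b => mem_of_adj_outer
  have hVω' : ∀ a b, a ∈ V → (openGraph ω').Adj a b → b ∈ V := by
    intro a b ha hab
    by_contra hb
    exact hb (hVω a b ha ((hadj b a hb).1 hab.symm).symm)
  ext w
  constructor
  · intro hw
    obtain ⟨hwΛ, y, hy, hyw⟩ := mem_outer.1 hw
    by_contra hwo
    have hwV : w ∈ V := Finset.mem_sdiff.2 ⟨hwΛ, hwo⟩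
    have : y ∈ V := cluster_induction (p := fun y => y ∈ V) hwV
      (fun a b _ ha hab => hVω' a b ha hab) hyw
    exact hy (Finset.mem_sdiff.1 this).1
  · intro hw
    obtain ⟨hwΛ, y, hy, hyw⟩ := mem_outer.1 hw
    have hwV : w ∉ V := fun h => (Finset.mem_sdiff.1 h).2 hw
    refine mem_outer.2 ⟨hwΛ, y, hy, ?_⟩
    refine (cluster_induction (p := fun y => y ∉ V ∧ y ∈ cluster ω' w)
      ⟨hwV, mem_cluster_self _ _⟩ (fun a b _ ha hab => ⟨fun hb => ?_, ?_⟩) hyw).2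
    · exact ha.1 (hVω b a hb hab.symm)
    · exact mem_cluster_of_adj ha.2 ((hadj a b ha.1).2 hab)

/-- When no open bond joins `V` to its complement, the boundary condition is equivalent to the
closed one. -/
lemma finVolMeasure_eq_closed (hβ : 0 < β) (hq : 1 ≤ q) {V : Finset (Fin d → ℤ)} {ω : Config J}
    (h : ∀ a b, a ∈ V → (openGraph ω).Adj a b → b ∈ V) {A : Set (Config J)}
    (hA : DependsOnlyOn V A) :
    (finVolMeasure J β q V ω).real A = (finVolMeasure J β q V ⊥).real A := by
  classical
  have hmem : ∀ S, glue V ω S ∈ A ↔ glue V ⊥ S ∈ A := by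
    refine fun S => hA _ _ fun e he => ?_
    simp [glue, he]
  -- Clusters started in `V` never leave it, so the exterior contributes nothing to the number of
  -- clusters that meet `V`.
  have hcl : ∀ S x, x ∈ V → cluster (glue V ω S) x = cluster (glue V ⊥ S) x := by
    intro S x hx
    apply Set.Subset.antisymm
    · intro y hy
      refine (cluster_induction (p := fun y => y ∈ V ∧ y ∈ cluster (glue V ⊥ S) x)
        ⟨hx, mem_cluster_self _ _⟩ (fun a b _ ha hab => ?_) hy).2
      have hb : b ∈ V := by
        by_contra hb
        refine hb (h a b ha.1 ?_)
        exact ((adj_congr (fun e he => glue_apply_of_notMem ω S he) hb).1 hab.symm).symm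
      refine ⟨hb, mem_cluster_of_adj ha.2 ?_⟩
      obtain ⟨h1, h2⟩ := openGraph_adj.1 hab
      refine openGraph_adj.2 ⟨h1, ?_⟩
      have he := mk_mem_bondsIn (h := h1).2 ⟨ha.1, hb⟩
      rwa [glue_apply_of_mem _ he] at h2 ⊢
    · exact cluster_mono (glue_mono bot_le subset_rfl) x
  have hw : ∀ S, weight J β q V (glue V ω S) = weight J β q V (glue V ⊥ S) := by
    intro S
    unfold weight
    rw [numClusters_eq, numClusters_eq, Set.image_congr fun x hx => hcl S x hx]
    congr 1
    refine Finset.prod_congr rfl fun e he => ?_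
    simp only [glue_apply_of_mem _ he]
  rw [finVolMeasure_real hβ hq, finVolMeasure_real hβ hq, partitionFn, partitionFn]
  simp only [hmem, hw]

lemma measurableSet_outer_eq (Λ o : Finset (Fin d → ℤ)) :
    MeasurableSet {ω : Config J | outer Λ ω = o} := by
  have : {ω : Config J | outer Λ ω = o} =
      {ω | ∀ w, (w ∈ Λ ∧ ω ∈ exits J w Λ) ↔ w ∈ o} := by
    ext ω
    simp only [Set.mem_ofPred_eq, Finset.ext_iff, mem_outer]
    rfl
  rw [this]
  refine measurableSet_setOfPred.2 (Measurable.forall fun w => ?_)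
  have : Measurable fun ω : Config J => ω ∈ exits J w Λ :=
    measurableSet_setOfPred.1 (measurableSet_exits w Λ)
  exact (measurable_const.and this).iff measurable_const

/-- When `D` is not connected to the complement of `Λ`, what happens inside `D` is governed by a
mixture of measures with closed boundary condition, whatever happens outside `Λ`. -/
lemma IsRandomCluster.real_inter_blocked_le (hP : IsRandomCluster J β q P) (hβ : 0 < β)
    (hq : 1 ≤ q) {D Λ : Finset (Fin d → ℤ)} (hDΛ : D ⊆ Λ) {G A : Set (Config J)}
    (hG : MeasurableSet G) (hGΛ : DependsOnlyOff Λ G) (hA : MeasurableSet A)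
    (hAD : DependsOnlyOn D A) {c : ℝ} (hc0 : 0 ≤ c)
    (hc : ∀ V, D ⊆ V → (finVolMeasure J β q V ⊥).real A ≤ c) :
    P.real ((G ∩ A) ∩ {ω | Disjoint D (outer Λ ω)}) ≤ c * P.real G := by
  classical
  have := hP.isProb
  -- The event is partitioned by the value `o` of `outer Λ ω`. Each piece depends only on bonds not
  -- inside `Λ \ o`, and given it, the measure inside `Λ \ o` has closed boundary condition.
  set I := Λ.powerset.filter (fun o => Disjoint D o) with hI
  have h1 : (G ∩ A) ∩ {ω | Disjoint D (outer Λ ω)} ⊆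
      ⋃ o ∈ I, (G ∩ {ω | outer Λ ω = o}) ∩ A := by
    rintro ω ⟨⟨hωG, hωA⟩, hω⟩
    simp only [Set.mem_iUnion]
    refine ⟨outer Λ ω, ?_, ⟨hωG, rfl⟩, hωA⟩
    exact Finset.mem_filter.2 ⟨Finset.mem_powerset.2 (Finset.filter_subset _ _), hω⟩
  have hmeas : ∀ o, MeasurableSet (G ∩ {ω | outer Λ ω = o}) :=
    fun o => hG.inter (measurableSet_outer_eq Λ o)
  have h2 : ∀ o ∈ I, P.real ((G ∩ {ω | outer Λ ω = o}) ∩ A) ≤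
      c * P.real (G ∩ {ω | outer Λ ω = o}) := by
    intro o ho
    have hDo := (Finset.mem_filter.1 ho).2
    refine hP.real_inter_le (Λ \ o) (hmeas o) ?_ hA ?_
    · refine (hGΛ.mono Finset.sdiff_subset).inter fun ω ω' hωω' => ?_
      constructor
      · rintro rfl
        exact outer_congr fun e he => (hωω' e he).symm
      · rintro rfl
        exact outer_congr hωω'
    · rintro ω ⟨-, rfl⟩
      have hDV : D ⊆ Λ \ outer Λ ω := Finset.subset_sdiff.2 ⟨hDΛ, hDo⟩
      rw [finVolMeasure_eq_closed hβ hq (fun a b => mem_of_adj_outer) (hAD.mono hDV)]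
      exact hc _ hDV
  calc P.real ((G ∩ A) ∩ {ω | Disjoint D (outer Λ ω)})
      ≤ P.real (⋃ o ∈ I, (G ∩ {ω | outer Λ ω = o}) ∩ A) := measureReal_mono h1 (measure_ne_top _ _)
    _ ≤ ∑ o ∈ I, P.real ((G ∩ {ω | outer Λ ω = o}) ∩ A) := measureReal_biUnion_finset_le _ _
    _ ≤ ∑ o ∈ I, c * P.real (G ∩ {ω | outer Λ ω = o}) := Finset.sum_le_sum h2
    _ = c * P.real (⋃ o ∈ I, G ∩ {ω | outer Λ ω = o}) := by
        rw [measureReal_biUnion_finset _ fun o _ => hmeas o, Finset.mul_sum]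
        intro o _ o' _ hoo'
        refine Set.disjoint_left.2 ?_
        rintro ω ⟨-, rfl⟩ ⟨-, h⟩
        exact hoo' h
    _ ≤ c * P.real G := by
        refine mul_le_mul_of_nonneg_left (measureReal_mono ?_) hc0
        exact Set.iUnion₂_subset fun o _ => Set.inter_subset_left

/-- The sites at distance at most `N` of `D` in the supremum norm. -/
def fatten (N : ℕ) (D : Finset (Fin d → ℤ)) : Finset (Fin d → ℤ) :=
  by classical exact D.biUnion fun x => translate x (box d N)

lemma mem_fatten {N : ℕ} {D : Finset (Fin d → ℤ)} {y : Fin d → ℤ} :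
    y ∈ fatten N D ↔ ∃ x ∈ D, ∀ i, |y i - x i| ≤ (N : ℤ) := by
  classical
  simp only [fatten, Finset.mem_biUnion, mem_translate, mem_box, Pi.sub_apply]

lemma subset_fatten (N : ℕ) (D : Finset (Fin d → ℤ)) : D ⊆ fatten N D :=
  fun x hx => mem_fatten.2 ⟨x, hx, by simp⟩

lemma card_box (N : ℕ) : (box d N).card = (2 * N + 1) ^ d := by
  rw [box, Pi.card_Icc]
  simp only [Int.card_Icc, Finset.prod_const, Finset.card_univ, Fintype.card_fin]
  congr 1
  omega

lemma card_fatten_le (N : ℕ) (D : Finset (Fin d → ℤ)) :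
    (fatten N D).card ≤ D.card * (2 * N + 1) ^ d := by
  classical
  unfold fatten
  refine Finset.card_biUnion_le_card_mul _ _ _ fun x _ => ?_
  rw [translate, Finset.card_map, card_box]

lemma IsRandomCluster.real_inter_exits_le (hP : IsRandomCluster J β q P) (hβ : 0 < β)
    (hq : 1 ≤ q) {ν₀ ν₁ : ℝ}
    (hdec : ∀ N : ℕ, (finVolMeasure J β q (box d N) (fun _ => true)).real
      (exits J 0 (box d N)) ≤ ν₀ * Real.exp (-ν₁ * N)) (v : Fin d → ℤ) (N : ℕ)
    {G : Set (Config J)} (hG : MeasurableSet G)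
    (hGΛ : DependsOnlyOff (translate v (box d N)) G) :
    P.real (G ∩ exits J v (translate v (box d N))) ≤ ν₀ * Real.exp (-ν₁ * N) * P.real G :=
  hP.real_inter_le _ hG hGΛ (measurableSet_exits _ _)
    fun η _ => finVolMeasure_exits_le hβ hq hdec v N η

/-- The basic decoupling estimate. -/
lemma IsRandomCluster.decoupling (hP : IsRandomCluster J β q P) (hβ : 0 < β)
    (hq : 1 ≤ q) {ν₀ ν₁ : ℝ}
    (hdec : ∀ N : ℕ, (finVolMeasure J β q (box d N) (fun _ => true)).real
      (exits J 0 (box d N)) ≤ ν₀ * Real.exp (-ν₁ * N)) {R : ℕ}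
    (hR : ∀ x y, (bondGraph J).Adj x y → ∀ i, |y i - x i| ≤ (R : ℤ)) {D : Finset (Fin d → ℤ)}
    (ρ : ℕ) {G A : Set (Config J)} (hG : MeasurableSet G)
    (hGΛ : DependsOnlyOff (fatten (2 * ρ + R) D) G) (hA : MeasurableSet A)
    (hAD : DependsOnlyOn D A) {c : ℝ} (hc0 : 0 ≤ c)
    (hc : ∀ V, D ⊆ V → (finVolMeasure J β q V ⊥).real A ≤ c) :
    P.real (G ∩ A) ≤ c * P.real G +
      (fatten (2 * ρ + R) D).card * (ν₀ * Real.exp (-ν₁ * ρ)) * P.real (G ∩ A) := by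
  classical
  have := hP.isProb
  set Λ := fatten (2 * ρ + R) D with hΛ
  have hDΛ : D ⊆ Λ := subset_fatten _ _
  have hmono : ∀ {M N : ℕ}, M ≤ N → fatten M D ⊆ fatten N D := by
    intro M N hMN z hz
    obtain ⟨x, hx, h⟩ := mem_fatten.1 hz
    exact mem_fatten.2 ⟨x, hx, fun i => (h i).trans (by exact_mod_cast hMN)⟩
  -- A cluster from `D` to the outside of `Λ` has a site `b` in this shell, just after its first
  -- exit from `fatten ρ D`. The box of radius `ρ` around `b` lies in `Λ` and misses `D`, so `G ∩ A`
  -- does not depend on the bonds inside it, and leaving it is unlikely even given `G ∩ A`.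
  set I := Λ.filter (fun b => b ∉ fatten ρ D ∧ b ∈ fatten (ρ + R) D) with hI
  have h1 : G ∩ A ⊆ ((G ∩ A) ∩ {ω | Disjoint D (outer Λ ω)}) ∪
      ⋃ b ∈ I, (G ∩ A) ∩ exits J b (translate b (box d ρ)) := by
    intro ω hω
    by_cases hd : Disjoint D (outer Λ ω)
    · exact Or.inl ⟨hω, hd⟩
    right
    obtain ⟨w, hwD, hwo⟩ := Finset.not_disjoint_iff.1 hd
    obtain ⟨-, y, hy, hyw⟩ := mem_outer.1 hwo
    obtain ⟨a, b, haw, ha, hab, hb⟩ := exists_adj_of_mem_cluster (p := fun z => z ∈ fatten ρ D)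
      hyw (subset_fatten _ _ hwD) (fun h => hy (hmono (by omega) h))
    have hbR : b ∈ fatten (ρ + R) D := by
      obtain ⟨x, hx, h⟩ := mem_fatten.1 ha
      refine mem_fatten.2 ⟨x, hx, fun i => ?_⟩
      have h2 := hR a b (openGraph_le_bondGraph ω hab) i
      calc |b i - x i| = |(b i - a i) + (a i - x i)| := by ring_nf
        _ ≤ R + ρ := (abs_add_le _ _).trans (add_le_add h2 (h i))
        _ = ((ρ + R : ℕ) : ℤ) := by push_cast; ring
    simp only [Set.mem_iUnion]
    refine ⟨b, Finset.mem_filter.2 ⟨hmono (by omega) hbR, hb, hbR⟩, hω, y, fun hyb => hy ?_, ?_⟩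
    · obtain ⟨x, hx, h⟩ := mem_fatten.1 hbR
      refine mem_fatten.2 ⟨x, hx, fun i => ?_⟩
      have h2 := mem_box.1 (mem_translate.1 hyb) i
      rw [Pi.sub_apply] at h2
      calc |y i - x i| = |(y i - b i) + (b i - x i)| := by ring_nf
        _ ≤ ρ + (ρ + R : ℕ) := (abs_add_le _ _).trans (add_le_add h2 (h i))
        _ = ((2 * ρ + R : ℕ) : ℤ) := by push_cast; ring
    · rw [cluster_eq_of_mem (mem_cluster_of_adj haw hab)]
      exact hyw
  have h2 : ∀ b ∈ I, P.real ((G ∩ A) ∩ exits J b (translate b (box d ρ))) ≤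
      ν₀ * Real.exp (-ν₁ * ρ) * P.real (G ∩ A) := by
    intro b hb
    obtain ⟨-, hb1, hb2⟩ := Finset.mem_filter.1 hb
    refine hP.real_inter_exits_le hβ hq hdec b ρ (hG.inter hA) (DependsOnlyOff.inter ?_ ?_)
    · refine hGΛ.mono fun y hy => ?_
      obtain ⟨x, hx, h⟩ := mem_fatten.1 hb2
      refine mem_fatten.2 ⟨x, hx, fun i => ?_⟩
      have h2 := mem_box.1 (mem_translate.1 hy) i
      rw [Pi.sub_apply] at h2
      calc |y i - x i| = |(y i - b i) + (b i - x i)| := by ring_nf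
        _ ≤ ρ + (ρ + R : ℕ) := (abs_add_le _ _).trans (add_le_add h2 (h i))
        _ = ((2 * ρ + R : ℕ) : ℤ) := by push_cast; ring
    · refine hAD.dependsOnlyOff (Finset.disjoint_left.2 fun x hx hxb => hb1 ?_)
      refine mem_fatten.2 ⟨x, hx, fun i => ?_⟩
      have h2 := mem_box.1 (mem_translate.1 hxb) i
      rwa [Pi.sub_apply, abs_sub_comm] at h2
  calc P.real (G ∩ A) ≤ P.real (((G ∩ A) ∩ {ω | Disjoint D (outer Λ ω)}) ∪
        ⋃ b ∈ I, (G ∩ A) ∩ exits J b (translate b (box d ρ))) := measureReal_mono h1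
    _ ≤ P.real ((G ∩ A) ∩ {ω | Disjoint D (outer Λ ω)}) +
        P.real (⋃ b ∈ I, (G ∩ A) ∩ exits J b (translate b (box d ρ))) := measureReal_union_le _ _
    _ ≤ c * P.real G + ∑ b ∈ I, P.real ((G ∩ A) ∩ exits J b (translate b (box d ρ))) :=
        add_le_add (hP.real_inter_blocked_le hβ hq hDΛ hG hGΛ hA hAD hc0 hc)
          (measureReal_biUnion_finset_le _ _)
    _ ≤ c * P.real G + ∑ b ∈ I, ν₀ * Real.exp (-ν₁ * ρ) * P.real (G ∩ A) := by
        gcongr with b hb; exact h2 b hb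
    _ ≤ _ := by
        rw [Finset.sum_const, nsmul_eq_mul, ← mul_assoc]
        have hν : 0 ≤ ν₀ * Real.exp (-ν₁ * ρ) := measureReal_nonneg.trans (hdec ρ)
        have hcard : (I.card : ℝ) ≤ Λ.card := by exact_mod_cast Finset.card_filter_le _ _
        gcongr

end Blocking

end

section
variable {d : ℕ} {J : Coupling d} {β q : ℝ} {P : Measure (Config J)}

/-! ### Asymptotics, norms and the standing assumptions -/

section Asymptotics

lemma tendsto_linear_pow_mul_exp (a b : ℝ) {ν : ℝ} (hν : 0 < ν) (n : ℕ) :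
    Tendsto (fun x : ℝ => (a * x + b) ^ n * Real.exp (-ν * x)) atTop (𝓝 0) := by
  have h1 : (fun x : ℝ => a * x + b) =O[atTop] fun x : ℝ => x :=
    ((Asymptotics.isBigO_refl _ _).const_mul_left a).add
      (Asymptotics.isLittleO_const_id_atTop b).isBigO
  have h2 := (h1.pow n).trans_isLittleO (isLittleO_pow_exp_pos_mul_atTop n hν)
  refine h2.tendsto_div_nhds_zero.congr fun x => ?_
  rw [neg_mul, Real.exp_neg, div_eq_mul_inv]

end Asymptotics

section Norm

lemma norm_le_iff_mem_box {N : ℕ} {x : Fin d → ℤ} : x ∈ box d N ↔ ‖x‖ ≤ N := by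
  rw [mem_box, pi_norm_le_iff_of_nonneg (Nat.cast_nonneg N)]
  refine forall_congr' fun i => ?_
  rw [Int.norm_eq_abs]
  exact_mod_cast Iff.rfl

lemma norm_le_norm_emb (x : Fin d → ℤ) : ‖x‖ ≤ ‖emb x‖ := by
  rw [pi_norm_le_iff_of_nonneg (norm_nonneg _)]
  intro i
  rw [Int.norm_eq_abs]
  exact abs_apply_le_norm_emb x i

lemma norm_emb_le (x : Fin d → ℤ) : ‖emb x‖ ≤ d * ‖x‖ := by
  have h1 : ‖emb x‖ ≤ ∑ i, ‖(x i : ℝ)‖ := by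
    rw [EuclideanSpace.norm_eq]
    refine Real.sqrt_le_iff.2 ⟨Finset.sum_nonneg fun _ _ => norm_nonneg _, ?_⟩
    exact Finset.sum_sq_le_sq_sum_of_nonneg fun _ _ => norm_nonneg _
  refine h1.trans ?_
  calc ∑ i, ‖(x i : ℝ)‖ ≤ ∑ _i : Fin d, ‖x‖ := by
        refine Finset.sum_le_sum fun i _ => ?_
        have := norm_le_pi_norm x i
        rwa [Int.norm_eq_abs] at this
    _ = d * ‖x‖ := by simp

lemma one_le_norm {x : Fin d → ℤ} (hx : x ≠ 0) : 1 ≤ ‖x‖ := by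
  obtain ⟨i, hi⟩ := Function.ne_iff.1 hx
  refine le_trans ?_ (norm_le_pi_norm x i)
  rw [Int.norm_eq_abs]
  exact_mod_cast Int.one_le_abs hi

end Norm

/-- The standing assumptions: `P` is a random cluster measure, there is exponential decay in wired
boxes, and the interaction has range `R`. -/
structure Subcritical (J : Coupling d) (β q : ℝ) (P : Measure (Config J)) (ν₀ ν₁ : ℝ) (R : ℕ) :
    Prop where
  hβ : 0 < β
  hq : 1 ≤ q
  rc : IsRandomCluster J β q P
  hν₁ : 0 < ν₁
  decay : ∀ N : ℕ, (finVolMeasure J β q (box d N) (fun _ => true)).real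
      (exits J 0 (box d N)) ≤ ν₀ * Real.exp (-ν₁ * N)
  range : ∀ x y, (bondGraph J).Adj x y → ∀ i, |y i - x i| ≤ (R : ℤ)

/-! ### Uniqueness, translation invariance, positive association -/

namespace Subcritical

variable {ν₀ ν₁ : ℝ} {R : ℕ} (h : Subcritical J β q P ν₀ ν₁ R)

include h

lemma isProb : IsProbabilityMeasure P := h.rc.isProb

lemma nonneg_nu₀ : 0 ≤ ν₀ := by
  have := measureReal_nonneg.trans (h.decay 0)
  simpa using this

/-- The probability of a local event is bounded by its probabilities with closed boundary
conditions. -/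
lemma le_of_closed_le {D : Finset (Fin d → ℤ)} {A : Set (Config J)} (hA : MeasurableSet A)
    (hAD : DependsOnlyOn D A) {c : ℝ} (hc0 : 0 ≤ c)
    (hc : ∀ V, D ⊆ V → (finVolMeasure J β q V ⊥).real A ≤ c) : P.real A ≤ c := by
  have := h.isProb
  -- Decoupling with the trivial event `G`; the volume of the fattened set grows polynomially in
  -- `ρ`, so the error vanishes as `ρ` tends to infinity.
  have h1 : ∀ ρ : ℕ, P.real A ≤ c + (D.card : ℝ) * ν₀ *
      ((4 * (ρ : ℝ) + (2 * R + 1)) ^ d * Real.exp (-ν₁ * ρ)) := by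
    intro ρ
    have h2 := h.rc.decoupling h.hβ h.hq h.decay h.range ρ (D := D) MeasurableSet.univ
      (dependsOnlyOff_univ _) hA hAD hc0 hc
    rw [Set.univ_inter, probReal_univ, mul_one] at h2
    refine h2.trans (add_le_add_right ?_ _)
    have h3 : ((fatten (2 * ρ + R) D).card : ℝ) ≤ D.card * (4 * (ρ : ℝ) + (2 * R + 1)) ^ d := by
      refine (Nat.cast_le.2 (card_fatten_le (2 * ρ + R) D)).trans (le_of_eq ?_)
      push_cast; ring
    have hν : 0 ≤ ν₀ * Real.exp (-ν₁ * ρ) := mul_nonneg h.nonneg_nu₀ (Real.exp_pos _).le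
    calc ((fatten (2 * ρ + R) D).card : ℝ) * (ν₀ * Real.exp (-ν₁ * ρ)) * P.real A
        ≤ ((fatten (2 * ρ + R) D).card : ℝ) * (ν₀ * Real.exp (-ν₁ * ρ)) * 1 := by
          gcongr; exact measureReal_le_one
      _ ≤ (D.card * (4 * (ρ : ℝ) + (2 * R + 1)) ^ d) * (ν₀ * Real.exp (-ν₁ * ρ)) * 1 := by
          gcongr
      _ = _ := by ring
  have h4 : Tendsto (fun ρ : ℕ => c + (D.card : ℝ) * ν₀ *
      ((4 * (ρ : ℝ) + (2 * R + 1)) ^ d * Real.exp (-ν₁ * ρ))) atTop (𝓝 (c + D.card * ν₀ * 0)) :=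
    (((tendsto_linear_pow_mul_exp 4 (2 * R + 1) h.hν₁ d).comp
      tendsto_natCast_atTop_atTop).const_mul _).const_add _
  rw [mul_zero, add_zero] at h4
  exact ge_of_tendsto' h4 h1

/-- If `G` does not depend on what happens near `D`, an increasing event in `D` has, given `G`, at
most twice its probability. -/
lemma real_inter_le_two_mul {D : Finset (Fin d → ℤ)} {ρ : ℕ}
    (hρ : (D.card : ℝ) * ν₀ * ((4 * (ρ : ℝ) + (2 * R + 1)) ^ d * Real.exp (-ν₁ * ρ)) ≤ 1 / 2)
    {G A : Set (Config J)} (hG : MeasurableSet G)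
    (hGΛ : DependsOnlyOff (fatten (2 * ρ + R) D) G) (hA : MeasurableSet A)
    (hAD : DependsOnlyOn D A) (hAu : IsUpperSet A) :
    P.real (G ∩ A) ≤ 2 * P.real A * P.real G := by
  have := h.isProb
  have h2 := h.rc.decoupling h.hβ h.hq h.decay h.range ρ (D := D) hG hGΛ hA hAD
    measureReal_nonneg (fun V _ => h.rc.closed_le h.hβ h.hq V hA hAu)
  have h3 : ((fatten (2 * ρ + R) D).card : ℝ) ≤ D.card * (4 * (ρ : ℝ) + (2 * R + 1)) ^ d := by
    refine (Nat.cast_le.2 (card_fatten_le (2 * ρ + R) D)).trans (le_of_eq ?_)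
    push_cast; ring
  have hν : 0 ≤ ν₀ * Real.exp (-ν₁ * ρ) := mul_nonneg h.nonneg_nu₀ (Real.exp_pos _).le
  have h4 : ((fatten (2 * ρ + R) D).card : ℝ) * (ν₀ * Real.exp (-ν₁ * ρ)) ≤ 1 / 2 := by
    refine le_trans ?_ hρ
    calc ((fatten (2 * ρ + R) D).card : ℝ) * (ν₀ * Real.exp (-ν₁ * ρ))
        ≤ (D.card * (4 * (ρ : ℝ) + (2 * R + 1)) ^ d) * (ν₀ * Real.exp (-ν₁ * ρ)) := by gcongr
      _ = _ := by ring
  nlinarith [mul_le_mul_of_nonneg_right h4 (measureReal_nonneg (μ := P) (s := G ∩ A))]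

/-- Uniqueness of the random cluster measure. -/
lemma unique {P' : Measure (Config J)} (hP' : IsRandomCluster J β q P') : P = P' := by
  have h' : Subcritical J β q P' ν₀ ν₁ R := ⟨h.hβ, h.hq, hP', h.hν₁, h.decay, h.range⟩
  have := h.isProb
  have := h'.isProb
  -- These generating events are local and increasing, so under either measure their probability is
  -- at most the supremum over closed boundary conditions, which the other measure dominates.
  set π : Set (Set (Config J)) := {A | ∃ F : Finset (Bond J), A = {ω | ∀ e ∈ F, ω e = true}} with hπ
  have hpi : IsPiSystem π := by
    classical
    rintro _ ⟨F, rfl⟩ _ ⟨F', rfl⟩ -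
    refine ⟨F ∪ F', ?_⟩
    ext ω
    simp only [Set.mem_inter_iff, Set.mem_ofPred_eq, Finset.mem_union]
    exact ⟨fun h e he => he.elim (h.1 e) (h.2 e),
      fun h => ⟨fun e he => h e (Or.inl he), fun e he => h e (Or.inr he)⟩⟩
  have hmeas : ∀ F : Finset (Bond J), MeasurableSet {ω : Config J | ∀ e ∈ F, ω e = true} := by
    intro F
    have : {ω : Config J | ∀ e ∈ F, ω e = true} = ⋂ e ∈ F, (fun ω : Config J => ω e) ⁻¹' {true} := by
      ext ω; simp
    rw [this]
    exact Finset.measurableSet_biInter _ fun e _ =>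
      measurable_pi_apply e (MeasurableSet.singleton true)
  have hgen : (inferInstance : MeasurableSpace (Config J)) = MeasurableSpace.generateFrom π := by
    apply le_antisymm
    · refine iSup_le fun e => ?_
      rw [← measurable_iff_comap_le]
      refine @measurable_to_bool _ (MeasurableSpace.generateFrom π) _ ?_
      refine MeasurableSpace.measurableSet_generateFrom ⟨{e}, ?_⟩
      ext ω; simp
    · refine MeasurableSpace.generateFrom_le ?_
      rintro _ ⟨F, rfl⟩
      exact hmeas F
  refine ext_of_generate_finite π hgen hpi ?_ (by simp)
  rintro _ ⟨F, rfl⟩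
  have hup : IsUpperSet {ω : Config J | ∀ e ∈ F, ω e = true} := by
    intro ω ω' hωω' hω e he
    have := hωω' e
    rw [hω e he] at this
    exact top_le_iff.1 this
  obtain ⟨D, hD⟩ : ∃ D : Finset (Fin d → ℤ), F ⊆ bondsIn J D := by
    classical
    refine ⟨F.biUnion fun e => e.1.toFinset, fun e he => mem_bondsIn.2 fun v hv => ?_⟩
    exact Finset.mem_biUnion.2 ⟨e, he, by simpa using hv⟩
  have hdep : DependsOnlyOn D {ω : Config J | ∀ e ∈ F, ω e = true} :=
    fun ω ω' hωω' => forall₂_congr fun e he => by rw [hωω' e (hD he)]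
  have hle1 := h.le_of_closed_le (hmeas F) hdep measureReal_nonneg
    fun V _ => hP'.closed_le h.hβ h.hq V (hmeas F) hup
  have hle2 := h'.le_of_closed_le (hmeas F) hdep measureReal_nonneg
    fun V _ => h.rc.closed_le h.hβ h.hq V (hmeas F) hup
  exact (measureReal_eq_measureReal_iff (measure_ne_top _ _) (measure_ne_top _ _)).1
    (le_antisymm hle1 hle2)

/-- Connection is not local, but it is the increasing limit of connection inside boxes. -/
lemma connected_le_of_closed_le {x y : Fin d → ℤ} {c : ℝ} (hc0 : 0 ≤ c)
    (hc : ∀ V, (finVolMeasure J β q V ⊥).real (connected J x y) ≤ c) :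
    P.real (connected J x y) ≤ c := by
  have := h.isProb
  set A : ℕ → Set (Config J) := fun N => {ω | restrict (box d N) ω ∈ connected J x y} with hA
  have hmono : Monotone A := by
    intro M N hMN ω hω
    refine cluster_mono (restrict_mono_set (fun z hz => ?_) ω) x hω
    exact mem_box.2 fun i => (mem_box.1 hz i).trans (by exact_mod_cast hMN)
  have hU : connected J x y = ⋃ N, A N := by
    ext ω
    rw [Set.mem_iUnion]
    exact ⟨fun hω => exists_restrict_of_mem_cluster hω,
      fun ⟨N, hN⟩ => cluster_mono (restrict_le _ _) x hN⟩
  have hle : ∀ N, P.real (A N) ≤ c := by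
    intro N
    refine h.le_of_closed_le (D := box d N)
      (measurable_restrict _ (measurableSet_connected x y)) (dependsOnlyOn_restrict _ _) hc0 ?_
    intro V _
    have := finVolMeasure_isProb h.hβ h.hq V (⊥ : Config J)
    refine (measureReal_mono ?_).trans (hc V)
    exact fun ω hω => cluster_mono (restrict_le _ _) x hω
  have h1 := tendsto_measure_iUnion_atTop (μ := P) hmono
  rw [← hU] at h1
  have h2 := (ENNReal.tendsto_toReal (measure_ne_top P _)).comp h1
  exact le_of_tendsto' h2 hle

/-- Positive association of connection events with increasing events. -/
lemma fkg_connected (x y : Fin d → ℤ) {B : Set (Config J)} (hB : MeasurableSet B)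
    (hBu : IsUpperSet B) :
    P.real (connected J x y) * P.real B ≤ P.real (connected J x y ∩ B) := by
  have := h.isProb
  rcases (measureReal_nonneg (μ := P) (s := B)).eq_or_lt with h0 | h0
  · rw [← h0, mul_zero]; exact measureReal_nonneg
  rw [← le_div_iff₀ h0]
  refine h.connected_le_of_closed_le (by positivity) fun V => ?_
  rw [le_div_iff₀ h0]
  -- It now suffices to treat the closed measure in `V`: apply FKG to the kernel with boundary
  -- condition `η`, lower the connection factor to the closed boundary condition, and integrate over
  -- `η`.
  have hC := measurableSet_connected (J := J) x y
  have h1 := h.rc.real_inter V MeasurableSet.univ (dependsOnlyOff_univ V) hB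
  have h2 := h.rc.real_inter V MeasurableSet.univ (dependsOnlyOff_univ V) (hC.inter hB)
  rw [Set.univ_inter, setIntegral_univ] at h1 h2
  rw [h1, h2, ← integral_const_mul]
  refine integral_mono ((h.rc.integrable V hB).const_mul _) (h.rc.integrable V (hC.inter hB)) ?_
  intro η
  refine le_trans ?_ (finVolMeasure_fkg h.hβ h.hq V η (isUpperSet_connected x y) hBu)
  exact mul_le_mul_of_nonneg_right (finVolMeasure_mono h.hβ le_rfl h.hq V bot_le
    (isUpperSet_connected x y)) measureReal_nonneg

/-- Closed boundary conditions are translation invariant, so each closed approximation of the left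
side is one of the right side in a translated volume. The opposite inequality follows by translating
back. -/
lemma connected_add_le (x y v : Fin d → ℤ) :
    P.real (connected J (x + v) (y + v)) ≤ P.real (connected J x y) := by
  refine h.connected_le_of_closed_le measureReal_nonneg fun V => ?_
  have hV : V = translate v (translate (-v) V) := by
    ext z; simp [mem_translate]
  rw [← shift_connected, hV, finVolMeasure_translate h.hβ h.hq]
  exact h.rc.closed_le h.hβ h.hq _ (measurableSet_connected x y) (isUpperSet_connected x y)

lemma connected_eq (x y : Fin d → ℤ) :
    P.real (connected J x y) = P.real (connected J 0 (y - x)) := by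
  apply le_antisymm
  · have := h.connected_add_le 0 (y - x) x
    simpa using this
  · have := h.connected_add_le x y (-x)
    simpa [sub_eq_add_neg] using this

lemma connected_mul_le (x y : Fin d → ℤ) :
    P.real (connected J 0 x) * P.real (connected J 0 y) ≤ P.real (connected J 0 (x + y)) := by
  have := h.isProb
  have h1 := h.fkg_connected 0 x (measurableSet_connected x (x + y))
    (isUpperSet_connected x (x + y))
  rw [h.connected_eq x (x + y), add_sub_cancel_left] at h1
  refine h1.trans (measureReal_mono ?_)
  rintro ω ⟨h2, h3⟩
  exact SimpleGraph.Reachable.trans h2 h3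

lemma connected_neg (x : Fin d → ℤ) :
    P.real (connected J 0 (-x)) = P.real (connected J 0 x) := by
  have h1 := h.connected_eq x 0
  rw [zero_sub] at h1
  rw [← h1]
  congr 1
  ext ω; exact mem_cluster_comm

lemma connected_le_exp {x : Fin d → ℤ} (hx : x ≠ 0) :
    P.real (connected J 0 x) ≤ ν₀ * Real.exp ν₁ * Real.exp (-ν₁ * ‖x‖) := by
  have := h.isProb
  have h1 := one_le_norm hx
  set N : ℕ := ⌈‖x‖⌉₊ - 1 with hN
  have hceil : 1 ≤ ⌈‖x‖⌉₊ := Nat.one_le_iff_ne_zero.2 (Nat.ceil_pos.2 (by linarith)).ne'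
  have hN1 : (N : ℝ) + 1 = ⌈‖x‖⌉₊ := by
    rw [hN]; push_cast [hceil]; ring
  have hN2 : (N : ℝ) < ‖x‖ := by
    have := Nat.ceil_lt_add_one (norm_nonneg x); linarith
  have hN3 : ‖x‖ - 1 ≤ N := by
    have := Nat.le_ceil ‖x‖; linarith
  have h2 := h.rc.real_inter_exits_le h.hβ h.hq h.decay 0 N MeasurableSet.univ
    (dependsOnlyOff_univ _)
  have htr : translate 0 (box d N) = box d N := by
    ext z; simp [mem_translate]
  rw [htr, Set.univ_inter, probReal_univ, mul_one] at h2
  calc P.real (connected J 0 x) ≤ P.real (exits J 0 (box d N)) := by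
        refine measureReal_mono fun ω hω => ⟨x, fun hx => ?_, hω⟩
        exact absurd (norm_le_iff_mem_box.1 hx) (not_le.2 hN2)
    _ ≤ ν₀ * Real.exp (-ν₁ * N) := h2
    _ ≤ ν₀ * Real.exp (ν₁ + -ν₁ * ‖x‖) := by
        refine mul_le_mul_of_nonneg_left (Real.exp_le_exp.2 ?_) h.nonneg_nu₀
        nlinarith [h.hν₁]
    _ = ν₀ * Real.exp ν₁ * Real.exp (-ν₁ * ‖x‖) := by rw [Real.exp_add, mul_assoc]

omit h in
lemma bondGraph_adj_single (x : Fin d → ℤ) (i : Fin d) (s : ℤ) (hs : |s| = 1) :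
    (bondGraph J).Adj x (x + Pi.single i s) := by
  have hne : s ≠ 0 := by rintro rfl; simp at hs
  rw [bondGraph_adj]
  refine ⟨fun h0 => ?_, ?_⟩
  · have := congr_fun h0 i
    simp [hne] at this
  · rw [add_sub_cancel_left]
    apply J.pos_of_norm_one
    have h1 : emb (Pi.single i s : Fin d → ℤ) = EuclideanSpace.single i (s : ℝ) := by
      ext j
      by_cases hj : j = i
      · subst hj; simp [emb]
      · simp [emb, hj]
    rw [h1, PiLp.norm_single, Real.norm_eq_abs]
    exact_mod_cast hs

/-- Opening a single nearest-neighbour bond has a uniformly positive cost by finite energy. -/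
lemma exists_connected_single_ge :
    ∃ κ : ℝ, 0 < κ ∧ κ ≤ 1 ∧ ∀ (i : Fin d) (s : ℤ), |s| = 1 →
      κ ≤ P.real (connected J 0 (Pi.single i s)) := by
  classical
  have := h.isProb
  obtain ⟨c, hc, hcP⟩ := exists_energy_const J h.hβ h.hq
  have hbound : ∀ (i : Fin d) (s : ℤ), |s| = 1 →
      c 2 ≤ P.real (connected J 0 (Pi.single i s)) := by
    intro i s hs
    have hadj := bondGraph_adj_single (J := J) 0 i s hs
    rw [zero_add] at hadj
    set z : Fin d → ℤ := Pi.single i s with hz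
    have h1 := hcP P h.rc {0, z} Set.univ (connected J 0 z) MeasurableSet.univ
      (measurableSet_connected 0 z) ?_
    · rwa [probReal_univ, mul_one, Finset.card_pair hadj.ne] at h1
    · intro ω _
      refine ⟨openBonds ω {⟨s(0, z), hadj⟩}, ?_, fun e he => ?_⟩
      · exact mem_cluster_of_adj (mem_cluster_self _ _)
          (openGraph_adj.2 ⟨hadj, by simp [openBonds]⟩)
      · have : e ≠ ⟨s(0, z), hadj⟩ := by
          rintro rfl
          exact he (mk_mem_bondsIn.2 ⟨by simp, by simp⟩)
        simp [openBonds, this]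
  exact ⟨min (c 2) 1, lt_min (hc 2) one_pos, min_le_right _ _,
    fun i s hs => (min_le_left _ _).trans (hbound i s hs)⟩

/-- The two-point function decays at most exponentially. -/
lemma exists_connected_ge :
    ∃ C : ℝ, 0 ≤ C ∧ ∀ x : Fin d → ℤ, Real.exp (-C * ‖x‖) ≤ P.real (connected J 0 x) := by
  have := h.isProb
  obtain ⟨κ, hκ, hκ1, hκP⟩ := h.exists_connected_single_ge
  have key : ∀ n : ℕ, ∀ x : Fin d → ℤ, ∑ i, (x i).natAbs = n →
      κ ^ n ≤ P.real (connected J 0 x) := by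
    intro n
    induction n with
    | zero =>
      intro x hx
      have hx0 : x = 0 := by
        funext i
        have := (Finset.sum_eq_zero_iff.1 hx) i (Finset.mem_univ i)
        simpa using this
      have hu : connected J 0 x = Set.univ := by
        ext ω; rw [hx0]; simp [connected, mem_cluster_self]
      rw [hu]; simp
    | succ n ih =>
      intro x hx
      obtain ⟨i, hi⟩ : ∃ i, x i ≠ 0 := by
        by_contra hcon
        push Not at hcon
        simp [hcon] at hx
      set s : ℤ := (x i).sign with hs
      have hsabs : |s| = 1 := by
        rw [hs]
        rcases lt_or_gt_of_ne hi with h1 | h1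
        · rw [Int.sign_eq_neg_one_of_neg h1]; rfl
        · rw [Int.sign_eq_one_of_pos h1]; rfl
      have hxi : ((x - Pi.single i s : Fin d → ℤ) i).natAbs + 1 = (x i).natAbs := by
        rw [Pi.sub_apply, Pi.single_eq_same, hs]
        rcases lt_or_gt_of_ne hi with h1 | h1
        · rw [Int.sign_eq_neg_one_of_neg h1]; omega
        · rw [Int.sign_eq_one_of_pos h1]; omega
      have hsum : ∑ j, ((x - Pi.single i s : Fin d → ℤ) j).natAbs = n := by
        rw [← Finset.add_sum_erase _ _ (Finset.mem_univ i)] at hx ⊢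
        have : ∑ j ∈ Finset.univ.erase i, ((x - Pi.single i s : Fin d → ℤ) j).natAbs =
            ∑ j ∈ Finset.univ.erase i, (x j).natAbs := by
          refine Finset.sum_congr rfl fun j hj => ?_
          rw [Pi.sub_apply, Pi.single_eq_of_ne (Finset.ne_of_mem_erase hj), sub_zero]
        omega
      have h1 := h.connected_mul_le (x - Pi.single i s) (Pi.single i s)
      rw [sub_add_cancel] at h1
      refine le_trans ?_ h1
      rw [pow_succ]
      exact mul_le_mul (ih _ hsum) (hκP i s hsabs) hκ.le measureReal_nonneg
  have hlog : Real.log κ ≤ 0 := Real.log_nonpos hκ.le hκ1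
  refine ⟨-(d * Real.log κ), by nlinarith [(Nat.cast_nonneg d : (0 : ℝ) ≤ d)], fun x => ?_⟩
  refine le_trans ?_ (key _ x rfl)
  rw [← Real.exp_log hκ, ← Real.exp_nat_mul, Real.log_exp, neg_neg]
  refine Real.exp_le_exp.2 ?_
  have h1 : ((∑ i, (x i).natAbs : ℕ) : ℝ) ≤ d * ‖x‖ := by
    push_cast
    calc ∑ i, ((x i).natAbs : ℝ) ≤ ∑ _i : Fin d, ‖x‖ := by
          refine Finset.sum_le_sum fun i _ => ?_
          have := norm_le_pi_norm x i
          rw [Int.norm_eq_abs] at this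
          rwa [Nat.cast_natAbs, Int.cast_abs]
      _ = d * ‖x‖ := by simp
  nlinarith

lemma connected_pos (x : Fin d → ℤ) : 0 < P.real (connected J 0 x) := by
  obtain ⟨C, -, hC⟩ := h.exists_connected_ge
  exact (Real.exp_pos _).trans_le (hC x)

end Subcritical

end

/-! ### The inverse correlation length on the lattice -/

section
variable {d : ℕ} {J : Coupling d} {β q : ℝ} {P : Measure (Config J)}

/-- `- log P(0 ↔ x)`. -/
def nlog (P : Measure (Config J)) (x : Fin d → ℤ) : ℝ := -Real.log (P.real (connected J 0 x))

/-- The inverse correlation length on the lattice. -/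
def zeta (P : Measure (Config J)) (x : Fin d → ℤ) : ℝ := xi P (emb x)

lemma intPart_smul_emb (k : ℕ) (x : Fin d → ℤ) : intPart ((k : ℝ) • emb x) = k • x := by
  funext i
  have : ((k : ℝ) • emb x) i = ((k * x i : ℤ) : ℝ) := by simp [emb]
  rw [intPart, this, Int.floor_intCast]
  simp

namespace Subcritical

variable {ν₀ ν₁ : ℝ} {R : ℕ} (h : Subcritical J β q P ν₀ ν₁ R)

include h

lemma exp_neg_nlog (x : Fin d → ℤ) : Real.exp (-nlog P x) = P.real (connected J 0 x) := by
  rw [nlog, neg_neg, Real.exp_log (h.connected_pos x)]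

lemma nlog_nonneg (x : Fin d → ℤ) : 0 ≤ nlog P x := by
  have := h.isProb
  exact neg_nonneg.2 (Real.log_nonpos measureReal_nonneg measureReal_le_one)

lemma nlog_add_le (x y : Fin d → ℤ) : nlog P (x + y) ≤ nlog P x + nlog P y := by
  have h1 := h.connected_mul_le x y
  rw [← h.exp_neg_nlog x, ← h.exp_neg_nlog y, ← h.exp_neg_nlog (x + y), ← Real.exp_add,
    Real.exp_le_exp] at h1
  linarith

lemma nlog_neg (x : Fin d → ℤ) : nlog P (-x) = nlog P x := by
  rw [nlog, h.connected_neg, nlog]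

lemma exists_nlog_le : ∃ C : ℝ, 0 ≤ C ∧ ∀ x : Fin d → ℤ, nlog P x ≤ C * ‖x‖ := by
  obtain ⟨C, hC0, hC⟩ := h.exists_connected_ge
  refine ⟨C, hC0, fun x => ?_⟩
  have := hC x
  rw [← h.exp_neg_nlog, Real.exp_le_exp] at this
  linarith

lemma exists_le_nlog : ∃ C : ℝ, ∀ x : Fin d → ℤ, x ≠ 0 → ν₁ * ‖x‖ - C ≤ nlog P x := by
  refine ⟨Real.log (ν₀ * Real.exp ν₁), fun x hx => ?_⟩
  have h1 := h.connected_le_exp hx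
  have h2 := h.connected_pos x
  have h3 : 0 < ν₀ * Real.exp ν₁ := by
    by_contra hcon
    have := mul_nonpos_of_nonpos_of_nonneg (not_lt.1 hcon) (Real.exp_pos (-ν₁ * ‖x‖)).le
    linarith
  have h4 := Real.log_le_log h2 h1
  rw [Real.log_mul h3.ne' (Real.exp_pos _).ne', Real.log_exp] at h4
  rw [nlog]; linarith

lemma nlog_zero : nlog P 0 = 0 := by
  have := h.isProb
  have hu : connected J 0 0 = Set.univ := by
    ext ω; simp [connected, mem_cluster_self]
  rw [nlog, hu]; simp

lemma nlog_nsmul_le (k : ℕ) (x : Fin d → ℤ) : nlog P (k • x) ≤ k * nlog P x := by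
  induction k with
  | zero => simp [h.nlog_zero]
  | succ k ih =>
    rw [succ_nsmul]
    refine (h.nlog_add_le _ _).trans ?_
    push_cast; linarith

lemma tendsto_zeta (x : Fin d → ℤ) :
    Tendsto (fun k : ℕ => nlog P (k • x) / k) atTop (𝓝 (zeta P x)) := by
  have hsub : Subadditive fun k : ℕ => nlog P (k • x) := by
    intro m n
    change nlog P ((m + n) • x) ≤ _
    rw [add_nsmul]
    exact h.nlog_add_le _ _
  have hlim := hsub.tendsto_lim ⟨0, by
    rintro _ ⟨n, rfl⟩
    exact div_nonneg (h.nlog_nonneg _) (Nat.cast_nonneg _)⟩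
  have h1 : Tendsto (fun k : ℕ => (1 / (k : ℝ)) *
      Real.log (P.real (connected J 0 (intPart ((k : ℝ) • emb x))))) atTop (𝓝 (-hsub.lim)) := by
    refine hlim.neg.congr fun k => ?_
    rw [intPart_smul_emb, nlog]; ring
  have h2 : zeta P x = hsub.lim := by
    rw [zeta, xi, h1.limUnder_eq, neg_neg]
  rw [h2]; exact hlim

lemma zeta_le_nlog (x : Fin d → ℤ) : zeta P x ≤ nlog P x := by
  refine le_of_tendsto (h.tendsto_zeta x) ((eventually_gt_atTop 0).mono fun k hk => ?_)
  rw [div_le_iff₀ (Nat.cast_pos.2 hk), mul_comm]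
  exact h.nlog_nsmul_le k x

lemma connected_le_exp_zeta (x : Fin d → ℤ) :
    P.real (connected J 0 x) ≤ Real.exp (-zeta P x) := by
  rw [← h.exp_neg_nlog, Real.exp_le_exp]
  linarith [h.zeta_le_nlog x]

lemma zeta_nonneg (x : Fin d → ℤ) : 0 ≤ zeta P x :=
  ge_of_tendsto' (h.tendsto_zeta x) fun _ => div_nonneg (h.nlog_nonneg _) (Nat.cast_nonneg _)

lemma zeta_add_le (x y : Fin d → ℤ) : zeta P (x + y) ≤ zeta P x + zeta P y := by
  refine le_of_tendsto_of_tendsto' (h.tendsto_zeta _)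
    ((h.tendsto_zeta x).add (h.tendsto_zeta y)) fun k => ?_
  rw [← add_div, nsmul_add]
  exact div_le_div_of_nonneg_right (h.nlog_add_le _ _) (Nat.cast_nonneg _)

lemma zeta_neg (x : Fin d → ℤ) : zeta P (-x) = zeta P x := by
  refine tendsto_nhds_unique (h.tendsto_zeta (-x)) ((h.tendsto_zeta x).congr fun k => ?_)
  rw [smul_neg, h.nlog_neg]

lemma zeta_sub_comm (x y : Fin d → ℤ) : zeta P (x - y) = zeta P (y - x) := by
  rw [← h.zeta_neg, neg_sub]

lemma zeta_sub_le (x y z : Fin d → ℤ) : zeta P (x - z) ≤ zeta P (x - y) + zeta P (y - z) := by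
  rw [← sub_add_sub_cancel x y z]; exact h.zeta_add_le _ _

lemma zeta_zero : zeta P 0 = 0 := by
  have h1 := h.zeta_le_nlog 0
  rw [h.nlog_zero] at h1
  exact le_antisymm h1 (h.zeta_nonneg 0)

lemma zeta_nsmul (k : ℕ) (x : Fin d → ℤ) : zeta P (k • x) = k * zeta P x := by
  rcases Nat.eq_zero_or_pos k with rfl | hk
  · simp [h.zeta_zero]
  have hk' : (0 : ℝ) < k := Nat.cast_pos.2 hk
  have h1 : Tendsto (fun j : ℕ => j * k) atTop atTop :=
    tendsto_id.atTop_mul_const' hk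
  refine tendsto_nhds_unique (h.tendsto_zeta (k • x))
    ((((h.tendsto_zeta x).comp h1).const_mul (k : ℝ)).congr fun j => ?_)
  simp only [Function.comp_apply]
  rw [mul_nsmul, Nat.cast_mul, nsmul_left_comm]
  rcases Nat.eq_zero_or_pos j with rfl | hj
  · simp
  have : (0 : ℝ) < j := Nat.cast_pos.2 hj
  field_simp

/-- The additive constant in the bound on `nlog` disappears after division by `k` along the
multiples of `x`. -/
lemma nu_mul_norm_le_zeta (x : Fin d → ℤ) : ν₁ * ‖x‖ ≤ zeta P x := by
  obtain ⟨C, hC⟩ := h.exists_le_nlog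
  by_cases hx : x = 0
  · rw [hx]; simpa using h.zeta_nonneg 0
  have h1 : Tendsto (fun k : ℕ => ν₁ * ‖x‖ - C / k) atTop (𝓝 (ν₁ * ‖x‖ - 0)) :=
    tendsto_const_nhds.sub (tendsto_const_div_atTop_nhds_zero_nat C)
  rw [sub_zero] at h1
  refine le_of_tendsto_of_tendsto h1 (h.tendsto_zeta x) ?_
  refine (eventually_gt_atTop 0).mono fun k hk => ?_
  have hk' : (0 : ℝ) < k := Nat.cast_pos.2 hk
  have h2 := hC (k • x) (smul_ne_zero hk.ne' hx)
  have h3 : ‖k • x‖ = k * ‖x‖ := by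
    have := norm_smul (k : ℤ) x
    simpa using this
  rw [h3] at h2
  rw [le_div_iff₀ hk', sub_mul, div_mul_cancel₀ _ hk'.ne']
  linarith

lemma exists_zeta_le : ∃ C : ℝ, 0 ≤ C ∧ (∀ x : Fin d → ℤ, nlog P x ≤ C * ‖x‖) ∧
    ∀ x : Fin d → ℤ, zeta P x ≤ C * ‖x‖ := by
  obtain ⟨C, hC0, hC⟩ := h.exists_nlog_le
  exact ⟨C, hC0, hC, fun x => (h.zeta_le_nlog x).trans (hC x)⟩

/-- The two-point function decays with rate `ζ`, uniformly in the direction. -/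
lemma exists_nlog_le_zeta_add {ε : ℝ} (hε : 0 < ε) :
    ∃ C' : ℝ, 0 ≤ C' ∧ ∀ x : Fin d → ℤ, nlog P x ≤ zeta P x + ε * ‖x‖ + C' := by
  obtain ⟨C, hC0, hC, hCζ⟩ := h.exists_zeta_le
  -- Every `x` is close to `k • v` with `v` in a fixed box and `k` about `‖x‖ / M`. There are
  -- finitely many `v`, so the convergence along their multiples is uniform; the rounding error and
  -- the slack are at most `2 * C + 1` per multiple, which the choice of `M` makes at most `ε ‖x‖`
  -- plus a constant.
  obtain ⟨M, hM⟩ := exists_nat_gt ((2 * C + 1) / ε)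
  have hM0 : (0 : ℝ) < M := lt_of_le_of_lt (by positivity) hM
  have hloc : ∀ v : Fin d → ℤ, ∃ D : ℝ, 0 ≤ D ∧
      ∀ k : ℕ, nlog P (k • v) ≤ k * (zeta P v + 1) + D := by
    intro v
    have h1 := (h.tendsto_zeta v).eventually_lt_const (lt_add_one (zeta P v))
    obtain ⟨k₀, hk₀⟩ := eventually_atTop.1 h1
    refine ⟨∑ k ∈ Finset.range (k₀ + 1), nlog P (k • v),
      Finset.sum_nonneg fun _ _ => h.nlog_nonneg _, fun k => ?_⟩
    have hz := h.zeta_nonneg v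
    by_cases hk : k < k₀ + 1
    · have h2 := Finset.single_le_sum (f := fun k : ℕ => nlog P (k • v))
        (fun _ _ => h.nlog_nonneg _) (Finset.mem_range.2 hk)
      have : 0 ≤ (k : ℝ) * (zeta P v + 1) := by positivity
      linarith
    · have hkpos : (0 : ℝ) < k := by
        have : 0 < k := by omega
        exact_mod_cast this
      have h2 := (hk₀ k (by omega)).le
      rw [div_le_iff₀ hkpos] at h2
      have := Finset.sum_nonneg (s := Finset.range (k₀ + 1))
        (f := fun k : ℕ => nlog P (k • v)) fun _ _ => h.nlog_nonneg _
      linarith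
  choose D hD0 hD using hloc
  set D' := ∑ v ∈ box d (M + 1), D v with hD'
  have hDD' : ∀ v ∈ box d (M + 1), D v ≤ D' := fun v hv =>
    Finset.single_le_sum (fun v _ => hD0 v) hv
  refine ⟨D' + (2 * C + 1), by
    have : 0 ≤ D' := Finset.sum_nonneg fun v _ => hD0 v
    positivity, fun x => ?_⟩
  set k : ℕ := ⌊‖x‖ / M⌋₊ + 1 with hk
  have hk0 : (0 : ℝ) < k := by rw [hk]; positivity
  have hk1 : (k : ℝ) ≤ ‖x‖ / M + 1 := by
    rw [hk]; push_cast
    have := Nat.floor_le (div_nonneg (norm_nonneg x) hM0.le)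
    linarith
  have hk2 : ‖x‖ ≤ M * k := by
    have := (Nat.lt_floor_add_one (‖x‖ / M)).le
    rw [div_le_iff₀ hM0] at this
    rw [hk]; push_cast; linarith
  set v : Fin d → ℤ := fun i => x i / (k : ℤ) with hv
  have hkz : (0 : ℤ) < k := by exact_mod_cast hk0
  have hdiff : ‖x - k • v‖ ≤ k := by
    rw [pi_norm_le_iff_of_nonneg hk0.le]
    intro i
    have h1 : (x - k • v) i = x i % (k : ℤ) := by
      rw [Pi.sub_apply, Pi.smul_apply, nsmul_eq_mul, hv, Int.emod_def]
    rw [h1, Int.norm_eq_abs, abs_of_nonneg (by exact_mod_cast Int.emod_nonneg _ hkz.ne')]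
    exact_mod_cast (Int.emod_lt_of_pos _ hkz).le
  have hnk : ‖k • v‖ = k * ‖v‖ := by
    have := norm_smul (k : ℤ) v
    simpa using this
  have hvbox : v ∈ box d (M + 1) := by
    rw [norm_le_iff_mem_box]
    have h1 : (k : ℝ) * ‖v‖ ≤ k * (M + 1) := by
      rw [← hnk]
      calc ‖k • v‖ = ‖x - (x - k • v)‖ := by rw [sub_sub_cancel]
        _ ≤ ‖x‖ + ‖x - k • v‖ := norm_sub_le _ _
        _ ≤ M * k + k := add_le_add hk2 hdiff
        _ = k * (M + 1) := by ring
    have := le_of_mul_le_mul_left h1 hk0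
    push_cast; exact this
  have e1 : nlog P x ≤ nlog P (k • v) + nlog P (x - k • v) := by
    have := h.nlog_add_le (k • v) (x - k • v)
    rwa [add_sub_cancel] at this
  have e2 : nlog P (x - k • v) ≤ C * k := (hC _).trans (by gcongr)
  have e3 := hD v k
  have e4 := hDD' v hvbox
  have e5 : (k : ℝ) * zeta P v ≤ zeta P x + C * k := by
    rw [← h.zeta_nsmul]
    have h1 := h.zeta_add_le x (k • v - x)
    rw [add_sub_cancel, ← neg_sub, h.zeta_neg] at h1
    have h2 : zeta P (x - k • v) ≤ C * k := (hCζ _).trans (by gcongr)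
    linarith
  have e6 : (2 * C + 1) * k ≤ ε * ‖x‖ + (2 * C + 1) := by
    have h1 : (2 * C + 1) * k ≤ (2 * C + 1) * (‖x‖ / M + 1) := by gcongr
    have h2 : (2 * C + 1) * (‖x‖ / M) ≤ ε * ‖x‖ := by
      rw [div_lt_iff₀ hε] at hM
      rw [mul_div_assoc', div_le_iff₀ hM0]
      nlinarith [norm_nonneg x]
    linarith
  nlinarith

/-- Homogeneity of `ξ` in the lattice directions. -/
lemma xi_smul_emb {r : ℝ} (hr : 0 < r) (y : Fin d → ℤ) : xi P (r • emb y) = r * zeta P y := by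
  obtain ⟨C, hC0, hC, -⟩ := h.exists_zeta_le
  -- The integer part of `k r y` stays at bounded distance from the multiple `m k • y`, and `nlog`
  -- is Lipschitz, so the limit along the lattice direction `y` determines the limit for the
  -- non-lattice vector `r y`.
  set m : ℕ → ℕ := fun k => ⌊r * (k : ℝ)⌋₊ with hm
  set g : ℕ → (Fin d → ℤ) := fun k => intPart ((k : ℝ) • r • emb y) with hg
  have hmtop : Tendsto m atTop atTop :=
    tendsto_nat_floor_atTop.comp (tendsto_natCast_atTop_atTop.const_mul_atTop hr)
  have hmk : Tendsto (fun k : ℕ => (m k : ℝ) / k) atTop (𝓝 r) :=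
    (tendsto_nat_floor_mul_div_atTop hr.le).comp tendsto_natCast_atTop_atTop
  have h1 : Tendsto (fun k : ℕ => (m k : ℝ) / k * (nlog P (m k • y) / m k)) atTop
      (𝓝 (r * zeta P y)) := hmk.mul ((h.tendsto_zeta y).comp hmtop)
  have hdist : ∀ k, ‖g k - m k • y‖ ≤ ‖y‖ + 1 := by
    intro k
    rw [pi_norm_le_iff_of_nonneg (by positivity)]
    intro i
    have e1 : g k i = ⌊(k : ℝ) * (r * y i)⌋ := by simp [hg, intPart, emb]
    rw [Pi.sub_apply, Pi.smul_apply, e1, Int.norm_eq_abs, nsmul_eq_mul]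
    push_cast
    have e2 := Int.floor_le ((k : ℝ) * (r * y i))
    have e3 := Int.lt_floor_add_one ((k : ℝ) * (r * y i))
    have e4 := Nat.floor_le (by positivity : 0 ≤ r * (k : ℝ))
    have e5 := Nat.lt_floor_add_one (r * (k : ℝ))
    have e6 := norm_le_pi_norm y i
    rw [Int.norm_eq_abs] at e6
    have e7 : |(r * (k : ℝ) - m k) * y i| ≤ ‖y‖ := by
      rw [abs_mul]
      calc |r * (k : ℝ) - m k| * |(y i : ℝ)| ≤ 1 * ‖y‖ := by
            refine mul_le_mul ?_ e6 (abs_nonneg _) zero_le_one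
            rw [abs_le]; constructor <;> simp only [hm] <;> linarith
        _ = ‖y‖ := one_mul _
    have e8 := abs_le.1 e7
    rw [abs_le]
    have e9 : (k : ℝ) * (r * y i) = (r * (k : ℝ) - m k) * y i + m k * y i := by ring
    constructor <;> linarith [e8.1, e8.2]
  have hlip : ∀ a b : Fin d → ℤ, |nlog P a - nlog P b| ≤ C * ‖a - b‖ := by
    intro a b
    rw [abs_le]
    have e1 := h.nlog_add_le b (a - b)
    have e2 := h.nlog_add_le a (b - a)
    rw [add_sub_cancel] at e1 e2
    rw [← neg_sub, h.nlog_neg] at e2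
    have e3 := hC (a - b)
    constructor <;> linarith
  have h2 : Tendsto (fun k : ℕ => (nlog P (g k) - nlog P (m k • y)) / k) atTop (𝓝 0) := by
    refine squeeze_zero_norm (fun k => ?_)
      (tendsto_const_div_atTop_nhds_zero_nat (C * (‖y‖ + 1)))
    rw [norm_div, Real.norm_eq_abs, Real.norm_natCast]
    refine div_le_div_of_nonneg_right ((hlip _ _).trans ?_) (Nat.cast_nonneg _)
    exact mul_le_mul_of_nonneg_left (hdist k) hC0
  have h3 : Tendsto (fun k : ℕ => (1 / (k : ℝ)) *
      Real.log (P.real (connected J 0 (intPart ((k : ℝ) • r • emb y))))) atTop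
      (𝓝 (-(r * zeta P y))) := by
    have h4 := (h1.add h2).neg
    rw [add_zero] at h4
    refine h4.congr' ?_
    filter_upwards [hmtop.eventually_gt_atTop 0] with k hk
    have hmk0 : (m k : ℝ) ≠ 0 := by exact_mod_cast hk.ne'
    have e1 : (m k : ℝ) / k * (nlog P (m k • y) / m k) = nlog P (m k • y) / k := by
      field_simp
    rw [e1, ← add_div, add_sub_cancel, nlog]
    ring
  rw [xi, h3.limUnder_eq, neg_neg]

/-- A vector of the Wulff shape is dominated by `ζ` on the lattice. -/
lemma inner_le_zeta {t : EuclideanSpace ℝ (Fin d)} (ht : t ∈ frontier (wulff P))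
    (y : Fin d → ℤ) : inner ℝ t (emb y) ≤ zeta P y := by
  have hclosed : IsClosed (wulff P) :=
    isClosed_biInter fun n _ => isClosed_le (by fun_prop) continuous_const
  have ht' : t ∈ wulff P := hclosed.frontier_subset ht
  by_cases hy : y = 0
  · have : emb y = 0 := by ext i; simp [emb, hy]
    rw [this, inner_zero_right]; exact h.zeta_nonneg y
  have hpos : 0 < ‖emb y‖ := lt_of_lt_of_le one_pos ((one_le_norm hy).trans (norm_le_norm_emb y))
  have h1 := Set.mem_iInter₂.1 ht' (‖emb y‖⁻¹ • emb y) (by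
    rw [mem_sphere_zero_iff_norm, norm_smul, norm_inv, norm_norm, inv_mul_cancel₀ hpos.ne'])
  rw [Set.mem_ofPred_eq, h.xi_smul_emb (inv_pos.2 hpos), inner_smul_right] at h1
  exact le_of_mul_le_mul_left h1 (inv_pos.2 hpos)

end Subcritical

end

/-! ### Skeletons of a cluster -/

section
variable {d : ℕ} {J : Coupling d} {β q : ℝ} {P : Measure (Config J)}

open Classical in
/-- The ball `{y | ζ (y - v) ≤ r}` of the norm `ζ`. -/
def zball (P : Measure (Config J)) (ν₁ r : ℝ) (v : Fin d → ℤ) : Finset (Fin d → ℤ) :=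
  (translate v (box d ⌈r / ν₁⌉₊)).filter fun y => zeta P (y - v) ≤ r

lemma card_zball_le (P : Measure (Config J)) {ν₁ r : ℝ} (hν : 0 < ν₁) (hr : 0 ≤ r)
    (v : Fin d → ℤ) : ((zball P ν₁ r v).card : ℝ) ≤ (2 / ν₁ * r + 3) ^ d := by
  classical
  have h1 : (zball P ν₁ r v).card ≤ (2 * ⌈r / ν₁⌉₊ + 1) ^ d := by
    rw [← card_box]
    refine (Finset.card_filter_le _ _).trans ?_
    rw [translate, Finset.card_map]
  refine (Nat.cast_le.2 h1).trans ?_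
  push_cast
  refine pow_le_pow_left₀ (by positivity) ?_ d
  have := (Nat.ceil_lt_add_one (div_nonneg hr hν.le)).le
  calc 2 * (⌈r / ν₁⌉₊ : ℝ) + 1 ≤ 2 * (r / ν₁ + 1) + 1 := by gcongr
    _ = 2 / ν₁ * r + 3 := by ring

lemma mem_or_eq_of_mem_cluster_restrict {D : Finset (Fin d → ℤ)} {ω : Config J}
    {x y : Fin d → ℤ} (hy : y ∈ cluster (restrict D ω) x) : y = x ∨ y ∈ D :=
  cluster_induction (p := fun y => y = x ∨ y ∈ D) (Or.inl rfl)
    (fun _ _ _ _ hab => Or.inr (restrict_adj.1 hab).2.2) hy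

open Classical in
/-- The union of the `ζ`-balls of radius `r` centred at the elements of a list. -/
def zballs (P : Measure (Config J)) (ν₁ r : ℝ) (L : List (Fin d → ℤ)) : Finset (Fin d → ℤ) :=
  L.toFinset.biUnion (zball P ν₁ r)

lemma mem_zballs {ν₁ r : ℝ} {L : List (Fin d → ℤ)} {y : Fin d → ℤ} :
    y ∈ zballs P ν₁ r L ↔ ∃ v ∈ L, y ∈ zball P ν₁ r v := by
  classical
  simp [zballs]

/-- The event that `y` is connected to a `ζ`-distance larger than `K` without using the balls of
radius `K₂` around the elements of `L`. -/
def escapes (P : Measure (Config J)) (ν₁ K K₁ K₂ : ℝ) (L : List (Fin d → ℤ)) (y : Fin d → ℤ) :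
    Set (Config J) :=
  by classical exact {ω | restrict (zball P ν₁ K₁ y \ zballs P ν₁ K₂ L) ω ∈
    {ω' : Config J | ∃ z, K < zeta P (z - y) ∧ z ∈ cluster ω' y}}

/-- Successive escapes from all the elements of a list. -/
def skeletonEvent (P : Measure (Config J)) (ν₁ K K₁ K₂ : ℝ) : List (Fin d → ℤ) → Set (Config J)
  | [] => Set.univ
  | y :: L => skeletonEvent P ν₁ K K₁ K₂ L ∩ escapes P ν₁ K K₁ K₂ L y

lemma measurableSet_far (K : ℝ) (y : Fin d → ℤ) :
    MeasurableSet {ω' : Config J | ∃ z, K < zeta P (z - y) ∧ z ∈ cluster ω' y} :=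
  measurableSet_setOfPred.2
    (Measurable.exists fun z => measurable_const.and (measurable_mem_cluster y z))

lemma isUpperSet_far (K : ℝ) (y : Fin d → ℤ) :
    IsUpperSet {ω' : Config J | ∃ z, K < zeta P (z - y) ∧ z ∈ cluster ω' y} :=
  fun _ _ h ⟨z, hz, hzy⟩ => ⟨z, hz, cluster_mono h y hzy⟩

lemma measurableSet_escapes {ν₁ K K₁ K₂ : ℝ} (L : List (Fin d → ℤ)) (y : Fin d → ℤ) :
    MeasurableSet (escapes P ν₁ K K₁ K₂ L y) :=
  measurable_restrict _ (measurableSet_far K y)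

lemma measurableSet_skeletonEvent {ν₁ K K₁ K₂ : ℝ} (L : List (Fin d → ℤ)) :
    MeasurableSet (skeletonEvent P ν₁ K K₁ K₂ L) := by
  induction L with
  | nil => exact MeasurableSet.univ
  | cons y L ih => exact ih.inter (measurableSet_escapes L y)

lemma dependsOnlyOn_skeletonEvent {ν₁ K K₁ K₂ : ℝ} (L : List (Fin d → ℤ)) :
    DependsOnlyOn (zballs P ν₁ K₁ L) (skeletonEvent P ν₁ K K₁ K₂ L) := by
  classical
  induction L with
  | nil => exact fun _ _ _ => Iff.rfl
  | cons y L ih =>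
    have h1 : zballs P ν₁ K₁ L ⊆ zballs P ν₁ K₁ (y :: L) := by
      intro z hz
      obtain ⟨v, hv, hzv⟩ := mem_zballs.1 hz
      exact mem_zballs.2 ⟨v, List.mem_cons_of_mem _ hv, hzv⟩
    have h2 : zball P ν₁ K₁ y \ zballs P ν₁ K₂ L ⊆ zballs P ν₁ K₁ (y :: L) :=
      fun z hz => mem_zballs.2 ⟨y, List.mem_cons_self, (Finset.mem_sdiff.1 hz).1⟩
    exact fun ω ω' hωω' => and_congr (ih.mono h1 ω ω' hωω')
      ((dependsOnlyOn_restrict _ _).mono h2 ω ω' hωω')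

open Classical in
/-- The states of the exploration after at most `n` steps: a list of sites and a stack; a step
puts a neighbour (in the sense of `Δ`) of the top of the stack on the list and on the stack, or
removes the top of the stack. -/
def explorationStates (Δ : Finset (Fin d → ℤ)) :
    ℕ → Finset (List (Fin d → ℤ) × List (Fin d → ℤ))
  | 0 => {([0], [0])}
  | n + 1 => explorationStates Δ n ∪ ((explorationStates Δ n).image fun s => (s.1, s.2.tail)) ∪
      ((explorationStates Δ n) ×ˢ Δ).image
        fun s => ((s.1.2.headD 0 + s.2) :: s.1.1, (s.1.2.headD 0 + s.2) :: s.1.2)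

lemma card_explorationStates_le (Δ : Finset (Fin d → ℤ)) (n : ℕ) :
    (explorationStates Δ n).card ≤ (Δ.card + 2) ^ n := by
  classical
  induction n with
  | zero => simp [explorationStates]
  | succ n ih =>
    rw [explorationStates]
    refine (Finset.card_union_le _ _).trans ?_
    have h1 := Finset.card_union_le (explorationStates Δ n)
      ((explorationStates Δ n).image fun s => (s.1, s.2.tail))
    have h2 := Finset.card_image_le (s := explorationStates Δ n)
      (f := fun s => (s.1, s.2.tail))
    have h3 := Finset.card_image_le (s := (explorationStates Δ n) ×ˢ Δ)
      (f := fun s => ((s.1.2.headD 0 + s.2) :: s.1.1, (s.1.2.headD 0 + s.2) :: s.1.2))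
    rw [Finset.card_product] at h3
    calc _ ≤ (explorationStates Δ n).card * (Δ.card + 2) := by linarith
      _ ≤ (Δ.card + 2) ^ n * (Δ.card + 2) := Nat.mul_le_mul_right _ ih
      _ = (Δ.card + 2) ^ (n + 1) := (pow_succ _ _).symm

lemma explorationStates_mono (Δ : Finset (Fin d → ℤ)) {m n : ℕ} (hmn : m ≤ n) :
    explorationStates Δ m ⊆ explorationStates Δ n := by
  classical
  induction n, hmn using Nat.le_induction with
  | base => exact subset_rfl
  | succ n _ ih =>
    rw [explorationStates, Finset.union_assoc]
    exact ih.trans Finset.subset_union_left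

namespace Subcritical

variable {ν₀ ν₁ : ℝ} {R : ℕ} (h : Subcritical J β q P ν₀ ν₁ R)

include h

lemma mem_zball {r : ℝ} {v y : Fin d → ℤ} : y ∈ zball P ν₁ r v ↔ zeta P (y - v) ≤ r := by
  classical
  unfold zball
  rw [Finset.mem_filter, and_iff_right_iff_imp]
  intro hy
  rw [mem_translate, norm_le_iff_mem_box]
  refine le_trans ?_ (Nat.le_ceil _)
  rw [le_div_iff₀ h.hν₁, mul_comm]
  exact (h.nu_mul_norm_le_zeta _).trans hy

/-- The probability of one escape. -/
lemma real_escapes_le {K K₁ K₂ : ℝ} (hK : 0 ≤ K) (hK₁ : 0 ≤ K₁) (L : List (Fin d → ℤ))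
    (y : Fin d → ℤ) :
    P.real (escapes P ν₁ K K₁ K₂ L y) ≤ (2 / ν₁ * K₁ + 3) ^ d * Real.exp (-K) := by
  classical
  have := h.isProb
  set I := (zball P ν₁ K₁ y).filter fun z => K < zeta P (z - y) with hI
  have hsub : escapes P ν₁ K K₁ K₂ L y ⊆ ⋃ z ∈ I, connected J y z := by
    rintro ω ⟨z, hz, hzc⟩
    rcases mem_or_eq_of_mem_cluster_restrict hzc with rfl | hzD
    · rw [sub_self, h.zeta_zero] at hz; linarith
    · simp only [Set.mem_iUnion]
      exact ⟨z, Finset.mem_filter.2 ⟨(Finset.mem_sdiff.1 hzD).1, hz⟩,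
        cluster_mono (restrict_le _ _) y hzc⟩
  calc P.real (escapes P ν₁ K K₁ K₂ L y) ≤ P.real (⋃ z ∈ I, connected J y z) :=
        measureReal_mono hsub (measure_ne_top _ _)
    _ ≤ ∑ z ∈ I, P.real (connected J y z) := measureReal_biUnion_finset_le _ _
    _ ≤ ∑ _z ∈ I, Real.exp (-K) := by
        refine Finset.sum_le_sum fun z hz => ?_
        rw [h.connected_eq]
        refine (h.connected_le_exp_zeta _).trans (Real.exp_le_exp.2 ?_)
        linarith [(Finset.mem_filter.1 hz).2]
    _ = I.card * Real.exp (-K) := by rw [Finset.sum_const, nsmul_eq_mul]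
    _ ≤ _ := by
        refine mul_le_mul_of_nonneg_right ?_ (Real.exp_pos _).le
        exact (Nat.cast_le.2 (Finset.card_filter_le _ _)).trans (card_zball_le P h.hν₁ hK₁ y)

/-- The probability of a skeleton. -/
lemma real_skeletonEvent_le {K K₁ K₂ C : ℝ} (hK : 0 ≤ K) (hK₁ : 0 ≤ K₁) {ρ : ℕ}
    (hC : ∀ x : Fin d → ℤ, zeta P x ≤ C * ‖x‖) (hC0 : 0 ≤ C)
    (hK₂ : K₁ + C * (2 * ρ + R) ≤ K₂)
    (hρ : (2 / ν₁ * K₁ + 3) ^ d * ν₀ *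
      ((4 * (ρ : ℝ) + (2 * R + 1)) ^ d * Real.exp (-ν₁ * ρ)) ≤ 1 / 2) (L : List (Fin d → ℤ)) :
    P.real (skeletonEvent P ν₁ K K₁ K₂ L) ≤
      (2 * ((2 / ν₁ * K₁ + 3) ^ d * Real.exp (-K))) ^ L.length := by
  classical
  have := h.isProb
  induction L with
  | nil => simp [skeletonEvent]
  | cons y L ih =>
    set D := zball P ν₁ K₁ y \ zballs P ν₁ K₂ L with hD
    have hcard : (D.card : ℝ) ≤ (2 / ν₁ * K₁ + 3) ^ d :=
      (Nat.cast_le.2 (Finset.card_le_card Finset.sdiff_subset)).trans (card_zball_le P h.hν₁ hK₁ y)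
    have hnn : 0 ≤ ν₀ * ((4 * (ρ : ℝ) + (2 * R + 1)) ^ d * Real.exp (-ν₁ * ρ)) :=
      mul_nonneg h.nonneg_nu₀ (by positivity)
    -- The earlier escapes live in balls of radius `K₁`, whereas `D` avoids the balls of radius
    -- `K₂`; the gap between the radii leaves room for the decoupling width `2 * ρ + R`.
    have hoff : DependsOnlyOff (fatten (2 * ρ + R) D) (skeletonEvent P ν₁ K K₁ K₂ L) := by
      refine (dependsOnlyOn_skeletonEvent L).dependsOnlyOff (Finset.disjoint_left.2 ?_)
      intro z hz hzf
      obtain ⟨v, hv, hzv⟩ := mem_zballs.1 hz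
      obtain ⟨w, hw, hzw⟩ := mem_fatten.1 hzf
      refine (Finset.mem_sdiff.1 hw).2 (mem_zballs.2 ⟨v, hv, h.mem_zball.2 ?_⟩)
      have h1 : ‖w - z‖ ≤ 2 * ρ + R := by
        rw [pi_norm_le_iff_of_nonneg (by positivity)]
        intro i
        rw [Pi.sub_apply, Int.norm_eq_abs]
        have := hzw i
        rw [abs_sub_comm] at this
        exact_mod_cast this
      have h2 := hC (w - z)
      have h3 := h.mem_zball.1 hzv
      have h4 := h.zeta_sub_le w z v
      have h5 : C * ‖w - z‖ ≤ C * (2 * ρ + R) := by gcongr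
      linarith
    have hstep := h.real_inter_le_two_mul (D := D) (ρ := ρ)
      (by
        refine le_trans ?_ hρ
        rw [mul_assoc, mul_assoc]
        exact mul_le_mul_of_nonneg_right hcard hnn)
      (measurableSet_skeletonEvent L) hoff (measurableSet_escapes (K₁ := K₁) (K₂ := K₂) L y)
      (dependsOnlyOn_restrict _ _) (isUpperSet_restrict _ (isUpperSet_far K y))
    rw [List.length_cons, pow_succ, mul_comm ((2 * _) ^ _)]
    refine hstep.trans (mul_le_mul ?_ ih measureReal_nonneg (by
      have := h.hν₁; positivity))
    exact mul_le_mul_of_nonneg_left (h.real_escapes_le hK hK₁ L y) zero_le_two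

/-- A path that avoids the balls and goes far yields an escape. -/
lemma mem_escapes {K K₁ K₂ : ℝ} {L : List (Fin d → ℤ)} {a z : Fin d → ℤ} {ω : Config J}
    (hK : 0 ≤ K) (hstep : ∀ x y, (bondGraph J).Adj x y → K + zeta P (y - x) ≤ K₁)
    {D : Finset (Fin d → ℤ)} (hD : ∀ w ∈ D, w ∉ zballs P ν₁ K₂ L)
    (hz : z ∈ cluster (restrict D ω) a) (hfar : K < zeta P (z - a)) :
    ω ∈ escapes P ν₁ K K₁ K₂ L a := by
  classical
  by_contra hcon
  set D' := zball P ν₁ K₁ a \ zballs P ν₁ K₂ L with hD'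
  obtain ⟨w, w', -, ⟨hwc, hwK⟩, hadj, hw'⟩ := exists_adj_of_mem_cluster
    (p := fun w => w ∈ cluster (restrict D' ω) a ∧ zeta P (w - a) ≤ K) hz
    ⟨mem_cluster_self _ _, by rw [sub_self, h.zeta_zero]; exact hK⟩
    (fun hh => absurd hh.2 (not_le.2 hfar))
  obtain ⟨hadj, hwD, hw'D⟩ := restrict_adj.1 hadj
  have h1 := hstep w w' (openGraph_le_bondGraph ω hadj)
  have h2 := h.zeta_sub_le w' w a
  have h3 := h.zeta_nonneg (w' - w)
  have hw'c : w' ∈ cluster (restrict D' ω) a := by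
    refine mem_cluster_of_adj hwc (restrict_adj.2 ⟨hadj, ?_, ?_⟩)
    · exact Finset.mem_sdiff.2 ⟨h.mem_zball.2 (by linarith), hD w hwD⟩
    · exact Finset.mem_sdiff.2 ⟨h.mem_zball.2 (by linarith), hD w' hw'D⟩
  exact hcon ⟨w', lt_of_not_ge fun hle => hw' ⟨hw'c, hle⟩, hw'c⟩

-- Recording more sites only makes escapes harder. Hence a site removed from the stack because it
-- had no further escape nearby stays exhausted.
omit h in
lemma escapes_antitone {K K₁ K₂ : ℝ} {L : List (Fin d → ℤ)} {a y : Fin d → ℤ} :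
    escapes P ν₁ K K₁ K₂ (y :: L) a ⊆ escapes P ν₁ K K₁ K₂ L a := by
  classical
  rintro ω ⟨z, hz, hzc⟩
  refine ⟨z, hz, cluster_mono (restrict_mono_set ?_ ω) a hzc⟩
  refine Finset.sdiff_subset_sdiff subset_rfl fun w hw => ?_
  obtain ⟨v, hv, hwv⟩ := mem_zballs.1 hw
  exact mem_zballs.2 ⟨v, List.mem_cons_of_mem _ hv, hwv⟩

omit h in
lemma exists_mem_box_pair (a b : Fin d → ℤ) (N : ℕ) :
    ∃ M, N ≤ M ∧ a ∈ box d M ∧ b ∈ box d M := by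
  refine ⟨max N (max ⌈‖a‖⌉₊ ⌈‖b‖⌉₊), le_max_left _ _, ?_, ?_⟩
  · rw [norm_le_iff_mem_box]
    exact (Nat.le_ceil _).trans (by exact_mod_cast le_max_of_le_right (le_max_left _ _))
  · rw [norm_le_iff_mem_box]
    exact (Nat.le_ceil _).trans (by exact_mod_cast le_max_of_le_right (le_max_right _ _))

/-- If no further escape is possible then the whole cluster is near the skeleton. -/
lemma exists_near_of_exhausted {K K₁ K₂ K₃ : ℝ} {L : List (Fin d → ℤ)} {ω : Config J}
    (hK : 0 ≤ K) (hK₂ : 0 ≤ K₂)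
    (hstep : ∀ x y, (bondGraph J).Adj x y → K + zeta P (y - x) ≤ K₁)
    (hstep' : ∀ x y, (bondGraph J).Adj x y → K₂ + zeta P (y - x) ≤ K₃)
    (h0 : (0 : Fin d → ℤ) ∈ L)
    (hex : ∀ v ∈ L, ∀ y ∈ cluster ω 0, zeta P (y - v) ≤ K₃ → y ∉ zballs P ν₁ K₂ L →
      ω ∉ escapes P ν₁ K K₁ K₂ L y) {z : Fin d → ℤ} (hz : z ∈ cluster ω 0) (hK₂₃ : K₂ ≤ K + K₃) :
    ∃ v ∈ L, zeta P (z - v) ≤ K + K₃ := by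
  classical
  by_cases hzU : z ∈ zballs P ν₁ K₂ L
  · obtain ⟨v, hv, hzv⟩ := mem_zballs.1 hzU
    exact ⟨v, hv, (h.mem_zball.1 hzv).trans hK₂₃⟩
  have h0U : (0 : Fin d → ℤ) ∈ zballs P ν₁ K₂ L :=
    mem_zballs.2 ⟨0, h0, h.mem_zball.2 (by rw [sub_self, h.zeta_zero]; exact hK₂)⟩
  -- Follow the cluster from `z` towards `0` outside the balls of radius `K₂`, up to the last site
  -- `a` before it enters one of them. Then `a` is within `K₃` of a recorded site, and if `z` were
  -- farther than `K` from `a`, the path back to `z` would give a new escape from `a`.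
  obtain ⟨a, b, haz, ⟨N, haN⟩, hab, hb⟩ := exists_adj_of_mem_cluster
    (p := fun a => ∃ N, a ∈ cluster (restrict (box d N \ zballs P ν₁ K₂ L) ω) z)
    (mem_cluster_comm.1 hz) ⟨0, mem_cluster_self _ _⟩ (by
      rintro ⟨N, hN⟩
      rcases mem_or_eq_of_mem_cluster_restrict hN with h1 | h1
      · exact hzU (h1 ▸ h0U)
      · exact (Finset.mem_sdiff.1 h1).2 h0U)
  have haU : a ∉ zballs P ν₁ K₂ L := by
    rcases mem_or_eq_of_mem_cluster_restrict haN with h1 | h1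
    · rwa [h1]
    · exact (Finset.mem_sdiff.1 h1).2
  have hbU : b ∈ zballs P ν₁ K₂ L := by
    by_contra hbU
    obtain ⟨M, hNM, haM, hbM⟩ := exists_mem_box_pair a b N
    refine hb ⟨M, mem_cluster_of_adj (cluster_mono (restrict_mono_set
      (Finset.sdiff_subset_sdiff (fun y hy => ?_) subset_rfl) ω) z haN) (restrict_adj.2
        ⟨hab, Finset.mem_sdiff.2 ⟨haM, haU⟩, Finset.mem_sdiff.2 ⟨hbM, hbU⟩⟩)⟩
    exact mem_box.2 fun i => (mem_box.1 hy i).trans (by exact_mod_cast hNM)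
  obtain ⟨v, hv, hbv⟩ := mem_zballs.1 hbU
  have hav : zeta P (a - v) ≤ K₃ := by
    have h1 := h.zeta_sub_le a b v
    have h2 := hstep' a b (openGraph_le_bondGraph ω hab)
    rw [h.zeta_sub_comm b a] at h2
    have h3 := h.mem_zball.1 hbv
    linarith
  have ha0 : a ∈ cluster ω 0 := by rw [← cluster_eq_of_mem hz]; exact haz
  have hnot := hex v hv a ha0 hav haU
  have hza : zeta P (z - a) ≤ K := by
    by_contra hfar
    exact hnot (h.mem_escapes hK hstep (fun w hw => (Finset.mem_sdiff.1 hw).2)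
      (mem_cluster_comm.1 haN) (not_le.1 hfar))
  exact ⟨v, hv, (h.zeta_sub_le z a v).trans (add_le_add hza hav)⟩

/-- The sites of `L` form a connected set for jumps of `ζ`-length at most `K₃`. -/
def _root_.FK.JumpConnected (P : Measure (Config J)) (K₃ : ℝ) (V : Set (Fin d → ℤ)) : Prop :=
  ∀ v ∈ V, Relation.ReflTransGen (fun a b => a ∈ V ∧ b ∈ V ∧ zeta P (b - a) ≤ K₃) 0 v

/-- The exploration either finds a skeleton of length `m` or covers the cluster by a shorter
skeleton. -/
lemma exists_skeleton {K K₁ K₂ K₃ : ℝ} {ω : Config J}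
    (hK : 0 ≤ K) (hK₂ : 0 ≤ K₂) (hK₂₃ : K₂ ≤ K + K₃)
    (hstep : ∀ x y, (bondGraph J).Adj x y → K + zeta P (y - x) ≤ K₁)
    (hstep' : ∀ x y, (bondGraph J).Adj x y → K₂ + zeta P (y - x) ≤ K₃)
    {x : Fin d → ℤ} (hx : x ∈ cluster ω 0) (hxK : K < zeta P x) {m : ℕ} (hm : 1 ≤ m) :
    (∃ s ∈ explorationStates (zball P ν₁ K₃ 0) (2 * m), s.1.length = m ∧
      ω ∈ skeletonEvent P ν₁ K K₁ K₂ s.1) ∨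
    ∃ L : List (Fin d → ℤ), L.length ≤ m ∧ 0 ∈ L ∧ (∀ v ∈ L, v ∈ cluster ω 0) ∧
      JumpConnected P K₃ {v | v ∈ L} ∧
      ∀ z ∈ cluster ω 0, ∃ v ∈ L, zeta P (z - v) ≤ K + K₃ := by
  classical
  -- The potential `k` drops by one at every step: a new record changes its two terms by `-2` and
  -- `+1`, a removal from the stack by `0` and `-1`. This bounds the number of steps by `2 * m`.
  suffices H : ∀ (k n : ℕ) (L Q : List (Fin d → ℤ)), 2 * (m - L.length) + Q.length = k →
      n + k ≤ 2 * m → (L, Q) ∈ explorationStates (zball P ν₁ K₃ 0) n → L.length ≤ m →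
      ω ∈ skeletonEvent P ν₁ K K₁ K₂ L → 0 ∈ L → (∀ v ∈ L, v ∈ cluster ω 0) →
      JumpConnected P K₃ {v | v ∈ L} → (∀ v ∈ Q, v ∈ L) →
      (∀ v ∈ L, v ∈ Q ∨ ∀ y ∈ cluster ω 0, zeta P (y - v) ≤ K₃ → y ∉ zballs P ν₁ K₂ L →
        ω ∉ escapes P ν₁ K K₁ K₂ L y) →
      (∃ s ∈ explorationStates (zball P ν₁ K₃ 0) (2 * m), s.1.length = m ∧
        ω ∈ skeletonEvent P ν₁ K K₁ K₂ s.1) ∨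
      ∃ L : List (Fin d → ℤ), L.length ≤ m ∧ 0 ∈ L ∧ (∀ v ∈ L, v ∈ cluster ω 0) ∧
        JumpConnected P K₃ {v | v ∈ L} ∧
        ∀ z ∈ cluster ω 0, ∃ v ∈ L, zeta P (z - v) ≤ K + K₃ by
    refine H (2 * (m - 1) + 1) 0 [0] [0] (by simp) (by omega) (by simp [explorationStates])
      (by simpa using hm) ?_ (by simp) (by simp [mem_cluster_self]) ?_ (by simp) (by simp)
    -- The origin may be recorded at the start because it is joined to `x`, which is farther than
    -- `K`.
    · refine ⟨trivial, ?_⟩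
      obtain ⟨N, hN⟩ := exists_restrict_of_mem_cluster hx
      exact h.mem_escapes hK hstep (D := box d N) (by simp [mem_zballs]) hN (by rwa [sub_zero])
    · intro v hv
      have : v = 0 := by simpa using hv
      rw [this]
  intro k
  induction k with
  | zero =>
    intro n L Q hk hn hmem hLm hω h0 hLc hconn hQL hex
    have : L.length = m := by omega
    exact Or.inl ⟨_, explorationStates_mono _ (by omega) hmem, this, hω⟩
  | succ k ih =>
    intro n L Q hk hn hmem hLm hω h0 hLc hconn hQL hex
    by_cases hlen : L.length = m
    · exact Or.inl ⟨_, explorationStates_mono _ (by omega) hmem, hlen, hω⟩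
    have hlt : L.length < m := lt_of_le_of_ne hLm hlen
    rcases Q with _ | ⟨v, Q⟩
    · right
      refine ⟨L, hLm, h0, hLc, hconn, fun z hz => ?_⟩
      refine h.exists_near_of_exhausted hK hK₂ hstep hstep' h0 (fun v hv => ?_) hz hK₂₃
      rcases hex v hv with h1 | h1
      · simp at h1
      · exact h1
    have hvL := hQL v List.mem_cons_self
    by_cases hc : ∃ y ∈ cluster ω 0, zeta P (y - v) ≤ K₃ ∧ y ∉ zballs P ν₁ K₂ L ∧
        ω ∈ escapes P ν₁ K K₁ K₂ L y
    · obtain ⟨y, hyc, hyv, hyU, hyω⟩ := hc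
      rw [List.length_cons] at hk
      have hzmono : zballs P ν₁ K₂ L ⊆ zballs P ν₁ K₂ (y :: L) := by
        intro w hw
        obtain ⟨u, hu, hwu⟩ := mem_zballs.1 hw
        exact mem_zballs.2 ⟨u, List.mem_cons_of_mem _ hu, hwu⟩
      have hmem' : (y :: L, y :: v :: Q) ∈ explorationStates (zball P ν₁ K₃ 0) (n + 1) := by
        rw [explorationStates]
        refine Finset.mem_union_right _ (Finset.mem_image.2 ⟨((L, v :: Q), y - v), ?_, ?_⟩)
        · exact Finset.mem_product.2 ⟨hmem, h.mem_zball.2 (by simpa using hyv)⟩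
        · simp
      refine ih (n + 1) (y :: L) (y :: v :: Q) ?_ (by omega) hmem' ?_ ⟨hω, hyω⟩
        (List.mem_cons_of_mem _ h0) ?_ ?_ ?_ ?_
      · simp only [List.length_cons]; omega
      · simpa using hlt
      · intro u hu
        rcases List.mem_cons.1 hu with rfl | hu
        · exact hyc
        · exact hLc u hu
      · have hlift : ∀ u, u ∈ L → Relation.ReflTransGen (fun a b => a ∈ {w | w ∈ y :: L} ∧
            b ∈ {w | w ∈ y :: L} ∧ zeta P (b - a) ≤ K₃) 0 u := by
          intro u hu
          refine Relation.ReflTransGen.mono ?_ 0 u (hconn u hu)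
          exact fun a b hab => ⟨List.mem_cons_of_mem _ hab.1,
            List.mem_cons_of_mem _ hab.2.1, hab.2.2⟩
        intro u hu
        rcases List.mem_cons.1 hu with rfl | hu
        · exact (hlift v hvL).tail ⟨List.mem_cons_of_mem _ hvL, List.mem_cons_self, hyv⟩
        · exact hlift u hu
      · intro u hu
        rcases List.mem_cons.1 hu with rfl | hu
        · exact List.mem_cons_self
        · exact List.mem_cons_of_mem _ (hQL u hu)
      · intro u hu
        rcases List.mem_cons.1 hu with rfl | hu
        · exact Or.inl List.mem_cons_self
        · rcases hex u hu with h1 | h1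
          · exact Or.inl (List.mem_cons_of_mem _ h1)
          · exact Or.inr fun w hw hwu hwU hwω =>
              h1 w hw hwu (fun hw' => hwU (hzmono hw')) (escapes_antitone hwω)
    · push Not at hc
      rw [List.length_cons] at hk
      have hmem' : (L, Q) ∈ explorationStates (zball P ν₁ K₃ 0) (n + 1) := by
        rw [explorationStates]
        exact Finset.mem_union_left _ (Finset.mem_union_right _
          (Finset.mem_image.2 ⟨(L, v :: Q), hmem, rfl⟩))
      refine ih (n + 1) L Q (by omega) (by omega) hmem' hLm hω h0 hLc hconn
        (fun u hu => hQL u (List.mem_cons_of_mem _ hu)) fun u hu => ?_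
      rcases hex u hu with h1 | h1
      · rcases List.mem_cons.1 h1 with rfl | h2
        · exact Or.inr hc
        · exact Or.inl h2
      · exact Or.inr h1

end Subcritical

end

/-! ### Coarse cone points from short skeletons -/

section
variable {d : ℕ} {J : Coupling d} {β q : ℝ} {P : Measure (Config J)}

section Maximal

/-- The site `k` is crowded for the density `e` if some window that starts at `k` has average at
least `1 / p`. -/
def Crowded (p : ℕ) (e : ℤ → ℕ) (k : ℤ) : Prop :=
  ∃ j : ℕ, 1 ≤ j ∧ j ≤ p * ∑ i ∈ Finset.Ico k (k + j), e i

open Classical in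
/-- A one-sided maximal inequality. -/
lemma card_crowded_le (p : ℕ) (e : ℤ → ℕ) {T : Finset ℤ} (hT : ∀ i, i ∉ T → e i = 0) (n : ℕ) :
    ∀ a : ℤ, ((Finset.Ico a (a + n)).filter (Crowded p e)).card ≤
      p * ∑ i ∈ T.filter (fun i => a ≤ i), e i := by
  induction n using Nat.strong_induction_on with
  | _ n ih =>
    intro a
    rcases Nat.eq_zero_or_pos n with rfl | hn
    · simp
    by_cases ha : Crowded p e a
    · obtain ⟨j, hj1, hj⟩ := ha
      have hsub : (Finset.Ico a (a + n)).filter (Crowded p e) ⊆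
          Finset.Ico a (a + j) ∪
            (Finset.Ico (a + j) (a + j + (n - j : ℕ))).filter (Crowded p e) := by
        intro k hk
        rw [Finset.mem_filter, Finset.mem_Ico] at hk
        rw [Finset.mem_union, Finset.mem_filter, Finset.mem_Ico, Finset.mem_Ico]
        by_cases h1 : k < a + j
        · exact Or.inl ⟨hk.1.1, h1⟩
        · exact Or.inr ⟨⟨by omega, by omega⟩, hk.2⟩
      have h1 := ih (n - j) (by omega) (a + j)
      have h2 : ∑ i ∈ Finset.Ico a (a + j), e i ≤
          ∑ i ∈ (T.filter (fun i => a ≤ i)).filter (fun i => i < a + j), e i := by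
        rw [← Finset.sum_filter_add_sum_filter_not (Finset.Ico a (a + j)) (fun i => i ∈ T)]
        rw [Finset.sum_eq_zero (s := (Finset.Ico a (a + j)).filter (fun i => i ∉ T))
          fun i hi => hT i (Finset.mem_filter.1 hi).2, add_zero]
        refine Finset.sum_le_sum_of_subset fun i hi => ?_
        simp only [Finset.mem_filter, Finset.mem_Ico] at hi ⊢
        tauto
      have h3 : ∑ i ∈ T.filter (fun i => a + j ≤ i), e i ≤
          ∑ i ∈ (T.filter (fun i => a ≤ i)).filter (fun i => ¬ i < a + j), e i := by
        refine Finset.sum_le_sum_of_subset fun i hi => ?_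
        simp only [Finset.mem_filter] at hi ⊢
        exact ⟨⟨hi.1, by omega⟩, by omega⟩
      rw [← Finset.sum_filter_add_sum_filter_not (T.filter (fun i => a ≤ i))
        (fun i => i < a + j), mul_add]
      refine (Finset.card_le_card hsub).trans ((Finset.card_union_le _ _).trans (add_le_add ?_ ?_))
      · rw [Int.card_Ico]
        have : (a + j - a).toNat = j := by omega
        rw [this]
        exact hj.trans (Nat.mul_le_mul_left _ h2)
      · exact h1.trans (Nat.mul_le_mul_left _ h3)
    · have hsub : (Finset.Ico a (a + n)).filter (Crowded p e) ⊆
          (Finset.Ico (a + 1) (a + 1 + (n - 1 : ℕ))).filter (Crowded p e) := by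
        intro k hk
        rw [Finset.mem_filter, Finset.mem_Ico] at hk ⊢
        have : k ≠ a := by rintro rfl; exact ha hk.2
        exact ⟨⟨by omega, by omega⟩, hk.2⟩
      refine (Finset.card_le_card hsub).trans ((ih (n - 1) (by omega) (a + 1)).trans ?_)
      refine Nat.mul_le_mul_left _ (Finset.sum_le_sum_of_subset fun i hi => ?_)
      simp only [Finset.mem_filter] at hi ⊢
      exact ⟨hi.1, by omega⟩

end Maximal

section Paths

variable {α : Type*} {G : SimpleGraph α} {s : α → ℤ}

/-- The discrete intermediate value property: levels change by at most one per step. -/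
lemma exists_mem_support_eq (hs : ∀ a b, G.Adj a b → |s b - s a| ≤ 1) {a b : α} (p : G.Walk a b)
    {c : ℤ} (hc : (s a ≤ c ∧ c ≤ s b) ∨ (s b ≤ c ∧ c ≤ s a)) : ∃ w ∈ p.support, s w = c := by
  induction p with
  | nil => rename_i u; exact ⟨u, by simp, by omega⟩
  | @cons u v w huv p ih =>
    by_cases hu : s u = c
    · exact ⟨u, by simp, hu⟩
    · have h1 := abs_le.1 (hs u v huv)
      obtain ⟨w', hw', h2⟩ := ih (by omega)
      exact ⟨w', by simp [hw'], h2⟩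

lemma mem_of_mem_support {V : Finset α} (hV : ∀ a b, G.Adj a b → a ∈ V ∧ b ∈ V) {a b : α}
    (p : G.Walk a b) (ha : a ∈ V) {u : α} (hu : u ∈ p.support) : u ∈ V := by
  induction p with
  | nil => rw [SimpleGraph.Walk.support_nil, List.mem_singleton] at hu; rwa [hu]
  | cons huv p ih =>
    rw [SimpleGraph.Walk.support_cons, List.mem_cons] at hu
    rcases hu with rfl | hu
    · exact ha
    · exact ih (hV _ _ huv).2 hu

/-- A path from above to the unique site on level `k` stays between `k` and any level `c` above
its starting point that has at most one site. -/
lemma path_mem_slab [DecidableEq α] (hs : ∀ a b, G.Adj a b → |s b - s a| ≤ 1) {v y : α}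
    {p : G.Walk v y} (hp : p.IsPath) {c : ℤ} (hv : s y ≤ s v) (hvc : s v ≤ c)
    (hy : ∀ w ∈ p.support, s w = s y → w = y)
    (hc : ∀ w ∈ p.support, ∀ w' ∈ p.support, s w = c → s w' = c → w = w') {u : α}
    (hu : u ∈ p.support) : s y ≤ s u ∧ s u ≤ c := by
  constructor
  · by_contra hcon
    obtain ⟨w, hw, hws⟩ := exists_mem_support_eq hs (p.takeUntil u hu) (c := s y)
      (Or.inr ⟨(not_le.1 hcon).le, hv⟩)
    have hwy := hy w (p.support_takeUntil_subset_support hu hw) hws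
    rw [hwy] at hw
    exact SimpleGraph.Walk.endpoint_notMem_support_takeUntil hp hu
      (by rintro rfl; exact hcon le_rfl) hw
  · by_contra hcon
    push Not at hcon
    obtain ⟨w, hw, hws⟩ := exists_mem_support_eq hs (p.takeUntil u hu) (c := c)
      (Or.inl ⟨hvc, hcon.le⟩)
    obtain ⟨w', hw', hws'⟩ := exists_mem_support_eq hs (p.dropUntil u hu) (c := c)
      (Or.inr ⟨by omega, hcon.le⟩)
    have hww' := hc w (p.support_takeUntil_subset_support hu hw) w'
      (p.support_dropUntil_subset_support hu hw') hws hws'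
    subst hww'
    have hnd : ((p.takeUntil u hu).append (p.dropUntil u hu)).support.Nodup := by
      rw [p.take_spec hu]; exact hp.support_nodup
    rw [SimpleGraph.Walk.support_append, List.nodup_append] at hnd
    have hwt : w ∈ (p.dropUntil u hu).support.tail := by
      rcases (SimpleGraph.Walk.mem_support_iff _).1 hw' with h1 | h1
      · rw [h1] at hws; omega
      · exact h1
    exact hnd.2.2 w hw w hwt rfl

/-- If level `s y` is not crowded then the sites above it are joined to `y` by short paths. -/
lemma exists_short_walk [DecidableEq α] (hs : ∀ a b, G.Adj a b → |s b - s a| ≤ 1) {V : Finset α}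
    (hV : ∀ a b, G.Adj a b → a ∈ V ∧ b ∈ V) {e : ℤ → ℕ}
    (he : ∀ k, (V.filter (fun v => s v = k)).card ≤ e k + 1) {y v : α} (hyV : y ∈ V) (hvV : v ∈ V)
    (hconn : G.Reachable v y) (hgood : ¬ Crowded 10 e (s y)) {j : ℕ} (hj : s v = s y + j) :
    ∃ p : G.Walk v y, p.length ≤ 3 * j + 3 := by
  classical
  unfold Crowded at hgood
  push Not at hgood
  have huniq : ∀ k, e k = 0 → ∀ a ∈ V, ∀ b ∈ V, s a = k → s b = k → a = b := by
    intro k hk a ha b hb hak hbk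
    have h1 := he k
    rw [hk, zero_add] at h1
    exact Finset.card_le_one.1 h1 a (Finset.mem_filter.2 ⟨ha, hak⟩) b
      (Finset.mem_filter.2 ⟨hb, hbk⟩)
  have he0 : e (s y) = 0 := by
    have h1 := hgood 1 le_rfl
    have h2 : Finset.Ico (s y) (s y + (1 : ℕ)) = {s y} := by
      ext i; rw [Finset.mem_Ico, Finset.mem_singleton]; omega
    rw [h2, Finset.sum_singleton] at h1
    omega
  -- If all these `j + 2` levels had positive excess, the window of length `2 * j + 3` would be
  -- crowded. A level without excess has at most one site, so a simple path to `y` cannot cross it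
  -- and return; the path is confined to a slab whose number of sites bounds its length.
  obtain ⟨i, hji, hij, hei⟩ : ∃ i : ℕ, j < i ∧ i ≤ 2 * j + 2 ∧ e (s y + i) = 0 := by
    by_contra hcon
    push Not at hcon
    have h1 := hgood (2 * j + 3) (by omega)
    have h2 : ∑ i ∈ Finset.Ico (s y + j + 1) (s y + (2 * j + 3 : ℕ)), 1 ≤
        ∑ i ∈ Finset.Ico (s y) (s y + (2 * j + 3 : ℕ)), e i := by
      calc ∑ i ∈ Finset.Ico (s y + j + 1) (s y + (2 * j + 3 : ℕ)), 1
          ≤ ∑ i ∈ Finset.Ico (s y + j + 1) (s y + (2 * j + 3 : ℕ)), e i := by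
            refine Finset.sum_le_sum fun i hi => ?_
            rw [Finset.mem_Ico] at hi
            have := hcon (i - s y).toNat (by omega) (by omega)
            have h3 : s y + ((i - s y).toNat : ℤ) = i := by omega
            rw [h3] at this
            omega
        _ ≤ _ := by
            refine Finset.sum_le_sum_of_subset fun i hi => ?_
            rw [Finset.mem_Ico] at hi ⊢
            omega
    rw [Finset.sum_const, Int.card_Ico, smul_eq_mul, mul_one] at h2
    omega
  obtain ⟨p, hp⟩ := hconn.exists_isPath
  have hsupp : ∀ u ∈ p.support, u ∈ V := fun u hu => mem_of_mem_support hV p hvV hu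
  have hslab : ∀ u ∈ p.support, s y ≤ s u ∧ s u ≤ s y + i := fun u hu =>
    path_mem_slab hs hp (c := s y + i) (by omega) (by omega)
      (fun w hw hws => huniq _ he0 w (hsupp w hw) y hyV hws rfl)
      (fun w hw w' hw' => huniq _ hei w (hsupp w hw) w' (hsupp w' hw')) hu
  refine ⟨p, ?_⟩
  have hcard : p.length + 1 ≤ ∑ c ∈ Finset.Ico (s y) (s y + (i + 1 : ℕ)), (e c + 1) := by
    calc p.length + 1 = p.support.toFinset.card := by
          rw [List.toFinset_card_of_nodup hp.support_nodup, SimpleGraph.Walk.length_support]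
      _ ≤ ((Finset.Ico (s y) (s y + (i + 1 : ℕ))).biUnion
            fun c => V.filter (fun v => s v = c)).card := by
          refine Finset.card_le_card fun u hu => ?_
          have hu := List.mem_toFinset.1 hu
          have h1 := hslab u hu
          refine Finset.mem_biUnion.2 ⟨s u, Finset.mem_Ico.2 ⟨h1.1, by omega⟩, ?_⟩
          exact Finset.mem_filter.2 ⟨hsupp u hu, rfl⟩
      _ ≤ ∑ c ∈ Finset.Ico (s y) (s y + (i + 1 : ℕ)), (V.filter (fun v => s v = c)).card :=
          Finset.card_biUnion_le
      _ ≤ _ := Finset.sum_le_sum fun c _ => he c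
  rw [Finset.sum_add_distrib, Finset.sum_const, Int.card_Ico, smul_eq_mul, mul_one] at hcard
  have h1 := hgood (i + 1) (by omega)
  omega

end Paths

namespace Subcritical

variable {ν₀ ν₁ : ℝ} {R : ℕ} (h : Subcritical J β q P ν₀ ν₁ R)

include h

/-- The graph of jumps of `ζ`-length at most `K` between sites of `V`. -/
def _root_.FK.jumpGraph (P : Measure (Config J)) (K : ℝ) (V : Set (Fin d → ℤ)) :
    SimpleGraph (Fin d → ℤ) :=
  SimpleGraph.fromRel fun a b => a ∈ V ∧ b ∈ V ∧ zeta P (b - a) ≤ K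

lemma jumpGraph_adj {K : ℝ} {V : Set (Fin d → ℤ)} {a b : Fin d → ℤ} :
    (jumpGraph P K V).Adj a b ↔ a ≠ b ∧ a ∈ V ∧ b ∈ V ∧ zeta P (b - a) ≤ K := by
  rw [jumpGraph, SimpleGraph.fromRel_adj, h.zeta_sub_comm a b]
  tauto

lemma zeta_le_length {K : ℝ} {V : Set (Fin d → ℤ)} {a b : Fin d → ℤ}
    (p : (jumpGraph P K V).Walk a b) : zeta P (a - b) ≤ p.length * K := by
  induction p with
  | nil => simp [h.zeta_zero]
  | @cons u v w huv p ih =>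
    have h1 := h.zeta_sub_le u v w
    have h2 := (h.jumpGraph_adj.1 huv).2.2.2
    rw [h.zeta_sub_comm] at h2
    rw [SimpleGraph.Walk.length_cons]
    push_cast
    linarith

lemma jumpGraph_reachable {K : ℝ} {V : Set (Fin d → ℤ)} (hconn : JumpConnected P K V)
    {v : Fin d → ℤ} (hv : v ∈ V) : (jumpGraph P K V).Reachable 0 v := by
  have h1 := hconn v hv
  induction h1 with
  | refl => exact SimpleGraph.Reachable.refl _
  | @tail b c hab hbc ih =>
    by_cases hbc' : b = c
    · rw [← hbc']; exact ih hbc.1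
    · exact (ih hbc.1).trans (h.jumpGraph_adj.2 ⟨hbc', hbc⟩).reachable

/-- Most sites of a skeleton that is hardly longer than necessary are vertices of a double cone
that contains everything that is not too close to them. -/
lemma exists_coarse_conePoints {K : ℝ} (hK : 0 < K) {g : (Fin d → ℤ) → ℝ}
    (hgsub : ∀ a b, g (a - b) = g a - g b) (hg : ∀ a, g a ≤ zeta P a)
    {V : Finset (Fin d → ℤ)} (h0 : 0 ∈ V) (hconn : JumpConnected P K (V : Set (Fin d → ℤ)))
    {M E : ℕ} (hM : ∃ v ∈ V, (M : ℝ) * K ≤ g v) (hE : V.card ≤ M + 1 + E)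
    {C : Set (Fin d → ℤ)} (hC : ∀ z ∈ C, ∃ v ∈ V, zeta P (z - v) ≤ 2 * K) :
    ∃ Y ⊆ V, M + 1 ≤ Y.card + 20 * E ∧
      (∀ y ∈ Y, 0 ≤ g y ∧ g y ≤ (M + 1) * K) ∧ ∀ y ∈ Y, ∀ z ∈ C, 62 * K < zeta P (z - y) → zeta P (z - y) ≤ 4 * |g (z - y)| := by
  classical
  -- Levels of height in units of the jump length. Since `|g| ≤ ζ`, a jump changes the level by at
  -- most one, so all levels from `0` to `M` are occupied.
  set s : (Fin d → ℤ) → ℤ := fun v => ⌊g v / K⌋ with hs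
  set G := jumpGraph P K (V : Set (Fin d → ℤ)) with hG
  have hgabs : ∀ a, |g a| ≤ zeta P a := by
    intro a
    have h1 : g (-a) = -g a := by
      have h2 := hgsub 0 a
      have h3 := hgsub 0 0
      rw [sub_zero] at h3
      rw [zero_sub] at h2
      linarith
    have h2 := hg (-a)
    rw [h1, h.zeta_neg] at h2
    exact abs_le.2 ⟨by linarith, hg a⟩
  have hlip : ∀ a b, G.Adj a b → |s b - s a| ≤ 1 := by
    intro a b hab
    have h1 := (hgabs (b - a)).trans (h.jumpGraph_adj.1 hab).2.2.2
    rw [hgsub, abs_le] at h1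
    have e1 := Int.floor_le (g a / K)
    have e2 := Int.lt_floor_add_one (g a / K)
    have e3 := Int.floor_le (g b / K)
    have e4 := Int.lt_floor_add_one (g b / K)
    have e5 : g b / K - g a / K ≤ 1 := by
      rw [← sub_div, div_le_one hK]; exact h1.2
    have e6 : -1 ≤ g b / K - g a / K := by
      rw [← sub_div, le_div_iff₀ hK]; linarith
    have e7 : (s b : ℝ) - s a < 2 := by simp only [hs]; linarith
    have e8 : (-2 : ℝ) < s b - s a := by simp only [hs]; linarith
    have e9 : s b - s a < 2 := by exact_mod_cast e7
    have e10 : -2 < s b - s a := by exact_mod_cast e8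
    rw [abs_le]; omega
  have hVadj : ∀ a b, G.Adj a b → a ∈ V ∧ b ∈ V := fun a b hab =>
    ⟨(h.jumpGraph_adj.1 hab).2.1, (h.jumpGraph_adj.1 hab).2.2.1⟩
  have hreach : ∀ v ∈ V, ∀ w ∈ V, G.Reachable v w := fun v hv w hw =>
    (h.jumpGraph_reachable hconn hv).symm.trans (h.jumpGraph_reachable hconn hw)
  set N : ℤ → ℕ := fun k => (V.filter (fun v => s v = k)).card with hN
  -- The number of superfluous sites on a level: one site is indispensable between `0` and `M`, none
  -- elsewhere. The total is at most `E`.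
  set e : ℤ → ℕ := fun k => if k ∈ Finset.Icc 0 (M : ℤ) then N k - 1 else N k with he
  set T : Finset ℤ := V.image s with hT
  have hNT : ∀ k, k ∉ T → N k = 0 := by
    intro k hk
    rw [hN, Finset.card_eq_zero, Finset.filter_eq_empty_iff]
    rintro v hv rfl
    exact hk (Finset.mem_image_of_mem s hv)
  have heT : ∀ k, k ∉ T → e k = 0 := by
    intro k hk
    simp only [he, hNT k hk]
    split_ifs <;> rfl
  have heN : ∀ k, N k ≤ e k + 1 := by
    intro k
    simp only [he]
    split_ifs <;> omega
  have hs0 : s 0 = 0 := by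
    have h3 := hgsub 0 0
    rw [sub_zero, sub_self] at h3
    simp [hs, h3]
  obtain ⟨v₁, hv₁V, hv₁⟩ := hM
  have hs1 : (M : ℤ) ≤ s v₁ := by
    rw [hs, Int.le_floor, Int.cast_natCast, le_div_iff₀ hK]
    exact hv₁
  have hlevel : ∀ k ∈ Finset.Icc 0 (M : ℤ), ∃ v ∈ V, s v = k := by
    intro k hk
    rw [Finset.mem_Icc] at hk
    obtain ⟨p⟩ := hreach 0 h0 v₁ hv₁V
    obtain ⟨w, hw, hwk⟩ := exists_mem_support_eq hlip p (c := k)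
      (Or.inl ⟨by omega, by omega⟩)
    exact ⟨w, mem_of_mem_support hVadj p h0 hw, hwk⟩
  have hN1 : ∀ k ∈ Finset.Icc 0 (M : ℤ), 1 ≤ N k := by
    intro k hk
    obtain ⟨v, hv, hvk⟩ := hlevel k hk
    exact Finset.card_pos.2 ⟨v, Finset.mem_filter.2 ⟨hv, hvk⟩⟩
  have hIT : Finset.Icc 0 (M : ℤ) ⊆ T := by
    intro k hk
    obtain ⟨v, hv, hvk⟩ := hlevel k hk
    exact Finset.mem_image.2 ⟨v, hv, hvk⟩
  have hsumE : ∑ k ∈ T, e k ≤ E := by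
    have h1 : V.card = ∑ k ∈ T, N k :=
      Finset.card_eq_sum_card_fiberwise fun v hv => Finset.mem_image_of_mem s hv
    have h2 : ∑ k ∈ T, N k = ∑ k ∈ T, e k + ∑ k ∈ Finset.Icc 0 (M : ℤ), 1 := by
      rw [← Finset.sum_sdiff hIT, ← Finset.sum_sdiff (f := e) hIT, add_assoc,
        ← Finset.sum_add_distrib]
      congr 1
      · refine Finset.sum_congr rfl fun k hk => ?_
        simp only [he, if_neg (Finset.mem_sdiff.1 hk).2]
      · refine Finset.sum_congr rfl fun k hk => ?_
        have := hN1 k hk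
        simp only [he, if_pos hk]
        omega
    rw [Finset.sum_const, Int.card_Icc, smul_eq_mul, mul_one] at h2
    omega
  -- Reflection turns crowding of windows ending at a level into crowding of windows starting there.
  -- At most `10 * E` levels are bad on each side.
  set e' : ℤ → ℕ := fun k => e (-k) with he'
  have hbad1 : ((Finset.Icc 0 (M : ℤ)).filter (Crowded 10 e)).card ≤ 10 * E := by
    have h1 := card_crowded_le 10 e heT (M + 1) 0
    have h2 : Finset.Ico (0 : ℤ) (0 + (M + 1 : ℕ)) = Finset.Icc 0 (M : ℤ) := by
      ext i; rw [Finset.mem_Ico, Finset.mem_Icc]; omega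
    rw [h2] at h1
    exact h1.trans (Nat.mul_le_mul_left _
      ((Finset.sum_le_sum_of_subset (Finset.filter_subset _ _)).trans hsumE))
  have hbad2 : ((Finset.Icc 0 (M : ℤ)).filter (fun k => Crowded 10 e' (-k))).card ≤ 10 * E := by
    have h1 := card_crowded_le 10 e' (T := T.image Neg.neg) (by
      intro k hk
      refine heT _ fun hk' => hk (Finset.mem_image.2 ⟨-k, hk', neg_neg k⟩)) (M + 1) (-M)
    have h2 : ((Finset.Icc 0 (M : ℤ)).filter (fun k => Crowded 10 e' (-k))).card ≤
        ((Finset.Ico (-M : ℤ) (-M + (M + 1 : ℕ))).filter (Crowded 10 e')).card := by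
      refine Finset.card_le_card_of_injOn Neg.neg ?_ neg_injective.injOn
      intro k hk
      simp only [Finset.coe_filter, Finset.mem_Icc, Finset.mem_Ico, Set.mem_ofPred_eq] at hk ⊢
      exact ⟨⟨by omega, by push_cast; omega⟩, hk.2⟩
    refine h2.trans (h1.trans (Nat.mul_le_mul_left _ (le_trans ?_ hsumE)))
    refine (Finset.sum_le_sum_of_subset (Finset.filter_subset _ _)).trans ?_
    rw [Finset.sum_image neg_injective.injOn]
    simp [he']
  set good := (Finset.Icc 0 (M : ℤ)).filter
    (fun k => ¬ Crowded 10 e k ∧ ¬ Crowded 10 e' (-k)) with hgood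
  have hgoodcard : M + 1 ≤ good.card + 20 * E := by
    have h1 : Finset.Icc 0 (M : ℤ) ⊆ good ∪ ((Finset.Icc 0 (M : ℤ)).filter (Crowded 10 e) ∪
        (Finset.Icc 0 (M : ℤ)).filter (fun k => Crowded 10 e' (-k))) := by
      intro k hk
      simp only [hgood, Finset.mem_union, Finset.mem_filter]
      tauto
    have h2 := Finset.card_le_card h1
    have h3 := Finset.card_union_le good ((Finset.Icc 0 (M : ℤ)).filter (Crowded 10 e) ∪
        (Finset.Icc 0 (M : ℤ)).filter (fun k => Crowded 10 e' (-k)))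
    have h4 := Finset.card_union_le ((Finset.Icc 0 (M : ℤ)).filter (Crowded 10 e))
        ((Finset.Icc 0 (M : ℤ)).filter (fun k => Crowded 10 e' (-k)))
    rw [Int.card_Icc] at h2
    omega
  have hpick : ∀ k, ∃ v, k ∈ good → v ∈ V ∧ s v = k := by
    intro k
    by_cases hk : k ∈ good
    · obtain ⟨v, hv⟩ := hlevel k (Finset.mem_filter.1 hk).1
      exact ⟨v, fun _ => hv⟩
    · exact ⟨0, fun h => absurd h hk⟩
  choose y hy using hpick
  refine ⟨good.image y, ?_, ?_, ?_, ?_⟩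
  rotate_left 2
  · intro v hv
    obtain ⟨k, hk, rfl⟩ := Finset.mem_image.1 hv
    obtain ⟨hyV, hys⟩ := hy k hk
    have hk1 := Finset.mem_Icc.1 (Finset.mem_filter.1 hk).1
    have h1 := Int.floor_le (g (y k) / K)
    have h2 := Int.lt_floor_add_one (g (y k) / K)
    change s (y k) ≤ g (y k) / K at h1
    change g (y k) / K < s (y k) + 1 at h2
    rw [hys] at h1 h2
    rw [le_div_iff₀ hK] at h1
    rw [div_lt_iff₀ hK] at h2
    have h3 : (0 : ℝ) ≤ k := by exact_mod_cast hk1.1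
    have h4 : (k : ℝ) ≤ M := by exact_mod_cast hk1.2
    exact ⟨(mul_nonneg h3 hK.le).trans h1, h2.le.trans (by gcongr)⟩
  rotate_right 2
  · intro v hv
    obtain ⟨k, hk, rfl⟩ := Finset.mem_image.1 hv
    exact (hy k hk).1
  · rwa [Finset.card_image_of_injOn]
    intro k hk k' hk' hkk'
    have h1 := (hy k hk).2
    rw [hkk', (hy k' hk').2] at h1
    exact h1.symm
  · intro v hv z hz hzv
    obtain ⟨k, hk, rfl⟩ := Finset.mem_image.1 hv
    obtain ⟨hyV, hys⟩ := hy k hk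
    obtain ⟨-, hk1, hk2⟩ := Finset.mem_filter.1 hk
    obtain ⟨w, hwV, hwz⟩ := hC z hz
    -- With `j` the difference of levels, short walks bound `ζ` from above and the levels bound the
    -- height from below. Moving from `w` to `z` costs `2 * K` on both sides, and `62 * K` forces `j
    -- ≥ 20`, where `3 * j + 5 ≤ 4 * (j - 3)`.
    have key : ∃ j : ℕ, zeta P (w - y k) ≤ (3 * j + 3) * K ∧ (j - 1) * K ≤ |g (w - y k)| := by
      have f1 := Int.floor_le (g w / K)
      have f2 := Int.lt_floor_add_one (g w / K)
      have f3 := Int.floor_le (g (y k) / K)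
      have f4 := Int.lt_floor_add_one (g (y k) / K)
      rcases le_total (s (y k)) (s w) with hle | hle
      · obtain ⟨j, hj⟩ := Int.eq_ofNat_of_zero_le (sub_nonneg.2 hle)
        obtain ⟨p, hp⟩ := exists_short_walk hlip hVadj heN hyV hwV (hreach w hwV _ hyV)
          (by rwa [hys]) (j := j) (by omega)
        refine ⟨j, (h.zeta_le_length p).trans ?_, ?_⟩
        · have : (p.length : ℝ) ≤ 3 * j + 3 := by exact_mod_cast hp
          gcongr
        · refine le_trans ?_ (le_abs_self _)
          rw [hgsub]
          have h1 : (s w : ℝ) - s (y k) = j := by exact_mod_cast hj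
          have h2 : (j : ℝ) - 1 ≤ g w / K - g (y k) / K := by simp only [hs] at h1; linarith
          rw [← sub_div, le_div_iff₀ hK] at h2
          exact h2
      · obtain ⟨j, hj⟩ := Int.eq_ofNat_of_zero_le (sub_nonneg.2 hle)
        obtain ⟨p, hp⟩ := exists_short_walk (s := fun v => -s v) (e := e')
          (fun a b hab => by
            have := hlip a b hab
            rw [neg_sub_neg, abs_sub_comm]; exact this) hVadj
          (fun k => by
            have := heN (-k)
            simp only [he']
            refine le_trans (le_of_eq ?_) this
            simp only [hN]
            congr 1
            ext v
            simp only [Finset.mem_filter]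
            exact and_congr_right fun _ => by omega) hyV hwV (hreach w hwV _ hyV)
          (by simp only [hys]; exact hk2) (j := j) (by omega)
        refine ⟨j, (h.zeta_le_length p).trans ?_, ?_⟩
        · have : (p.length : ℝ) ≤ 3 * j + 3 := by exact_mod_cast hp
          gcongr
        · refine le_trans ?_ (neg_le_abs _)
          rw [hgsub]
          have h1 : (s (y k) : ℝ) - s w = j := by exact_mod_cast hj
          have h2 : (j : ℝ) - 1 ≤ g (y k) / K - g w / K := by simp only [hs] at h1; linarith
          rw [← sub_div, le_div_iff₀ hK] at h2
          linarith
    obtain ⟨j, hj1, hj2⟩ := key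
    have h1 := h.zeta_sub_le z w (y k)
    have h2 : |g (w - y k)| ≤ |g (z - y k)| + zeta P (z - w) := by
      have h3 : g (w - y k) = g (z - y k) - g (z - w) := by
        rw [hgsub, hgsub, hgsub]; ring
      rw [h3]
      exact (abs_sub _ _).trans (add_le_add_right (hgabs _) _)
    have h3 : zeta P (z - y k) ≤ (3 * j + 5) * K := by linarith
    have h4 : (j - 3) * K ≤ |g (z - y k)| := by linarith
    have h5 : (19 : ℝ) < j := by
      have : 62 * K < (3 * j + 5) * K := hzv.trans_le h3
      have := lt_of_mul_lt_mul_right this hK.le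
      linarith
    have h6 : (20 : ℝ) ≤ j := by
      have : 19 < j := by exact_mod_cast h5
      exact_mod_cast this
    nlinarith

end Subcritical

end

/-! ### Choice of scales and the coarse bound -/

section
variable {d : ℕ} {J : Coupling d} {β q : ℝ} {P : Measure (Config J)}

namespace Subcritical

variable {ν₀ ν₁ : ℝ} {R : ℕ} (h : Subcritical J β q P ν₀ ν₁ R)

include h

lemma zeta_le_of_adj {C : ℝ} (hC0 : 0 ≤ C) (hC : ∀ x : Fin d → ℤ, zeta P x ≤ C * ‖x‖)
    {x y : Fin d → ℤ} (hxy : (bondGraph J).Adj x y) : zeta P (y - x) ≤ C * R := by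
  refine (hC _).trans (mul_le_mul_of_nonneg_left ?_ hC0)
  rw [pi_norm_le_iff_of_nonneg (Nat.cast_nonneg R)]
  intro i
  rw [Pi.sub_apply, Int.norm_eq_abs]
  exact_mod_cast h.range x y hxy i

/-- Scales for which the skeleton estimate beats the number of skeletons. -/
lemma exists_scales : ∃ (K K₁ K₂ K₃ C : ℝ) (ρ : ℕ), 0 < K ∧ 0 ≤ K₁ ∧ 0 ≤ K₂ ∧ K₂ ≤ K + K₃ ∧
    K ≤ K₃ ∧ K₃ ≤ (1001 / 1000) * K ∧ 0 ≤ C ∧ (∀ x : Fin d → ℤ, zeta P x ≤ C * ‖x‖) ∧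
    (∀ x y, (bondGraph J).Adj x y → K + zeta P (y - x) ≤ K₁) ∧
    (∀ x y, (bondGraph J).Adj x y → K₂ + zeta P (y - x) ≤ K₃) ∧
    K₁ + C * (2 * ρ + R) ≤ K₂ ∧
    (2 / ν₁ * K₁ + 3) ^ d * ν₀ *
      ((4 * (ρ : ℝ) + (2 * R + 1)) ^ d * Real.exp (-ν₁ * ρ)) ≤ 1 / 2 ∧
    (((zball P ν₁ K₃ 0).card : ℝ) + 2) ^ 2 * (2 * ((2 / ν₁ * K₁ + 3) ^ d * Real.exp (-K))) ≤
      Real.exp (-(999 / 1000 * K)) := by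
  obtain ⟨C, hC0, -, hC⟩ := h.exists_zeta_le
  have hν := h.hν₁
  set b : ℝ := C * R with hb
  have hb0 : 0 ≤ b := by positivity
  -- The scale is `K = A * ρ`, proportional to the decoupling width. The large factor makes the
  -- corrections `2 * C * ρ + 3 * b` at most `K / 1000` once `b ≤ ρ`, while all ball volumes remain
  -- polynomial in `ρ` and lose to `exp (-ν₁ * ρ)` and to `exp (K / 1000)`.
  set A : ℝ := 4000 * (C + 1) with hA
  have hA0 : 0 < A := by positivity
  have t1 := tendsto_linear_pow_mul_exp (2 / ν₁ * A) (2 / ν₁ * b + 3) (half_pos hν) d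
  have t2 := tendsto_linear_pow_mul_exp 4 (2 * R + 1 : ℝ) (half_pos hν) d
  have t3 := tendsto_linear_pow_mul_exp (4 / ν₁ * A) 3 (show 0 < A / 3000 by positivity) d
  have t12 := (t1.mul t2).const_mul ν₀
  rw [mul_zero, mul_zero] at t12
  have e1 := (t12.comp tendsto_natCast_atTop_atTop).eventually_le_const
    (show (0 : ℝ) < 1 / 2 by norm_num)
  have e3 := (t3.comp tendsto_natCast_atTop_atTop).eventually_le_const
    (show (0 : ℝ) < 1 / 18 by norm_num)
  obtain ⟨ρ, h1, h3, hρ⟩ := (e1.and (e3.and (eventually_gt_atTop ⌈b⌉₊))).exists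
  simp only [Function.comp_apply] at h1 h3
  have hρb : b ≤ ρ := (Nat.le_ceil b).trans (by exact_mod_cast hρ.le)
  have hρ0 : (0 : ℝ) < ρ := by exact_mod_cast (Nat.zero_le _).trans_lt hρ
  have hadj : ∀ x y, (bondGraph J).Adj x y → zeta P (y - x) ≤ b := fun x y hxy =>
    h.zeta_le_of_adj hC0 hC hxy
  have hKpos : 0 < A * ρ := by positivity
  have hK3 : A * ρ + 2 * C * ρ + 3 * b ≤ 1001 / 1000 * (A * ρ) := by
    rw [hA]; nlinarith
  have hCρ : 0 ≤ C * ρ := by positivity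
  refine ⟨A * ρ, A * ρ + b, A * ρ + b + C * (2 * ρ + R), A * ρ + 2 * C * ρ + 3 * b, C, ρ, hKpos,
    by positivity, by positivity, ?_, ?_, hK3, hC0, hC, ?_, ?_, le_rfl, ?_, ?_⟩
  · linarith [hb]
  · linarith
  · intro x y hxy
    linarith [hadj x y hxy]
  · intro x y hxy
    linarith [hadj x y hxy, hb]
  · refine le_trans (le_of_eq ?_) h1
    have : Real.exp (-ν₁ * ρ) = Real.exp (-(ν₁ / 2) * ρ) * Real.exp (-(ν₁ / 2) * ρ) := by
      rw [← Real.exp_add]; ring_nf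
    rw [this]
    ring
  · set K₃ := A * ρ + 2 * C * ρ + 3 * b with hK₃
    set u : ℝ := (4 / ν₁ * A * ρ + 3) ^ d with hu
    have hu1 : 1 ≤ u := one_le_pow₀ (by
      have : 0 ≤ 4 / ν₁ * A * ρ := by positivity
      linarith)
    have hK32 : 2 / ν₁ * K₃ ≤ 4 / ν₁ * A * ρ := by
      have : 2 / ν₁ * K₃ ≤ 2 / ν₁ * (2 * (A * ρ)) := by gcongr; linarith
      calc _ ≤ _ := this
        _ = _ := by ring
    have hcard : ((zball P ν₁ K₃ 0).card : ℝ) ≤ u :=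
      (card_zball_le P hν (by positivity) 0).trans
        (pow_le_pow_left₀ (by positivity) (by linarith) d)
    have hK1 : (2 / ν₁ * (A * ρ + b) + 3) ^ d ≤ u := by
      refine pow_le_pow_left₀ (by positivity) ?_ d
      have : 2 / ν₁ * (A * ρ + b) ≤ 2 / ν₁ * K₃ := by gcongr; linarith
      linarith
    have h4 : u ≤ 1 / 18 * Real.exp (A / 3000 * ρ) := by
      rw [neg_mul, Real.exp_neg, ← div_eq_mul_inv, div_le_iff₀ (Real.exp_pos _)] at h3
      exact h3
    have h5 : 18 * u ^ 3 ≤ Real.exp (1 / 1000 * (A * ρ)) := by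
      have h6 : u ^ 3 ≤ (1 / 18 * Real.exp (A / 3000 * ρ)) ^ 3 := by gcongr
      have h7 : Real.exp (A / 3000 * ρ) ^ 3 = Real.exp (1 / 1000 * (A * ρ)) := by
        rw [← Real.exp_nat_mul]; congr 1; push_cast; ring
      rw [mul_pow, h7] at h6
      have := Real.exp_pos (1 / 1000 * (A * ρ))
      linarith
    calc (((zball P ν₁ K₃ 0).card : ℝ) + 2) ^ 2 *
          (2 * ((2 / ν₁ * (A * ρ + b) + 3) ^ d * Real.exp (-(A * ρ))))
        ≤ (3 * u) ^ 2 * (2 * (u * Real.exp (-(A * ρ)))) := by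
          gcongr
          linarith
      _ = 18 * u ^ 3 * Real.exp (-(A * ρ)) := by ring
      _ ≤ Real.exp (1 / 1000 * (A * ρ)) * Real.exp (-(A * ρ)) := by gcongr
      _ = _ := by rw [← Real.exp_add]; congr 1; ring

/-- Clusters with few coarse cone points are exponentially unlikely. -/
lemma exists_coarse_bound : ∃ K c H₀ : ℝ, 0 < K ∧ 0 < c ∧
    ∀ (x : Fin d → ℤ) (g : (Fin d → ℤ) → ℝ), (∀ a b, g (a - b) = g a - g b) →
      (∀ a, g a ≤ zeta P a) → g x = zeta P x → H₀ ≤ zeta P x →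
      P.real {ω | x ∈ cluster ω 0 ∧ ¬ ∃ Y : Finset (Fin d → ℤ), ↑Y ⊆ cluster ω 0 ∧
        zeta P x ≤ 2 * K * Y.card ∧ (∀ y ∈ Y, 0 ≤ g y ∧ g y ≤ zeta P x) ∧ ∀ y ∈ Y, ∀ z ∈ cluster ω 0,
          62 * K < zeta P (z - y) → zeta P (z - y) ≤ 4 * |g (z - y)|} ≤
        Real.exp (-c * zeta P x) * P.real (connected J 0 x) := by
  classical
  have := h.isProb
  obtain ⟨K, K₁, K₂, K₃, C, ρ, hK, hK₁, hK₂, hK₂₃, hKK₃, hK₃, hC0, hC, hstep, hstep', hK₁₂, hρ,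
    hcount⟩ := h.exists_scales
  obtain ⟨C', hC'0, hC'⟩ := h.exists_nlog_le_zeta_add (ε := ν₁ / 1000) (by have := h.hν₁; positivity)
  have hK₃0 : 0 < K₃ := hK.trans_le hKK₃
  refine ⟨K₃, 1 / 500, max (300 * K₃) (1000 * C'), hK₃0, by norm_num, ?_⟩
  intro x g hgsub hg hgx hH
  set H := zeta P x with hHdef
  have hH1 : 300 * K₃ ≤ H := (le_max_left _ _).trans hH
  have hH2 : 1000 * C' ≤ H := (le_max_right _ _).trans hH
  -- One percent more records than the height of `x` requires. The resulting factor `exp (-999 /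
  -- 1000 * K * m)` still beats the lower bound on `P (0 ↔ x)` by `exp (-H / 500)`, because every
  -- other loss is of order `H / 1000`.
  set m : ℕ := ⌈101 / 100 * H / K₃⌉₊ with hm
  have hHK : 300 ≤ H / K₃ := by rwa [le_div_iff₀ hK₃0]
  have hm1 : 101 / 100 * (H / K₃) ≤ m := by
    rw [← mul_div_assoc]; exact Nat.le_ceil _
  have hm2 : (m : ℝ) < 101 / 100 * (H / K₃) + 1 := by
    rw [← mul_div_assoc]
    exact Nat.ceil_lt_add_one (div_nonneg (by linarith) hK₃0.le)
  have hm3 : 1 ≤ m := by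
    have : (1 : ℝ) ≤ m := by linarith
    exact_mod_cast this
  set Δ := zball P ν₁ K₃ 0 with hΔ
  set 𝒮 := (explorationStates Δ (2 * m)).filter fun s => s.1.length = m with h𝒮
  have hsub : {ω | x ∈ cluster ω 0 ∧ ¬ ∃ Y : Finset (Fin d → ℤ), ↑Y ⊆ cluster ω 0 ∧
        H ≤ 2 * K₃ * Y.card ∧ (∀ y ∈ Y, 0 ≤ g y ∧ g y ≤ H) ∧ ∀ y ∈ Y, ∀ z ∈ cluster ω 0,
          62 * K₃ < zeta P (z - y) → zeta P (z - y) ≤ 4 * |g (z - y)|} ⊆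
      ⋃ s ∈ 𝒮, skeletonEvent P ν₁ K K₁ K₂ s.1 := by
    rintro ω ⟨hx, hY⟩
    rcases h.exists_skeleton hK.le hK₂ hK₂₃ hstep hstep' hx (by linarith) hm3 with
      ⟨s, hs, hsl, hsω⟩ | ⟨L, hL, h0L, hLC, hconn, hcov⟩
    · exact Set.mem_iUnion₂.2 ⟨s, Finset.mem_filter.2 ⟨hs, hsl⟩, hsω⟩
    · refine absurd ?_ hY
      set V := L.toFinset with hV
      have hVset : (V : Set (Fin d → ℤ)) = {v | v ∈ L} := by ext; simp [hV]
      -- The recorded site near `x` is within `2 * K₃` of it, hence of height at least `M * K₃`. The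
      -- excess `m - (M + 1)` is about one percent of `H / K₃`; twenty times as many bad levels
      -- still leave more than half of them when `H / K₃ ≥ 300`.
      set M : ℕ := ⌊H / K₃ - 2⌋₊ with hM
      have hM1 : (M : ℝ) ≤ H / K₃ - 2 := Nat.floor_le (by linarith)
      have hM2 : H / K₃ - 2 < M + 1 := Nat.lt_floor_add_one _
      have hMm : M + 1 ≤ m := by
        have : ((M + 1 : ℕ) : ℝ) ≤ m := by push_cast; linarith
        exact_mod_cast this
      have hcov' : ∀ z ∈ cluster ω 0, ∃ v ∈ V, zeta P (z - v) ≤ 2 * K₃ := fun z hz => by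
        obtain ⟨v, hv, hzv⟩ := hcov z hz
        exact ⟨v, List.mem_toFinset.2 hv, by linarith⟩
      obtain ⟨Y, hYV, hYcard, hYg, hYc⟩ := h.exists_coarse_conePoints hK₃0 hgsub hg
        (V := V) (M := M) (E := m - (M + 1)) (C := cluster ω 0)
        (List.mem_toFinset.2 h0L) (by rw [hVset]; exact hconn) (by
          obtain ⟨v, hv, hxv⟩ := hcov' x hx
          refine ⟨v, hv, ?_⟩
          have h1 := hg (x - v)
          rw [hgsub, hgx] at h1
          have h2 : (M : ℝ) * K₃ ≤ (H / K₃ - 2) * K₃ := by gcongr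
          rw [sub_mul, div_mul_cancel₀ _ hK₃0.ne'] at h2
          linarith) (by
          have : V.card ≤ L.length := List.toFinset_card_le L
          omega) hcov'
      refine ⟨Y, fun y hy => hLC y (List.mem_toFinset.1 (hYV hy)), ?_,
        fun y hy => ⟨(hYg y hy).1, (hYg y hy).2.trans ?_⟩, hYc⟩
      swap
      · have h2 : ((M : ℝ) + 1) * K₃ ≤ H / K₃ * K₃ := by gcongr; linarith
        rwa [div_mul_cancel₀ _ hK₃0.ne'] at h2
      have h1 : ((M + 1 : ℕ) : ℝ) ≤ Y.card + 20 * (m - (M + 1 : ℕ)) := by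
        rw [← Nat.cast_sub hMm]
        exact_mod_cast hYcard
      push_cast at h1
      have h2 : H / K₃ ≤ 2 * Y.card := by linarith
      rw [div_le_iff₀ hK₃0] at h2
      linarith
  have hcount' : P.real (⋃ s ∈ 𝒮, skeletonEvent P ν₁ K K₁ K₂ s.1) ≤
      Real.exp (-(999 / 1000 * K)) ^ m := by
    calc P.real (⋃ s ∈ 𝒮, skeletonEvent P ν₁ K K₁ K₂ s.1)
        ≤ ∑ s ∈ 𝒮, P.real (skeletonEvent P ν₁ K K₁ K₂ s.1) :=
          measureReal_biUnion_finset_le _ _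
      _ ≤ ∑ s ∈ 𝒮, (2 * ((2 / ν₁ * K₁ + 3) ^ d * Real.exp (-K))) ^ m := by
          refine Finset.sum_le_sum fun s hs => ?_
          have := h.real_skeletonEvent_le hK.le hK₁ hC hC0 hK₁₂ hρ s.1
          rwa [(Finset.mem_filter.1 hs).2] at this
      _ ≤ ((Δ.card : ℝ) + 2) ^ (2 * m) * (2 * ((2 / ν₁ * K₁ + 3) ^ d * Real.exp (-K))) ^ m := by
          rw [Finset.sum_const, nsmul_eq_mul]
          have hν := h.hν₁
          gcongr
          have h1 := (Finset.card_filter_le (explorationStates Δ (2 * m))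
            fun s => s.1.length = m).trans (card_explorationStates_le Δ (2 * m))
          exact_mod_cast h1
      _ = (((Δ.card : ℝ) + 2) ^ 2 * (2 * ((2 / ν₁ * K₁ + 3) ^ d * Real.exp (-K)))) ^ m := by
          rw [pow_mul, ← mul_pow]
      _ ≤ _ := by
          have hν := h.hν₁
          gcongr
  refine ((measureReal_mono hsub (measure_ne_top P _)).trans hcount').trans ?_
  rw [← h.exp_neg_nlog, ← Real.exp_nat_mul, ← Real.exp_add, Real.exp_le_exp]
  have h1 := hC' x
  have h2 := h.nu_mul_norm_le_zeta x
  have h3 : 101 / 100 * (1000 / 1001 * H) ≤ m * K := by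
    have h4 : 101 / 100 * (H / K₃) * K ≤ m * K := by gcongr
    have h5 : 1000 / 1001 * H ≤ H / K₃ * K := by
      rw [show H / K₃ * K = H * K / K₃ by ring, le_div_iff₀ hK₃0]
      have h6 : H * K₃ ≤ H * (1001 / 1000 * K) :=
        mul_le_mul_of_nonneg_left hK₃ (by linarith)
      linarith
    linarith
  rw [← hHdef] at h1 h2
  linarith

end Subcritical

end

/-! ### Lattice paths whose height stays away from that of the apex -/

section
variable {d : ℕ} {J : Coupling d} {β q : ℝ} {P : Measure (Config J)}

/-- The linear functional `(t, ·)` on `ℤ^d`. -/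
def height (t : EuclideanSpace ℝ (Fin d)) (z : Fin d → ℤ) : ℝ := inner ℝ t (emb z)

lemma height_eq_sum (t : EuclideanSpace ℝ (Fin d)) (z : Fin d → ℤ) :
    height t z = ∑ i, t i * z i := by
  simp [height, emb, PiLp.inner_apply, mul_comm]

lemma height_sub (t : EuclideanSpace ℝ (Fin d)) (a b : Fin d → ℤ) :
    height t (a - b) = height t a - height t b := by
  simp only [height_eq_sum, ← Finset.sum_sub_distrib, Pi.sub_apply]
  exact Finset.sum_congr rfl fun i _ => by push_cast; ring

lemma height_neg_left (t : EuclideanSpace ℝ (Fin d)) (z : Fin d → ℤ) :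
    height (-t) z = -height t z := by
  simp [height]

/-- Steps of the graph of bonds that stay in `W`. -/
def stepIn (J : Coupling d) (W : Set (Fin d → ℤ)) (a b : Fin d → ℤ) : Prop :=
  (bondGraph J).Adj a b ∧ a ∈ W ∧ b ∈ W

/-- One step of a descent to the origin that keeps the height bounded below. -/
lemma exists_descent_step {t : Fin d → ℝ} {c : ℝ} {b : Fin d → ℤ} (hc : c ≤ ∑ i, t i * b i)
    (hi : ∃ i, b i ≠ 0 ∧ c ≤ t i * (b i).sign) (hc0 : 0 ≤ c) :
    ∃ (j : Fin d) (b' : Fin d → ℤ), b j ≠ 0 ∧ b' = b + Pi.single j (-(b j).sign) ∧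
      (b' = 0 ∨ (c ≤ ∑ i, t i * b' i ∧ ∃ i, b' i ≠ 0 ∧ c ≤ t i * (b' i).sign)) := by
  classical
  obtain ⟨i, hbi, hci⟩ := hi
  -- Shrink the coordinate that contributes least to the height. If its rate is nonpositive, the
  -- height does not decrease; if it is positive, all contributions are, and one remaining
  -- coordinate of rate at least `c` suffices.
  obtain ⟨j, hj, hmin⟩ := Finset.exists_min_image (Finset.univ.filter fun k => b k ≠ 0)
    (fun k => t k * ((b k).sign : ℝ)) ⟨i, by simpa using hbi⟩
  have hbj : b j ≠ 0 := by simpa using hj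
  set b' : Fin d → ℤ := b + Pi.single j (-(b j).sign) with hb'
  refine ⟨j, b', hbj, rfl, ?_⟩
  by_cases h0 : b' = 0
  · exact Or.inl h0
  right
  have hne : ∀ k, k ≠ j → b' k = b k := fun k hk => by simp [hb', hk]
  have hbj' : b' j = b j - (b j).sign := by simp [hb', sub_eq_add_neg]
  have hsign : ∀ k, b' k ≠ 0 → (b' k).sign = (b k).sign ∧ b k ≠ 0 := by
    intro k hk
    by_cases hkj : k = j
    · subst hkj
      rw [hbj'] at hk ⊢
      rcases lt_or_gt_of_ne hbj with h1 | h1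
      · rw [Int.sign_eq_neg_one_of_neg h1] at hk ⊢
        exact ⟨Int.sign_eq_neg_one_of_neg (by omega), hbj⟩
      · rw [Int.sign_eq_one_of_pos h1] at hk ⊢
        exact ⟨Int.sign_eq_one_of_pos (by omega), hbj⟩
    · rw [hne k hkj] at hk ⊢; exact ⟨rfl, hk⟩
  have hmin' : ∀ k, b k ≠ 0 → t j * ((b j).sign : ℝ) ≤ t k * ((b k).sign : ℝ) := fun k hk =>
    hmin k (by simpa using hk)
  obtain ⟨i', hi', hci'⟩ : ∃ i, b' i ≠ 0 ∧ c ≤ t i * ((b' i).sign : ℝ) := by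
    by_cases hbi' : b' i = 0
    · have hij : i = j := by
        by_contra hij
        rw [hne i hij] at hbi'
        exact hbi hbi'
      subst hij
      obtain ⟨k, hk⟩ := Function.ne_iff.1 h0
      obtain ⟨h1, h2⟩ := hsign k hk
      exact ⟨k, hk, by rw [h1]; exact hci.trans (hmin' k h2)⟩
    · exact ⟨i, hbi', by rw [(hsign i hbi').1]; exact hci⟩
  refine ⟨?_, i', hi', hci'⟩
  have hterm : ∀ k, t k * (b' k : ℝ) = t k * ((b' k).sign : ℝ) * |(b' k : ℝ)| := by
    intro k
    have h1 : ((b' k).sign : ℝ) * |(b' k : ℝ)| = b' k := by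
      exact_mod_cast Int.sign_mul_abs (b' k)
    rw [mul_assoc, h1]
  rcases le_or_gt (t j * ((b j).sign : ℝ)) 0 with h1 | h1
  · have h2 : ∑ k, t k * (b' k : ℝ) = ∑ k, t k * (b k : ℝ) - t j * ((b j).sign : ℝ) := by
      rw [← Finset.add_sum_erase _ _ (Finset.mem_univ j),
        ← Finset.add_sum_erase _ (fun k => t k * (b k : ℝ)) (Finset.mem_univ j), hbj',
        Finset.sum_congr rfl fun k hk => by rw [hne k (Finset.ne_of_mem_erase hk)]]
      push_cast
      ring
    rw [h2]; linarith
  · have h2 : t i' * (b' i' : ℝ) ≤ ∑ k, t k * (b' k : ℝ) := by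
      refine Finset.single_le_sum (f := fun k => t k * (b' k : ℝ)) (fun k _ => ?_)
        (Finset.mem_univ i')
      change 0 ≤ t k * (b' k : ℝ)
      by_cases hk : b' k = 0
      · simp [hk]
      · obtain ⟨h3, h4⟩ := hsign k hk
        rw [hterm, h3]
        exact mul_nonneg (h1.le.trans (hmin' k h4)) (abs_nonneg _)
    refine le_trans ?_ h2
    rw [hterm]
    have h3 : (1 : ℝ) ≤ |(b' i' : ℝ)| := by exact_mod_cast Int.one_le_abs hi'
    nlinarith

lemma reflTransGen_descent {t : Fin d → ℝ} {c : ℝ} (hc0 : 0 ≤ c) {ℓ : ℝ} (n : ℕ) :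
    ∀ b : Fin d → ℤ, ∑ i, (b i).natAbs = n → ‖b‖ ≤ ℓ → c ≤ ∑ i, t i * b i →
      (∃ i, b i ≠ 0 ∧ c ≤ t i * (b i).sign) →
      Relation.ReflTransGen (stepIn J {w | ‖w‖ ≤ ℓ ∧ (w = 0 ∨ c ≤ ∑ i, t i * w i)}) b 0 := by
  classical
  induction n using Nat.strong_induction_on with
  | _ n ih =>
    intro b hbn hbℓ hc hi
    obtain ⟨j, b', hbj, hb', hj⟩ := exists_descent_step hc hi hc0
    have hne : ∀ k, k ≠ j → b' k = b k := fun k hk => by simp [hb', hk]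
    have hbj' : b' j = b j - (b j).sign := by simp [hb', sub_eq_add_neg]
    have habs : ∀ k, (b' k).natAbs ≤ (b k).natAbs ∧ (k = j → (b' k).natAbs < (b k).natAbs) := by
      intro k
      by_cases hk : k = j
      · subst hk
        rw [hbj']
        rcases lt_or_gt_of_ne hbj with h1 | h1
        · rw [Int.sign_eq_neg_one_of_neg h1]; omega
        · rw [Int.sign_eq_one_of_pos h1]; omega
      · rw [hne k hk]; exact ⟨le_rfl, fun h => absurd h hk⟩
    have hℓ : ‖b'‖ ≤ ℓ := by
      refine le_trans ?_ hbℓ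
      refine (pi_norm_le_iff_of_nonneg (norm_nonneg b)).2 fun k => le_trans ?_ (norm_le_pi_norm b k)
      rw [Int.norm_eq_abs, Int.norm_eq_abs, ← Int.cast_abs, ← Int.cast_abs, Int.cast_le, Int.abs_eq_natAbs,
        Int.abs_eq_natAbs]
      exact_mod_cast (habs k).1
    have hadj : (bondGraph J).Adj b b' := by
      rw [hb']
      refine Subcritical.bondGraph_adj_single b j _ ?_
      rw [abs_neg]
      rcases lt_or_gt_of_ne hbj with h1 | h1
      · rw [Int.sign_eq_neg_one_of_neg h1]; rfl
      · rw [Int.sign_eq_one_of_pos h1]; rfl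
    rcases hj with h0 | ⟨hc', hi'⟩
    · rw [h0] at hadj hℓ
      exact Relation.ReflTransGen.single ⟨hadj, ⟨hbℓ, Or.inr hc⟩, hℓ, Or.inl rfl⟩
    · refine Relation.ReflTransGen.head ⟨hadj, ⟨hbℓ, Or.inr hc⟩, hℓ, Or.inr hc'⟩
        (ih _ ?_ b' rfl hℓ hc' hi')
      rw [← hbn]
      exact Finset.sum_lt_sum (fun k _ => (habs k).1) ⟨j, Finset.mem_univ j, (habs j).2 rfl⟩

/-- The sites near `u` whose height differs from that of `u`, together with `u`. -/
def spindle (t : EuclideanSpace ℝ (Fin d)) (ℓ c : ℝ) (u : Fin d → ℤ) : Set (Fin d → ℤ) :=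
  {w | ‖w - u‖ ≤ ℓ ∧ (w = u ∨ c ≤ |height t (w - u)|)}

/-- Up to the sign of `t` the height of `b` is positive. Being at least `c * (d * ℓ)`, it cannot
come from `d` coordinates of rate below `c`, so the coordinatewise descent to the origin can start.
-/
lemma reflTransGen_spindle_zero {t : EuclideanSpace ℝ (Fin d)} {ℓ c c₁ : ℝ} (hc : 0 < c)
    (hcc₁ : c * (d * ℓ) ≤ c₁) {b : Fin d → ℤ} (hb : ‖b‖ ≤ ℓ) (hbt : c₁ ≤ |height t b|) :
    Relation.ReflTransGen (stepIn J (spindle t ℓ c 0)) b 0 := by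
  wlog hpos : 0 ≤ height t b generalizing t
  · have := this (t := -t) (by rwa [height_neg_left, abs_neg])
      (by rw [height_neg_left]; linarith)
    refine Relation.ReflTransGen.mono ?_ b 0 this
    exact fun a b hab => by simpa [spindle, stepIn, height_neg_left] using hab
  have hℓ : 0 ≤ ℓ := (norm_nonneg b).trans hb
  have key : Relation.ReflTransGen
      (stepIn J {w | ‖w‖ ≤ ℓ ∧ (w = 0 ∨ c ≤ ∑ i, t i * (w i : ℝ))}) b 0 := by
    rw [abs_of_nonneg hpos] at hbt
    by_cases hb0 : b = 0
    · rw [hb0]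
    have hℓ1 : 1 ≤ ℓ := (one_le_norm hb0).trans hb
    have hd : (1 : ℝ) ≤ d := by
      rcases Nat.eq_zero_or_pos d with rfl | hd
      · exact absurd (Subsingleton.elim b 0) hb0
      · exact_mod_cast hd
    have hcle : c ≤ c₁ := by
      refine le_trans ?_ hcc₁
      have : 1 ≤ d * ℓ := one_le_mul_of_one_le_of_one_le hd hℓ1
      nlinarith
    rw [height_eq_sum] at hbt
    refine reflTransGen_descent (t := t) hc.le _ b rfl hb (hcle.trans hbt) ?_
    by_contra hcon
    push Not at hcon
    have hlt : ∑ i, t i * (b i : ℝ) < ∑ _i : Fin d, c * ℓ := by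
      have hle : ∀ i, t i * (b i : ℝ) < c * ℓ := by
        intro i
        by_cases hbi : b i = 0
        · rw [hbi]; simp; positivity
        · have h1 := hcon i hbi
          have h2 : ((b i).sign : ℝ) * |(b i : ℝ)| = b i := by
            exact_mod_cast Int.sign_mul_abs (b i)
          have h3 : |(b i : ℝ)| ≤ ℓ := by
            rw [← Int.norm_eq_abs]; exact (norm_le_pi_norm b i).trans hb
          have h4 : 0 < |(b i : ℝ)| := abs_pos.2 (by exact_mod_cast hbi)
          calc t i * (b i : ℝ) = t i * ((b i).sign : ℝ) * |(b i : ℝ)| := by rw [mul_assoc, h2]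
            _ < c * |(b i : ℝ)| := by gcongr
            _ ≤ c * ℓ := by gcongr
      have : Nonempty (Fin d) := by
        obtain ⟨k, -⟩ := Function.ne_iff.1 hb0
        exact ⟨k⟩
      exact Finset.sum_lt_sum_of_nonempty Finset.univ_nonempty fun i _ => hle i
    rw [Finset.sum_const, Finset.card_univ, Fintype.card_fin, nsmul_eq_mul] at hlt
    linarith
  refine Relation.ReflTransGen.mono ?_ b 0 key
  rintro a b ⟨hab, ha, hb⟩
  have himp : ∀ w, ‖w‖ ≤ ℓ ∧ (w = 0 ∨ c ≤ ∑ i, t i * (w i : ℝ)) → w ∈ spindle t ℓ c 0 := by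
    rintro w ⟨h1, h2⟩
    refine ⟨by rwa [sub_zero], h2.imp_right fun h3 => ?_⟩
    rw [sub_zero, height_eq_sum]
    exact h3.trans (le_abs_self _)
  exact ⟨hab, himp a ha, himp b hb⟩

lemma reflTransGen_spindle {t : EuclideanSpace ℝ (Fin d)} {ℓ c c₁ : ℝ} (hc : 0 < c)
    (hcc₁ : c * (d * ℓ) ≤ c₁) {u b : Fin d → ℤ} (hb : ‖b - u‖ ≤ ℓ)
    (hbt : c₁ ≤ |height t (b - u)|) :
    Relation.ReflTransGen (stepIn J (spindle t ℓ c u)) b u := by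
  have h1 := (reflTransGen_spindle_zero (J := J) hc hcc₁ hb hbt).lift
    (p := stepIn J (spindle t ℓ c u)) (fun w => w + u) ?_
  · change Relation.ReflTransGen _ (b - u + u) (0 + u) at h1
    rwa [sub_add_cancel, zero_add] at h1
  · rintro a b ⟨hab, ha, hb⟩
    refine ⟨?_, ?_, ?_⟩
    · rw [bondGraph_adj] at hab ⊢
      refine ⟨fun h => hab.1 (add_right_cancel h), ?_⟩
      rw [add_sub_add_right_eq_sub]
      exact hab.2
    · simpa [spindle] using ha
    · simpa [spindle] using hb

end

/-! ### Local surgery and its effect on the selected points -/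

section
variable {d : ℕ} {J : Coupling d} {β q : ℝ} {P : Measure (Config J)}

open Classical in
/-- Modify the bonds that touch `B`: those inside `W ∪ (cluster of 0) \ B` are opened and the
others are closed. -/
def patch (B W : Set (Fin d → ℤ)) (ω : Config J) : Config J := fun e =>
  if ∃ a ∈ e.1, a ∈ B then decide (∀ a ∈ e.1, a ∈ W ∨ (a ∈ cluster ω 0 ∧ a ∉ B)) else ω e

section Patch

variable {B W : Set (Fin d → ℤ)} {ω : Config J}

lemma patch_adj_of_touch {a b : Fin d → ℤ} (h : a ∈ B ∨ b ∈ B) :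
    (openGraph (patch B W ω)).Adj a b ↔ (bondGraph J).Adj a b ∧
      (a ∈ W ∨ (a ∈ cluster ω 0 ∧ a ∉ B)) ∧ (b ∈ W ∨ (b ∈ cluster ω 0 ∧ b ∉ B)) := by
  rw [openGraph_adj]
  simp [patch, h]
  tauto

lemma patch_adj_of_not_touch {a b : Fin d → ℤ} (ha : a ∉ B) (hb : b ∉ B) :
    (openGraph (patch B W ω)).Adj a b ↔ (openGraph ω).Adj a b := by
  rw [openGraph_adj, openGraph_adj]
  simp [patch, ha, hb]

lemma mem_of_mem_cluster_patch (hWB : W ⊆ B) (h0 : 0 ∉ B) {y : Fin d → ℤ}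
    (hy : y ∈ cluster (patch B W ω) 0) : y ∈ W ∨ (y ∈ cluster ω 0 ∧ y ∉ B) := by
  refine cluster_induction (p := fun y => y ∈ W ∨ (y ∈ cluster ω 0 ∧ y ∉ B))
    (Or.inr ⟨mem_cluster_self _ _, h0⟩) (fun a b _ ha hab => ?_) hy
  by_cases ht : a ∈ B ∨ b ∈ B
  · exact ((patch_adj_of_touch ht).1 hab).2.2
  · push Not at ht
    rw [patch_adj_of_not_touch ht.1 ht.2] at hab
    rcases ha with ha | ha
    · exact absurd (hWB ha) ht.1
    · exact Or.inr ⟨mem_cluster_of_adj ha.1 hab, ht.2⟩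

lemma mem_cluster_patch_of_reflTransGen (hWB : W ⊆ B) {a b : Fin d → ℤ}
    (h : Relation.ReflTransGen (stepIn J W) a b) : a ∈ cluster (patch B W ω) b := by
  rw [mem_cluster_comm]
  induction h with
  | refl => exact mem_cluster_self _ _
  | tail _ hbc ih =>
    exact mem_cluster_of_adj ih
      ((patch_adj_of_touch (Or.inl (hWB hbc.2.1))).2 ⟨hbc.1, Or.inl hbc.2.1, Or.inl hbc.2.2⟩)

/-- An old path from `z` to `B` is intact until it enters `B`. The entrance bond is reopened by the
patch, and its end in `B` is joined to `u` inside `W`. -/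
lemma mem_cluster_patch_of_notMem (hWB : W ⊆ B) {u : Fin d → ℤ}
    (hhit : ∃ b ∈ cluster ω 0, b ∈ B)
    (hW : ∀ a ∈ cluster ω 0, a ∉ B → ∀ b ∈ B, (bondGraph J).Adj a b →
      b ∈ W ∧ Relation.ReflTransGen (stepIn J W) b u) {z : Fin d → ℤ} (hz : z ∈ cluster ω 0)
    (hzB : z ∉ B) : z ∈ cluster (patch B W ω) u := by
  rw [mem_cluster_comm]
  by_contra hcon
  obtain ⟨b₀, hb₀, hb₀B⟩ := hhit
  rw [← cluster_eq_of_mem hz] at hb₀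
  obtain ⟨a, b, ha, ⟨haB, haz⟩, hab, hb⟩ := exists_adj_of_mem_cluster
    (p := fun y => y ∉ B ∧ y ∈ cluster (patch B W ω) z) hb₀ ⟨hzB, mem_cluster_self _ _⟩
    (fun hp => hp.1 hb₀B)
  rw [cluster_eq_of_mem hz] at ha
  by_cases hbB : b ∈ B
  · obtain ⟨hbW, hbu⟩ := hW a ha haB b hbB (openGraph_le_bondGraph ω hab)
    have h1 : b ∈ cluster (patch B W ω) z := mem_cluster_of_adj haz
      ((patch_adj_of_touch (Or.inr hbB)).2
        ⟨openGraph_le_bondGraph ω hab, Or.inr ⟨ha, haB⟩, Or.inl hbW⟩)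
    have h2 := mem_cluster_patch_of_reflTransGen (ω := ω) hWB hbu
    rw [mem_cluster_comm] at h2
    rw [← cluster_eq_of_mem h1] at hcon
    exact hcon h2
  · exact hb ⟨hbB, mem_cluster_of_adj haz ((patch_adj_of_not_touch haB hbB).2 hab)⟩

end Patch

section Selection

variable {ℓ : ℝ} {U : Finset (Fin d → ℤ)} {C C' : Set (Fin d → ℤ)}

/-- A set together with the balls centred in `U` that it hits. -/
def hull (ℓ : ℝ) (U : Finset (Fin d → ℤ)) (C : Set (Fin d → ℤ)) : Set (Fin d → ℤ) :=
  C ∪ {w | ∃ v ∈ U, ‖w - v‖ ≤ ℓ ∧ ∃ b ∈ C, ‖b - v‖ ≤ ℓ}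

/-- The centres `u ∈ U` of the balls that are hit by `C`, avoid `0` and `x`, and see the hull
of `C` outside of the ball in a double cone. -/
def precone (P : Measure (Config J)) (t : EuclideanSpace ℝ (Fin d)) (ℓ : ℝ)
    (U : Finset (Fin d → ℤ)) (x : Fin d → ℤ) (C : Set (Fin d → ℤ)) : Set (Fin d → ℤ) :=
  {u | u ∈ U ∧ ℓ < ‖0 - u‖ ∧ ℓ < ‖x - u‖ ∧ (∃ b ∈ C, ‖b - u‖ ≤ ℓ) ∧
    ∀ z ∈ hull ℓ U C, ℓ < ‖z - u‖ → zeta P (z - u) ≤ 5 * |height t (z - u)|}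

/-- The points of `C` that see the rest of `C` in the double cone of parameter `θ`. -/
def sharpPoints (P : Measure (Config J)) (t : EuclideanSpace ℝ (Fin d)) (θ : ℝ)
    (C : Set (Fin d → ℤ)) : Set (Fin d → ℤ) :=
  {u | u ∈ C ∧ ∀ z ∈ C, z ≠ u → θ * zeta P (z - u) < |height t (z - u)|}

/-- Two sets that hit the ball around `u` and agree outside of it. -/
def AgreeOff (ℓ : ℝ) (u : Fin d → ℤ) (C C' : Set (Fin d → ℤ)) : Prop :=
  (∀ z, ℓ < ‖z - u‖ → (z ∈ C ↔ z ∈ C')) ∧ (∃ b ∈ C, ‖b - u‖ ≤ ℓ) ∧ ∃ b ∈ C', ‖b - u‖ ≤ ℓ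

/-- The balls of radius `ℓ` around the elements of `U` are disjoint. -/
def Separated (ℓ : ℝ) (U : Finset (Fin d → ℤ)) : Prop :=
  ∀ u ∈ U, ∀ v ∈ U, u ≠ v → 2 * ℓ < ‖u - v‖

lemma AgreeOff.symm {u : Fin d → ℤ} (h : AgreeOff ℓ u C C') : AgreeOff ℓ u C' C :=
  ⟨fun z hz => (h.1 z hz).symm, h.2.2, h.2.1⟩

lemma Separated.lt_norm (hU : Separated ℓ U) {u v w : Fin d → ℤ} (hu : u ∈ U) (hv : v ∈ U)
    (huv : v ≠ u) (hw : ‖w - v‖ ≤ ℓ) : ℓ < ‖w - u‖ := by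
  have h1 := hU v hv u hu huv
  have h2 := norm_sub_le_norm_sub_add_norm_sub v w u
  rw [norm_sub_rev v w] at h2
  linarith

lemma AgreeOff.hit (hU : Separated ℓ U) {u : Fin d → ℤ} (hu : u ∈ U) (h : AgreeOff ℓ u C C')
    {v : Fin d → ℤ} (hv : v ∈ U) (hhit : ∃ b ∈ C, ‖b - v‖ ≤ ℓ) : ∃ b ∈ C', ‖b - v‖ ≤ ℓ := by
  by_cases huv : v = u
  · rw [huv]; exact h.2.2
  · obtain ⟨b, hb, hbv⟩ := hhit
    exact ⟨b, (h.1 b (hU.lt_norm hu hv huv hbv)).1 hb, hbv⟩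

/-- This is why `precone` uses the hull: it fills every ball that is hit, so it forgets what the
cluster looks like inside the modified ball, and eligibility is invariant under surgery. -/
lemma AgreeOff.hull_subset (hU : Separated ℓ U) {u : Fin d → ℤ} (hu : u ∈ U)
    (h : AgreeOff ℓ u C C') : hull ℓ U C ⊆ hull ℓ U C' := by
  rintro w (hw | ⟨v, hv, hwv, hhit⟩)
  · rcases le_or_gt ‖w - u‖ ℓ with h1 | h1
    · exact Or.inr ⟨u, hu, h1, h.2.2⟩
    · exact Or.inl ((h.1 w h1).1 hw)
  · exact Or.inr ⟨v, hv, hwv, h.hit hU hu hv hhit⟩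

variable {t : EuclideanSpace ℝ (Fin d)} {x : Fin d → ℤ} {θ : ℝ}

lemma AgreeOff.precone_subset (hU : Separated ℓ U) {u : Fin d → ℤ} (hu : u ∈ U)
    (h : AgreeOff ℓ u C C') : precone P t ℓ U x C ⊆ precone P t ℓ U x C' :=
  fun _ ⟨hv, h0, hx, hhit, hc⟩ =>
    ⟨hv, h0, hx, h.hit hU hu hv hhit, fun z hz => hc z (h.symm.hull_subset hU hu hz)⟩

lemma AgreeOff.precone_eq (hU : Separated ℓ U) {u : Fin d → ℤ} (hu : u ∈ U)
    (h : AgreeOff ℓ u C C') : precone P t ℓ U x C' = precone P t ℓ U x C :=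
  (h.symm.precone_subset hU hu).antisymm (h.precone_subset hU hu)

/-- Every site of the ball around `u` is in the hull, and therefore in the double cone of `v` with
the better constant `1 / 5 > θ`. What the surgery puts there cannot spoil the sharpness of `v`. -/
lemma AgreeOff.mem_sharpPoints (hU : Separated ℓ U) {u : Fin d → ℤ} (hu : u ∈ U)
    (h : AgreeOff ℓ u C C') (hθ : θ < 1 / 5) (hζ : ∀ z : Fin d → ℤ, z ≠ 0 → 0 < zeta P z)
    (hℓ : 0 ≤ ℓ)
    {v : Fin d → ℤ} (hv : v ∈ precone P t ℓ U x C) (huv : v ≠ u)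
    (hs : v ∈ sharpPoints P t θ C) : v ∈ sharpPoints P t θ C' := by
  have hvu : ℓ < ‖v - u‖ := hU.lt_norm hu hv.1 huv (by simpa using hℓ)
  refine ⟨(h.1 v hvu).1 hs.1, fun z hz hzv => ?_⟩
  rcases le_or_gt ‖z - u‖ ℓ with h1 | h1
  · have h2 := hv.2.2.2.2 z (Or.inr ⟨u, hu, h1, h.2.1⟩) (hU.lt_norm hv.1 hu huv.symm h1)
    have h3 := hζ (z - v) (sub_ne_zero.2 hzv)
    nlinarith
  · exact hs.2 z ((h.1 z h1).2 hz) hzv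

end Selection

namespace Subcritical

variable {ν₀ ν₁ : ℝ} {R : ℕ} (h : Subcritical J β q P ν₀ ν₁ R)

include h

lemma zeta_pos {z : Fin d → ℤ} (hz : z ≠ 0) : 0 < zeta P z :=
  (mul_pos h.hν₁ (norm_pos_iff.2 hz)).trans_le (h.nu_mul_norm_le_zeta z)

/-- The parameters of the local modification. -/
structure PatchParams (P : Measure (Config J)) (ν₁ : ℝ) (R : ℕ) (Cζ ℓ c θ : ℝ) : Prop where
  hCζ : ∀ z : Fin d → ℤ, zeta P z ≤ Cζ * ‖z‖
  hℓ : 0 < ℓ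
  hc : 0 < c
  hcℓ : c ≤ ν₁ * ℓ / 5 - Cζ * R
  hcℓ' : c * (d * ℓ) ≤ ν₁ * ℓ / 5 - Cζ * R
  hθ0 : 0 < θ
  hθ : θ < 1 / 5
  hθc : θ * (Cζ * ℓ) < c

variable {Cζ ℓ c θ : ℝ} {t : EuclideanSpace ℝ (Fin d)} {U : Finset (Fin d → ℤ)}
  {u x : Fin d → ℤ} {ω : Config J}

/-- Where the cluster enters the ball, the cone condition forces a height difference of at least `ν₁
* ℓ / 5` from `u`, up to one bond. So every entrance lies in the spindle and is joined to `u` there.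
Afterwards a site of the cluster is either in the spindle, with height difference at least `c > θ *
(Cζ * ℓ)`, or outside the ball, in the cone of constant `1 / 5`. -/
lemma patch_facts (hp : PatchParams P ν₁ R Cζ ℓ c θ) (hC0 : 0 ≤ Cζ)
    (ht : ∀ z, |height t z| ≤ zeta P z) (hx : x ∈ cluster ω 0)
    (hu : u ∈ precone P t ℓ U x (cluster ω 0)) {ω' : Config J}
    (hω' : ω' = patch {w | ‖w - u‖ ≤ ℓ} (spindle t ℓ c u) ω) :
    AgreeOff ℓ u (cluster ω 0) (cluster ω' 0) ∧ x ∈ cluster ω' 0 ∧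
      u ∈ sharpPoints P t θ (cluster ω' 0) := by
  obtain ⟨huU, h0u, hxu, hhit, hcone⟩ := hu
  have hWB : spindle t ℓ c u ⊆ {w | ‖w - u‖ ≤ ℓ} := fun w hw => hw.1
  have h0B : (0 : Fin d → ℤ) ∉ {w : Fin d → ℤ | ‖w - u‖ ≤ ℓ} := not_le.2 h0u
  have hW : ∀ a ∈ cluster ω 0, a ∉ {w : Fin d → ℤ | ‖w - u‖ ≤ ℓ} →
      ∀ b ∈ {w : Fin d → ℤ | ‖w - u‖ ≤ ℓ}, (bondGraph J).Adj a b →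
      b ∈ spindle t ℓ c u ∧ Relation.ReflTransGen (stepIn J (spindle t ℓ c u)) b u := by
    intro a ha haB b hb hab
    have haB' : ℓ < ‖a - u‖ := not_le.1 haB
    have h1 := hcone a (Or.inl ha) haB'
    have h2 := h.nu_mul_norm_le_zeta (a - u)
    have h3 : ν₁ * ℓ ≤ ν₁ * ‖a - u‖ := mul_le_mul_of_nonneg_left haB'.le h.hν₁.le
    have h4 := (ht (a - b)).trans (h.zeta_le_of_adj hC0 hp.hCζ hab.symm)
    have h5 : |height t (a - u)| ≤ |height t (b - u)| + |height t (a - b)| := by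
      have : height t (a - u) = height t (b - u) + height t (a - b) := by
        simp only [height_sub]; ring
      rw [this]
      exact abs_add_le _ _
    have h6 : ν₁ * ℓ / 5 - Cζ * R ≤ |height t (b - u)| := by linarith
    exact ⟨⟨hb, Or.inr (hp.hcℓ.trans h6)⟩, reflTransGen_spindle hp.hc hp.hcℓ' hb h6⟩
  have hto : ∀ z ∈ cluster ω 0, ℓ < ‖z - u‖ → z ∈ cluster ω' u := fun z hz hzu => by
    rw [hω']
    exact mem_cluster_patch_of_notMem hWB hhit hW hz (not_le.2 hzu)
  have hu0 : u ∈ cluster ω' 0 := mem_cluster_comm.1 (hto 0 (mem_cluster_self _ _) h0u)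
  have hfrom : ∀ z ∈ cluster ω' 0, z ∈ spindle t ℓ c u ∨ (z ∈ cluster ω 0 ∧ ℓ < ‖z - u‖) := by
    intro z hz
    rw [hω'] at hz
    exact (mem_of_mem_cluster_patch hWB h0B hz).imp_right fun hz' => ⟨hz'.1, not_le.1 hz'.2⟩
  have hto' : ∀ z ∈ cluster ω 0, ℓ < ‖z - u‖ → z ∈ cluster ω' 0 := fun z hz hzu => by
    rw [← cluster_eq_of_mem hu0]
    exact hto z hz hzu
  refine ⟨⟨fun z hz => ⟨fun hzC => hto' z hzC hz, fun hzC => ?_⟩, hhit, u, hu0, ?_⟩,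
    hto' x hx hxu, hu0, fun z hz hzu => ?_⟩
  · rcases hfrom z hzC with h1 | h1
    · exact absurd h1.1 (not_le.2 hz)
    · exact h1.1
  · simpa using hp.hℓ.le
  · rcases hfrom z hz with h1 | h1
    · have h2 : c ≤ |height t (z - u)| := h1.2.resolve_left hzu
      have h3 : θ * zeta P (z - u) ≤ θ * (Cζ * ℓ) :=
        mul_le_mul_of_nonneg_left
          ((hp.hCζ _).trans (mul_le_mul_of_nonneg_left h1.1 hC0)) hp.hθ0.le
      linarith [hp.hθc]
    · have h2 := hcone z (Or.inl h1.1) h1.2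
      have h3 := h.zeta_pos (sub_ne_zero.2 hzu)
      have := hp.hθ
      nlinarith

/-- The local modification creates exactly one sharp point. -/
lemma patch_selection (hp : PatchParams P ν₁ R Cζ ℓ c θ) (hC0 : 0 ≤ Cζ)
    (ht : ∀ z, |height t z| ≤ zeta P z) (hU : Separated ℓ U) (hx : x ∈ cluster ω 0)
    (hu : u ∈ precone P t ℓ U x (cluster ω 0)) {ω' : Config J}
    (hω' : ω' = patch {w | ‖w - u‖ ≤ ℓ} (spindle t ℓ c u) ω) :
    x ∈ cluster ω' 0 ∧ precone P t ℓ U x (cluster ω' 0) = precone P t ℓ U x (cluster ω 0) ∧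
      precone P t ℓ U x (cluster ω' 0) ∩ sharpPoints P t θ (cluster ω' 0) =
        insert u (precone P t ℓ U x (cluster ω 0) ∩ sharpPoints P t θ (cluster ω 0)) := by
  obtain ⟨hag, hx', hus⟩ := h.patch_facts hp hC0 ht hx hu hω'
  have hpre := hag.precone_eq (P := P) (t := t) (x := x) hU hu.1
  refine ⟨hx', hpre, ?_⟩
  rw [hpre]
  ext v
  constructor
  · rintro ⟨h1, h2⟩
    by_cases hvu : v = u
    · exact Or.inl hvu
    · refine Or.inr ⟨h1, hag.symm.mem_sharpPoints hU hu.1 hp.hθ (fun z hz => h.zeta_pos hz)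
        hp.hℓ.le (x := x) (t := t) ?_ hvu h2⟩
      rw [hpre]; exact h1
  · rintro (rfl | ⟨h1, h2⟩)
    · exact ⟨hu, hus⟩
    · by_cases hvu : v = u
      · rw [hvu]; exact ⟨hu, hus⟩
      · exact ⟨h1, hag.mem_sharpPoints hU hu.1 hp.hθ (fun z hz => h.zeta_pos hz) hp.hℓ.le h1 hvu h2⟩

end Subcritical

end

/-! ### Comparison of the numbers of selected points -/

section
variable {d : ℕ} {J : Coupling d} {β q : ℝ} {P : Measure (Config J)}

section Counting

open Classical in
/-- The number of elements of a finset in a set. -/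
def countIn {ι : Type*} (U : Finset ι) (S : Set ι) : ℕ := (U.filter (· ∈ S)).card

section CountIn

variable {ι : Type*} {U : Finset ι} {S S' : Set ι}

lemma countIn_mono (h : S ⊆ S') : countIn U S ≤ countIn U S' := by
  classical
  exact Finset.card_le_card fun u hu =>
    Finset.mem_filter.2 ⟨(Finset.mem_filter.1 hu).1, h (Finset.mem_filter.1 hu).2⟩

lemma countIn_union_le : countIn U (S ∪ S') ≤ countIn U S + countIn U S' := by
  classical
  refine le_trans (Finset.card_le_card fun u hu => ?_) (Finset.card_union_le _ _)
  simp only [Finset.mem_union, Finset.mem_filter, Set.mem_union] at hu ⊢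
  tauto

lemma countIn_insert {u : ι} (hu : u ∈ U) (huS : u ∉ S) :
    countIn U (insert u S) = countIn U S + 1 := by
  classical
  rw [countIn, countIn, ← Finset.card_insert_of_notMem (a := u)
    fun h => huS (Finset.mem_filter.1 h).2]
  congr 1
  ext v
  simp only [Finset.mem_filter, Finset.mem_insert, Set.mem_insert_iff]
  constructor
  · rintro ⟨h1, h2⟩
    exact h2.imp_right fun h => ⟨h1, h⟩
  · rintro (rfl | h)
    · exact ⟨hu, Or.inl rfl⟩
    · exact ⟨h.1, Or.inr h.2⟩

lemma countIn_eq_sum {Ω : Type*} (F : ι → Set Ω) (ω : Ω) :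
    (countIn U {u | ω ∈ F u} : ℝ) = ∑ u ∈ U, (F u).indicator (fun _ => (1 : ℝ)) ω := by
  classical
  rw [countIn, Finset.card_filter]
  push_cast
  exact Finset.sum_congr rfl fun u _ => by simp only [Set.indicator_apply, Set.mem_ofPred_eq]

lemma measurable_countIn {Ω : Type*} [MeasurableSpace Ω] (U : Finset ι) {p : Ω → Set ι}
    (hp : ∀ u, Measurable fun ω => u ∈ p ω) : Measurable fun ω => countIn U (p ω) := by
  classical
  simp only [countIn, Finset.card_filter]
  exact Finset.measurable_sum _ fun u _ =>
    Measurable.ite (measurableSet_setOfPred.2 (hp u)) measurable_const measurable_const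

end CountIn

variable {Ω ι : Type*} [MeasurableSpace Ω] {μ : Measure Ω} [IsFiniteMeasure μ] {U : Finset ι}
  {F : ι → Set Ω} {E : Set Ω}

lemma sum_measureReal_eq_integral (hF : ∀ u, MeasurableSet (F u)) :
    ∑ u ∈ U, μ.real (F u) = ∫ ω, (countIn U {u | ω ∈ F u} : ℝ) ∂μ := by
  simp only [countIn_eq_sum]
  rw [integral_finsetSum _ fun u _ => (integrable_const (1 : ℝ)).indicator (hF u)]
  refine Finset.sum_congr rfl fun u _ => ?_
  rw [integral_indicator_const _ (hF u), smul_eq_mul, mul_one]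

lemma integrable_countIn (hF : ∀ u, MeasurableSet (F u)) :
    Integrable (fun ω => (countIn U {u | ω ∈ F u} : ℝ)) μ := by
  simp only [countIn_eq_sum]
  exact integrable_finsetSum _ fun u _ => (integrable_const (1 : ℝ)).indicator (hF u)

lemma mul_measureReal_le_sum (hF : ∀ u, MeasurableSet (F u)) (hE : MeasurableSet E) {m : ℝ}
    (h : ∀ ω ∈ E, m ≤ countIn U {u | ω ∈ F u}) :
    m * μ.real E ≤ ∑ u ∈ U, μ.real (F u) := by
  rw [sum_measureReal_eq_integral hF, mul_comm, ← smul_eq_mul, ← integral_indicator_const m hE]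
  refine integral_mono ((integrable_const m).indicator hE) (integrable_countIn hF) fun ω => ?_
  by_cases hω : ω ∈ E
  · simpa [hω] using h ω hω
  · simp [hω]

lemma sum_measureReal_le_mul (hF : ∀ u, MeasurableSet (F u)) (hE : MeasurableSet E)
    (hFE : ∀ u, F u ⊆ E) {k : ℝ} (h : ∀ ω ∈ E, (countIn U {u | ω ∈ F u} : ℝ) ≤ k) :
    ∑ u ∈ U, μ.real (F u) ≤ k * μ.real E := by
  rw [sum_measureReal_eq_integral hF, mul_comm, ← smul_eq_mul, ← integral_indicator_const k hE]
  refine integral_mono (integrable_countIn hF) ((integrable_const k).indicator hE) fun ω => ?_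
  by_cases hω : ω ∈ E
  · simpa [hω] using h ω hω
  · have : ∀ u, ω ∉ F u := fun u hu => hω (hFE u hu)
    simp [hω, this, countIn]

/-- A sequence that doubles at each step before `T` has small partial sums. -/
lemma sum_range_le_of_doubling {a : ℕ → ℝ} {p : ℝ} (ha : ∀ s, 0 ≤ a s) (hp : ∀ s, a s ≤ p) {T : ℕ}
    (h : ∀ s < T, 2 * a s ≤ a (s + 1)) {k : ℕ} (hk : k ≤ T) :
    ∑ s ∈ Finset.range k, a s ≤ p / 2 ^ (T - k) := by
  have h1 : ∀ k ≤ T, ∑ s ∈ Finset.range k, a s ≤ a k := by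
    intro k
    induction k with
    | zero => intro _; simpa using ha 0
    | succ k ih =>
      intro hk
      rw [Finset.sum_range_succ]
      have := ih (by omega)
      have := h k (by omega)
      linarith
  have h2 : ∀ j, ∀ k, k + j = T → a k * 2 ^ j ≤ p := by
    intro j
    induction j with
    | zero => intro k _; simpa using hp k
    | succ j ih =>
      intro k hk
      have h3 := ih (k + 1) (by omega)
      have h4 := h k (by omega)
      rw [pow_succ']
      have : (0 : ℝ) < 2 ^ j := by positivity
      nlinarith
  rw [le_div_iff₀ (by positivity)]
  exact (mul_le_mul_of_nonneg_right (h1 k hk) (by positivity)).trans (h2 (T - k) k (by omega))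

end Counting

section Measurability

variable {ℓ θ : ℝ} {U : Finset (Fin d → ℤ)} {t : EuclideanSpace ℝ (Fin d)} {x : Fin d → ℤ}

lemma measurable_mem_precone (u : Fin d → ℤ) :
    Measurable fun ω : Config J => u ∈ precone P t ℓ U x (cluster ω 0) := by
  have hhit : ∀ v : Fin d → ℤ, Measurable fun ω : Config J => ∃ b ∈ cluster ω 0, ‖b - v‖ ≤ ℓ :=
    fun v => Measurable.exists fun b => (measurable_mem_cluster 0 b).and measurable_const
  have hhull : ∀ z : Fin d → ℤ, Measurable fun ω : Config J => z ∈ hull ℓ U (cluster ω 0) := by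
    intro z
    refine (measurable_mem_cluster 0 z).or ?_
    exact Measurable.exists fun v => measurable_const.and (measurable_const.and (hhit v))
  exact measurable_const.and (measurable_const.and (measurable_const.and ((hhit u).and
    (Measurable.forall fun z => (hhull z).imp measurable_const))))

lemma measurable_mem_sharpPoints (u : Fin d → ℤ) :
    Measurable fun ω : Config J => u ∈ sharpPoints P t θ (cluster ω 0) :=
  (measurable_mem_cluster 0 u).and
    (Measurable.forall fun z => (measurable_mem_cluster 0 z).imp measurable_const)

end Measurability

namespace Subcritical

variable {ν₀ ν₁ : ℝ} {R : ℕ} (h : Subcritical J β q P ν₀ ν₁ R)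

include h

lemma not_touch_of_notMem_bondsIn {ℓ : ℕ} {u : Fin d → ℤ} {e : Bond J}
    (he : e ∉ bondsIn J (translate u (box d (ℓ + R)))) :
    ¬ ∃ a ∈ e.1, a ∈ {w : Fin d → ℤ | ‖w - u‖ ≤ (ℓ : ℝ)} := by
  rintro ⟨a, ha, hau⟩
  refine he (mem_bondsIn.2 fun b hb => ?_)
  rw [mem_translate, norm_le_iff_mem_box]
  have hau' : ‖a - u‖ ≤ (ℓ : ℝ) := hau
  by_cases hab : b = a
  · rw [hab]; push_cast; have : (0 : ℝ) ≤ R := Nat.cast_nonneg R; linarith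
  · have hee : e.1 = s(a, b) := ((Sym2.mem_and_mem_iff (Ne.symm hab)).1 ⟨ha, hb⟩)
    have hadj : (bondGraph J).Adj a b := by
      have := e.2
      rw [hee] at this
      exact this
    have h1 : ‖b - a‖ ≤ (R : ℝ) := by
      rw [pi_norm_le_iff_of_nonneg (Nat.cast_nonneg R)]
      intro i
      rw [Pi.sub_apply, Int.norm_eq_abs]
      exact_mod_cast h.range a b hadj i
    have h2 := norm_sub_le_norm_sub_add_norm_sub b a u
    push_cast
    linarith

lemma patch_eq_off {ℓ : ℕ} {W : Set (Fin d → ℤ)} {u : Fin d → ℤ} {ω : Config J} {e : Bond J}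
    (he : e ∉ bondsIn J (translate u (box d (ℓ + R)))) :
    patch {w | ‖w - u‖ ≤ (ℓ : ℝ)} W ω e = ω e := by
  rw [patch, if_neg (h.not_touch_of_notMem_bondsIn he)]

/-- Many centres of almost conical balls but few sharp points: exponentially unlikely. -/
lemma exists_selection_bound (ℓ : ℕ) : ∃ c₀ : ℝ, 0 < c₀ ∧
    ∀ (Cζ c θ : ℝ) (t : EuclideanSpace ℝ (Fin d)) (U : Finset (Fin d → ℤ)) (x : Fin d → ℤ)
      (m T k : ℕ), PatchParams P ν₁ R Cζ ℓ c θ → 0 ≤ Cζ → (∀ z, |height t z| ≤ zeta P z) →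
      Separated ℓ U → 2 * (T : ℝ) ≤ c₀ * (m - T) → k ≤ T →
      P.real {ω | x ∈ cluster ω 0 ∧
        m ≤ countIn U (precone P t ℓ U x (cluster ω 0)) ∧
        countIn U (precone P t ℓ U x (cluster ω 0) ∩ sharpPoints P t θ (cluster ω 0)) < k} ≤
        P.real (connected J 0 x) / 2 ^ (T - k) := by
  have := h.isProb
  obtain ⟨ec, hec0, hec⟩ := exists_energy_const J h.hβ h.hq
  refine ⟨ec ((2 * (ℓ + R) + 1) ^ d), hec0 _, ?_⟩
  intro Cζ c θ t U x m T k hp hC0 ht hU hT hkT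
  set c₀ := ec ((2 * (ℓ + R) + 1) ^ d) with hc₀
  have hc₀0 : 0 < c₀ := hec0 _
  set pre : Config J → Set (Fin d → ℤ) := fun ω => precone P t ℓ U x (cluster ω 0) with hpre
  set sel : Config J → Set (Fin d → ℤ) := fun ω => pre ω ∩ sharpPoints P t θ (cluster ω 0) with hsel
  have mpre : ∀ u, Measurable fun ω => u ∈ pre ω := fun u => measurable_mem_precone u
  have msel : ∀ u, Measurable fun ω => u ∈ sel ω := fun u =>
    (mpre u).and (measurable_mem_sharpPoints u)
  set A : Set (Config J) := {ω | x ∈ cluster ω 0 ∧ m ≤ countIn U (pre ω)} with hA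
  have mA : MeasurableSet A := by
    refine MeasurableSet.inter (measurableSet_connected 0 x) ?_
    exact measurableSet_le measurable_const (measurable_countIn U mpre)
  set E : ℕ → Set (Config J) := fun s => A ∩ {ω | countIn U (sel ω) = s} with hE
  have mE : ∀ s, MeasurableSet (E s) := fun s =>
    mA.inter (measurableSet_eq_fun (measurable_countIn U msel) measurable_const)
  -- Double counting of pairs of a configuration and a centre: on `E s` at least `m - s` eligible
  -- centres are not selected, and surgery at `u` leads to `E (s + 1)` with `u` selected, where only
  -- `s + 1` centres are. Fixing `u` before comparing makes it unnecessary to recover it from the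
  -- new configuration.
  have hstep : ∀ s < T, 2 * P.real (E s) ≤ P.real (E (s + 1)) := by
    intro s hs
    have mF : ∀ u, MeasurableSet (E s ∩ {ω | u ∈ pre ω ∧ u ∉ sel ω}) := fun u =>
      (mE s).inter (measurableSet_setOfPred.2 ((mpre u).and (msel u).not))
    have mG : ∀ u, MeasurableSet (E (s + 1) ∩ {ω | u ∈ sel ω}) := fun u =>
      (mE (s + 1)).inter (measurableSet_setOfPred.2 (msel u))
    have h1 : ((m : ℝ) - s) * P.real (E s) ≤
        ∑ u ∈ U, P.real (E s ∩ {ω | u ∈ pre ω ∧ u ∉ sel ω}) := by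
      refine mul_measureReal_le_sum mF (mE s) fun ω hω => ?_
      have h2 : pre ω ⊆ {u | ω ∈ E s ∩ {ω | u ∈ pre ω ∧ u ∉ sel ω}} ∪ sel ω := by
        intro u hu
        by_cases hus : u ∈ sel ω
        · exact Or.inr hus
        · exact Or.inl ⟨hω, hu, hus⟩
      have h3 := (countIn_mono (U := U) h2).trans countIn_union_le
      rw [show countIn U (sel ω) = s from hω.2] at h3
      have h4 := hω.1.2.trans h3
      have h5 : (m : ℝ) ≤ countIn U {u | ω ∈ E s ∩ {ω | u ∈ pre ω ∧ u ∉ sel ω}} + s := by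
        exact_mod_cast h4
      linarith
    have h2 : ∑ u ∈ U, P.real (E (s + 1) ∩ {ω | u ∈ sel ω}) ≤ (s + 1) * P.real (E (s + 1)) := by
      refine sum_measureReal_le_mul mG (mE (s + 1)) (fun u => Set.inter_subset_left) fun ω hω => ?_
      have h4 : countIn U {u | ω ∈ E (s + 1) ∩ {ω | u ∈ sel ω}} ≤ countIn U (sel ω) :=
        countIn_mono fun u hu => hu.2
      rw [show countIn U (sel ω) = s + 1 from hω.2] at h4
      exact_mod_cast h4
    have h3 : c₀ * ∑ u ∈ U, P.real (E s ∩ {ω | u ∈ pre ω ∧ u ∉ sel ω}) ≤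
        ∑ u ∈ U, P.real (E (s + 1) ∩ {ω | u ∈ sel ω}) := by
      rw [Finset.mul_sum]
      refine Finset.sum_le_sum fun u hu => ?_
      have h4 := hec P h.rc (translate u (box d (ℓ + R))) _ _ (mF u) (mG u) ?_
      · rwa [translate, Finset.card_map, card_box] at h4
      · rintro ω ⟨⟨hωA, hωs⟩, hωp, hωn⟩
        obtain ⟨hx', hpre', hsel'⟩ := h.patch_selection hp hC0 ht hU hωA.1 hωp rfl
        set ω' := patch {w | ‖w - u‖ ≤ (ℓ : ℝ)} (spindle t ℓ c u) ω with hω'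
        have hsel'' : sel ω' = insert u (sel ω) := hsel'
        refine ⟨ω', ⟨⟨⟨hx', ?_⟩, ?_⟩, ?_⟩, fun e he => h.patch_eq_off he⟩
        · have h6 : pre ω' = pre ω := hpre'
          rw [h6]
          exact hωA.2
        · change countIn U (sel ω') = s + 1
          rw [hsel'', countIn_insert hu hωn, show countIn U (sel ω) = s from hωs]
        · change u ∈ sel ω'
          rw [hsel'']
          exact Set.mem_insert _ _
    have hsT : (s : ℝ) + 1 ≤ T := by exact_mod_cast hs
    have h4 : 2 * ((s : ℝ) + 1) ≤ c₀ * (m - s) := by nlinarith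
    have h5 : c₀ * ((m - s) * P.real (E s)) ≤ (s + 1) * P.real (E (s + 1)) :=
      (mul_le_mul_of_nonneg_left h1 hc₀0.le).trans (h3.trans h2)
    have h6 : 2 * ((s : ℝ) + 1) * P.real (E s) ≤ c₀ * (m - s) * P.real (E s) :=
      mul_le_mul_of_nonneg_right h4 measureReal_nonneg
    have h7 : ((s : ℝ) + 1) * (2 * P.real (E s)) ≤ (s + 1) * P.real (E (s + 1)) := by linarith
    exact le_of_mul_le_mul_left h7 (by positivity)
  have hsub : {ω | x ∈ cluster ω 0 ∧ m ≤ countIn U (pre ω) ∧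
      countIn U (sel ω) < k} ⊆ ⋃ s ∈ Finset.range k, E s := by
    rintro ω ⟨h1, h2, h3⟩
    exact Set.mem_iUnion₂.2 ⟨_, Finset.mem_range.2 h3, ⟨h1, h2⟩, rfl⟩
  refine (measureReal_mono hsub (measure_ne_top P _)).trans
    ((measureReal_biUnion_finset_le _ _).trans ?_)
  exact sum_range_le_of_doubling (fun _ => measureReal_nonneg)
    (fun s => measureReal_mono fun ω hω => hω.1.1) hstep hkT

end Subcritical

end

/-! ### Linearly many sharp points for distant endpoints -/

section
variable {d : ℕ} {J : Coupling d} {β q : ℝ} {P : Measure (Config J)}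

section Sublattice

/-- The sites of a box in a given class modulo `L`. -/
def boxClass (N L : ℕ) (o : Fin d → ℤ) : Finset (Fin d → ℤ) :=
  (box d N).filter fun u => (fun i => u i % (L : ℤ)) = o

lemma norm_le_of_boxClass {N L : ℕ} (o : Fin d → ℤ) :
    ∀ u ∈ boxClass N L o, ∀ v ∈ boxClass N L o, u ≠ v → (L : ℝ) ≤ ‖u - v‖ := by
  intro u hu v hv huv
  obtain ⟨i, hi⟩ := Function.ne_iff.1 huv
  have h1 : u i % (L : ℤ) = v i % (L : ℤ) := by
    have h2 := congr_fun (Finset.mem_filter.1 hu).2 i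
    have h3 := congr_fun (Finset.mem_filter.1 hv).2 i
    exact h2.trans h3.symm
  have h2 : (L : ℤ) ∣ u i - v i := Int.ModEq.dvd (Eq.symm h1)
  have h3 : (L : ℤ) ≤ |u i - v i| :=
    Int.le_of_dvd (abs_pos.2 (sub_ne_zero.2 hi)) ((dvd_abs _ _).2 h2)
  have h4 := norm_le_pi_norm (u - v) i
  rw [Pi.sub_apply, Int.norm_eq_abs] at h4
  have h5 : (L : ℝ) ≤ |((u i - v i : ℤ) : ℝ)| := by exact_mod_cast h3
  linarith

lemma separated_boxClass {N L : ℕ} {ℓ : ℝ} (hL : 2 * ℓ < L) (o : Fin d → ℤ) :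
    Separated ℓ (boxClass N L o) :=
  fun u hu v hv huv => hL.trans_le (norm_le_of_boxClass o u hu v hv huv)

open Classical in
/-- Among `n L^d` sites of a box, at least `n` are in the same class modulo `L`. -/
lemma exists_boxClass {N L n : ℕ} (hL : 0 < L) {Y : Finset (Fin d → ℤ)} (hY : Y ⊆ box d N)
    (hn : n * L ^ d ≤ Y.card) :
    ∃ o ∈ Finset.Icc (0 : Fin d → ℤ) (fun _ => (L : ℤ) - 1),
      n ≤ (Y.filter (· ∈ boxClass N L o)).card := by
  have hcard : (Finset.Icc (0 : Fin d → ℤ) (fun _ => (L : ℤ) - 1)).card = L ^ d := by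
    rw [Pi.card_Icc]
    simp
  obtain ⟨o, ho, hno⟩ := Finset.exists_le_card_fiber_of_mul_le_card_of_maps_to
    (s := Y) (t := Finset.Icc (0 : Fin d → ℤ) (fun _ => (L : ℤ) - 1))
    (f := fun u i => u i % (L : ℤ)) (n := n) (fun u _ => Finset.mem_Icc.2
      ⟨fun i => Int.emod_nonneg _ (by omega), fun i => by
        have := Int.emod_lt_of_pos (u i) (show (0 : ℤ) < L by omega)
        show u i % (L : ℤ) ≤ (L : ℤ) - 1
        omega⟩)
    ⟨fun _ => 0, Finset.mem_Icc.2 ⟨le_rfl, fun i => by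
      show (0 : ℤ) ≤ (L : ℤ) - 1
      omega⟩⟩ (by rw [hcard, mul_comm]; exact hn)
  refine ⟨o, ho, hno.trans (Finset.card_le_card fun u hu => ?_)⟩
  rw [Finset.mem_filter] at hu ⊢
  exact ⟨hu.1, Finset.mem_filter.2 ⟨hY hu.1, hu.2⟩⟩

end Sublattice

namespace Subcritical

variable {ν₀ ν₁ : ℝ} {R : ℕ} (h : Subcritical J β q P ν₀ ν₁ R)

include h

/-- The height is odd and `ζ` is even. -/
lemma abs_height_le {t : EuclideanSpace ℝ (Fin d)} (ht : ∀ z, height t z ≤ zeta P z)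
    (z : Fin d → ℤ) : |height t z| ≤ zeta P z := by
  have h1 := ht (0 - z)
  rw [height_sub, zero_sub, h.zeta_neg, height_eq_sum t 0] at h1
  simp only [Pi.zero_apply, Int.cast_zero, mul_zero, Finset.sum_const_zero, zero_sub] at h1
  exact abs_le.2 ⟨by linarith, ht z⟩

/-- A coarse cone point on a sparse lattice is the centre of an almost conical ball. -/
lemma mem_precone_of_coarse {Cζ K ℓ : ℝ} (hC0 : 0 ≤ Cζ)
    (hC : ∀ z : Fin d → ℤ, zeta P z ≤ Cζ * ‖z‖) (hℓ : 0 ≤ ℓ) (hK : 62 * K < ν₁ * ℓ) {L : ℝ}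
    (hL : 2 * ℓ ≤ L) (hL' : 50 * (Cζ * ℓ) ≤ ν₁ * (L - ℓ))
    {t : EuclideanSpace ℝ (Fin d)} (ht : ∀ z, |height t z| ≤ zeta P z)
    {U : Finset (Fin d → ℤ)} (hU : ∀ u ∈ U, ∀ v ∈ U, u ≠ v → L ≤ ‖u - v‖)
    {x u : Fin d → ℤ} {C : Set (Fin d → ℤ)} (hu : u ∈ U) (huC : u ∈ C) (h0 : ℓ < ‖0 - u‖)
    (hx : ℓ < ‖x - u‖)
    (hc : ∀ z ∈ C, 62 * K < zeta P (z - u) → zeta P (z - u) ≤ 4 * |height t (z - u)|) :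
    u ∈ precone P t ℓ U x C := by
  have hν := h.hν₁
  refine ⟨hu, h0, hx, ⟨u, huC, by simpa using hℓ⟩, fun z hz hzu => ?_⟩
  rcases hz with hz | ⟨v, hv, hzv, b, hb, hbv⟩
  · have h1 := h.nu_mul_norm_le_zeta (z - u)
    have h2 : ν₁ * ℓ < ν₁ * ‖z - u‖ := by gcongr
    have h3 := hc z hz (by linarith)
    have := abs_nonneg (height t (z - u))
    linarith
  -- A site of another ball is compared with a cluster point `b` of that ball. The error, `10 * (Cζ
  -- * ℓ)` in total, is at most a fifth of `ζ (z - u)` because the balls are far apart; this turns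
  -- the constant `4` into `5`.
  · have huv : v ≠ u := by rintro rfl; linarith
    have h1 := hU v hv u hu huv
    have hbu : L - ℓ ≤ ‖b - u‖ := by
      have h2 := norm_sub_le_norm_sub_add_norm_sub v b u
      rw [norm_sub_rev v b] at h2
      linarith
    have hzu' : L - ℓ ≤ ‖z - u‖ := by
      have h2 := norm_sub_le_norm_sub_add_norm_sub v z u
      rw [norm_sub_rev v z] at h2
      linarith
    have h3 := h.nu_mul_norm_le_zeta (b - u)
    have h4 : 62 * K < zeta P (b - u) := by nlinarith
    have h5 := hc b hb h4
    have h6 : zeta P (z - b) ≤ Cζ * (2 * ℓ) := by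
      refine (hC _).trans (mul_le_mul_of_nonneg_left ?_ hC0)
      have h7 := norm_sub_le_norm_sub_add_norm_sub z v b
      rw [norm_sub_rev v b] at h7
      linarith
    have h7 := h.zeta_sub_le z b u
    have h8 : |height t (b - u)| ≤ |height t (z - u)| + zeta P (z - b) := by
      have h9 : height t (b - u) = height t (z - u) - height t (z - b) := by
        simp only [height_sub]; ring
      rw [h9]
      exact (abs_sub _ _).trans (add_le_add_right (ht _) _)
    have h9 := h.nu_mul_norm_le_zeta (z - u)
    have h10 : ν₁ * (L - ℓ) ≤ ν₁ * ‖z - u‖ := by gcongr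
    linarith

set_option maxHeartbeats 800000 in
/-- Clusters of far away points with few sharp points are exponentially unlikely. -/
lemma exists_sharp_bound_far : ∃ θ a c M₀ : ℝ, 0 < θ ∧ 0 < a ∧ 0 < c ∧
    ∀ (x : Fin d → ℤ) (t : EuclideanSpace ℝ (Fin d)), (∀ z, height t z ≤ zeta P z) →
      height t x = zeta P x → M₀ ≤ ‖x‖ →
      P.real {ω | x ∈ cluster ω 0 ∧ ¬ ∃ F : Finset (Fin d → ℤ),
        ↑F ⊆ sharpPoints P t θ (cluster ω 0) ∧ a * ‖x‖ ≤ F.card} ≤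
        Real.exp (-c * ‖x‖) * P.real (connected J 0 x) := by
  classical
  have := h.isProb
  have hν := h.hν₁
  obtain ⟨K, c₁, H₀, hK, hc₁, hcoarse⟩ := h.exists_coarse_bound
  obtain ⟨Cζ, hC0, -, hC⟩ := h.exists_zeta_le
  -- The radius exceeds the coarse resolution `62 * K` in `ζ`-distance, and makes `ν₁ * ℓ / 5 - Cζ *
  -- R` at least `1`, which dominates both `c` and `c * (d * ℓ)` below.
  obtain ⟨ℓ, hℓ⟩ := exists_nat_gt ((62 * K + 5 * (Cζ * R) + 5) / ν₁)
  rw [div_lt_iff₀ hν, mul_comm] at hℓ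
  have hCR : 0 ≤ Cζ * R := by positivity
  have hℓ0 : (0 : ℝ) < ℓ := by
    by_contra hcon
    have : ν₁ * (ℓ : ℝ) ≤ 0 := mul_nonpos_of_nonneg_of_nonpos hν.le (not_lt.1 hcon)
    linarith
  set c : ℝ := 1 / (d * ℓ + 1) with hc
  have hc0 : 0 < c := by positivity
  have hc1 : c ≤ 1 := by
    rw [hc, div_le_one (by positivity)]
    have : (0 : ℝ) ≤ d * ℓ := by positivity
    linarith
  have hcd : c * (d * ℓ) ≤ 1 := by
    rw [hc, div_mul_eq_mul_div, div_le_one (by positivity)]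
    linarith
  set θ : ℝ := min (1 / 10) (c / (2 * (Cζ * ℓ + 1))) with hθ
  have hp : PatchParams P ν₁ R Cζ ℓ c θ := by
    refine ⟨hC, hℓ0, hc0, by linarith, by linarith, by positivity,
      (min_le_left _ _).trans_lt (by norm_num), ?_⟩
    have h1 : θ ≤ c / (2 * (Cζ * ℓ + 1)) := min_le_right _ _
    rw [le_div_iff₀ (by positivity)] at h1
    have h2 : 0 < θ := by positivity
    have h3 : 0 ≤ θ * (Cζ * ℓ) := by positivity
    nlinarith
  obtain ⟨c₀, hc₀, hsel⟩ := h.exists_selection_bound ℓ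
  obtain ⟨L, hL⟩ := exists_nat_gt (2 * (ℓ : ℝ) + 50 * (Cζ * ℓ) / ν₁)
  have hCℓ : 0 ≤ 50 * (Cζ * ℓ) / ν₁ := by positivity
  have hL1 : 2 * (ℓ : ℝ) < L := by linarith
  have hL2 : 50 * (Cζ * ℓ) ≤ ν₁ * (L - ℓ) := by
    have : 50 * (Cζ * ℓ) / ν₁ ≤ L - ℓ := by linarith
    rw [div_le_iff₀ hν] at this
    linarith
  have hL0 : (0 : ℝ) < L := by linarith
  set D : ℝ := (L : ℝ) ^ d with hD
  have hD0 : 0 < D := by positivity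
  -- One residue class modulo `L` keeps `m`, about `H / (4 * K * D)`, coarse cone points. Doubling
  -- holds up to `T`, about `c₀ * m / (2 + c₀)`, which is `2 * κ * H`; with `k` half of `T`, both
  -- `k` and `T - k` are of order `κ * H`.
  set κ : ℝ := c₀ / (2 * (2 + c₀) * (4 * K * D)) with hκ
  have hκ0 : 0 < κ := by positivity
  set c₂ : ℝ := min c₁ (κ / 4) with hc₂
  have hc₂0 : 0 < c₂ := lt_min hc₁ (by positivity)
  set Hmin : ℝ := |H₀| + 62 * K + 8 * K * (2 * ℓ + 1) ^ d + 3 / κ + 2 * D / c₂ with hHmin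
  refine ⟨θ, κ * ν₁ / 2, c₂ * ν₁ / 2, Hmin / ν₁, hp.hθ0, by positivity, by positivity, ?_⟩
  intro x t ht htx hx
  set H := zeta P x with hH
  have hxH : ν₁ * ‖x‖ ≤ H := h.nu_mul_norm_le_zeta x
  have hHH : Hmin ≤ H := by
    rw [div_le_iff₀ hν, mul_comm] at hx
    exact hx.trans hxH
  have p1 : 0 ≤ |H₀| := abs_nonneg _
  have p3 : 0 ≤ 8 * K * (2 * (ℓ : ℝ) + 1) ^ d := by positivity
  have p4 : 0 ≤ 3 / κ := by positivity
  have p5 : 0 ≤ 2 * D / c₂ := by positivity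
  have hH0 : H₀ ≤ H := (le_abs_self _).trans (by linarith)
  have hH1 : 62 * K ≤ H := by linarith
  have hH2 : 8 * K * (2 * (ℓ : ℝ) + 1) ^ d ≤ H := by linarith
  have hH3 : 3 ≤ κ * H := by
    have : 3 / κ ≤ H := by linarith
    rwa [div_le_iff₀ hκ0, mul_comm] at this
  have hH4 : D ≤ c₂ * H / 2 := by
    have : 2 * D / c₂ ≤ H := by linarith
    rw [div_le_iff₀ hc₂0] at this
    linarith
  have hHpos : 0 < H := by linarith
  have habs := h.abs_height_le ht
  set m : ℕ := ⌊H / (4 * K * D)⌋₊ with hm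
  have hm1 : (m : ℝ) * (4 * K * D) ≤ H := by
    rw [← le_div_iff₀ (by positivity)]
    exact Nat.floor_le (by positivity)
  have hm2 : H / (4 * K * D) < m + 1 := Nat.lt_floor_add_one _
  set T : ℕ := ⌊c₀ * m / (2 + c₀)⌋₊ with hT
  have hT1 : (T : ℝ) * (2 + c₀) ≤ c₀ * m := by
    rw [← le_div_iff₀ (by positivity)]
    exact Nat.floor_le (by positivity)
  have hT2 : c₀ * m / (2 + c₀) < T + 1 := Nat.lt_floor_add_one _
  set k : ℕ := T / 2 with hk
  have hkH : κ * H / 2 ≤ k := by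
    have h1 : (T : ℝ) ≤ 2 * k + 1 := by
      have : T ≤ 2 * k + 1 := by omega
      exact_mod_cast this
    have h2 : c₀ / (2 + c₀) * (H / (4 * K * D) - 1) ≤ c₀ * m / (2 + c₀) := by
      rw [mul_div_right_comm]
      gcongr
      linarith
    have h3 : c₀ / (2 + c₀) * (H / (4 * K * D)) = 2 * (κ * H) := by
      rw [hκ]; field_simp
    have h4 : c₀ / (2 + c₀) ≤ 1 := (div_le_one (by positivity)).2 (by linarith)
    rw [mul_sub, h3, mul_one] at h2
    linarith
  set N : ℕ := ⌈4 * H / ν₁⌉₊ with hN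
  set O := Finset.Icc (0 : Fin d → ℤ) (fun _ => (L : ℤ) - 1) with hO
  have hOcard : (O.card : ℝ) = D := by
    rw [hO, Pi.card_Icc]
    simp [hD]
  set bad₁ : Set (Config J) := {ω | x ∈ cluster ω 0 ∧ ¬ ∃ Y : Finset (Fin d → ℤ),
    ↑Y ⊆ cluster ω 0 ∧ H ≤ 2 * K * Y.card ∧ (∀ y ∈ Y, 0 ≤ height t y ∧ height t y ≤ H) ∧
      ∀ y ∈ Y, ∀ z ∈ cluster ω 0, 62 * K < zeta P (z - y) →
        zeta P (z - y) ≤ 4 * |height t (z - y)|} with hbad₁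
  set bad₂ : (Fin d → ℤ) → Set (Config J) := fun o => {ω | x ∈ cluster ω 0 ∧
    m ≤ countIn (boxClass N L o) (precone P t ℓ (boxClass N L o) x (cluster ω 0)) ∧
    countIn (boxClass N L o) (precone P t ℓ (boxClass N L o) x (cluster ω 0) ∩
      sharpPoints P t θ (cluster ω 0)) < k} with hbad₂
  have hsub : {ω | x ∈ cluster ω 0 ∧ ¬ ∃ F : Finset (Fin d → ℤ),
      ↑F ⊆ sharpPoints P t θ (cluster ω 0) ∧ κ * ν₁ / 2 * ‖x‖ ≤ F.card} ⊆
      bad₁ ∪ ⋃ o ∈ O, bad₂ o := by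
    rintro ω ⟨hxC, hF⟩
    by_cases hY : ω ∈ bad₁
    · exact Or.inl hY
    right
    have hY' : ∃ Y : Finset (Fin d → ℤ),
        ↑Y ⊆ cluster ω 0 ∧ H ≤ 2 * K * Y.card ∧ (∀ y ∈ Y, 0 ≤ height t y ∧ height t y ≤ H) ∧
        ∀ y ∈ Y, ∀ z ∈ cluster ω 0, 62 * K < zeta P (z - y) →
          zeta P (z - y) ≤ 4 * |height t (z - y)| := by
      by_contra hcon
      exact hY ⟨hxC, hcon⟩
    obtain ⟨Y, hYC, hYcard, hYH, hYc⟩ := hY'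
    -- Surgery must not touch the endpoints. The number of discarded sites is a constant, absorbed
    -- by the lower bound on `H`.
    set Y' := Y \ (translate 0 (box d ℓ) ∪ translate x (box d ℓ)) with hY'
    have hY'card : m * L ^ d ≤ Y'.card := by
      have h1 : Y.card ≤ Y'.card + ((2 * ℓ + 1) ^ d + (2 * ℓ + 1) ^ d) := by
        have h2 := Finset.card_union_le (translate 0 (box d ℓ)) (translate x (box d ℓ))
        have h3 : ∀ v : Fin d → ℤ, (translate v (box d ℓ)).card = (2 * ℓ + 1) ^ d := fun v => by
          rw [translate, Finset.card_map, card_box]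
        rw [h3, h3] at h2
        have h4 := Finset.le_card_sdiff (translate 0 (box d ℓ) ∪ translate x (box d ℓ)) Y
        rw [← hY'] at h4
        omega
      have h2 : (Y.card : ℝ) ≤ Y'.card + ((2 * ℓ + 1) ^ d + (2 * ℓ + 1) ^ d) := by
        exact_mod_cast h1
      have h3 : (4 * K) * ((m : ℝ) * D) ≤ (4 * K) * Y'.card := by nlinarith
      have h4 := le_of_mul_le_mul_left h3 (by positivity)
      rw [hD] at h4
      exact_mod_cast h4
    have hY'far : ∀ y ∈ Y', y ∈ Y ∧ (ℓ : ℝ) < ‖0 - y‖ ∧ (ℓ : ℝ) < ‖x - y‖ := by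
      intro y hy
      rw [hY', Finset.mem_sdiff, Finset.mem_union, mem_translate, mem_translate,
        norm_le_iff_mem_box, norm_le_iff_mem_box, not_or, not_le, not_le, norm_sub_rev y 0,
        norm_sub_rev y x] at hy
      exact hy
    -- The double cone condition at `y`, tested on the origin, gives `ζ(y) ≤ 4 * H`: this is the use
    -- of the bound on the heights of the coarse cone points. The set of possible centres is thus
    -- fixed in advance and finite.
    have hY'box : Y' ⊆ box d N := by
      intro y hy
      have hyY := (hY'far y hy).1
      rw [norm_le_iff_mem_box]
      refine le_trans ?_ (Nat.le_ceil _)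
      rw [le_div_iff₀ hν, mul_comm]
      refine (h.nu_mul_norm_le_zeta y).trans ?_
      have h1 := hYc y hyY 0 (mem_cluster_self _ _)
      rw [zero_sub, h.zeta_neg, ← zero_sub, height_sub, height_eq_sum t 0] at h1
      simp only [Pi.zero_apply, Int.cast_zero, mul_zero, Finset.sum_const_zero, zero_sub,
        abs_neg] at h1
      rw [abs_of_nonneg (hYH y hyY).1] at h1
      rcases lt_or_ge (62 * K) (zeta P y) with h2 | h2
      · linarith [h1 h2, (hYH y hyY).2]
      · linarith
    obtain ⟨o, hoO, ho⟩ := exists_boxClass (by exact_mod_cast hL0) hY'box hY'card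
    refine Set.mem_iUnion₂.2 ⟨o, hoO, hxC, ho.trans ?_, ?_⟩
    · refine Finset.card_le_card fun y hy => ?_
      obtain ⟨hyY', hyo⟩ := Finset.mem_filter.1 hy
      obtain ⟨hyY, hy0, hyx⟩ := hY'far y hyY'
      exact Finset.mem_filter.2 ⟨hyo, h.mem_precone_of_coarse hC0 hC hℓ0.le (by linarith)
        hL1.le hL2 habs (norm_le_of_boxClass o) hyo (hYC hyY) hy0 hyx (hYc y hyY)⟩
    · by_contra hcon
      refine hF ⟨(boxClass N L o).filter (· ∈ precone P t ℓ (boxClass N L o) x (cluster ω 0) ∩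
        sharpPoints P t θ (cluster ω 0)), fun u hu => ?_, ?_⟩
      · exact (Finset.mem_filter.1 (Finset.mem_coe.1 hu)).2.2
      · have h1 : (k : ℝ) ≤ (countIn (boxClass N L o) (precone P t ℓ (boxClass N L o) x
            (cluster ω 0) ∩ sharpPoints P t θ (cluster ω 0)) : ℝ) := by
          exact_mod_cast not_lt.1 hcon
        refine le_trans ?_ (h1.trans (le_of_eq (by rw [countIn]; congr!)))
        refine le_trans ?_ hkH
        have h2 := mul_le_mul_of_nonneg_left hxH hκ0.le
        linarith
  have hb₁ : P.real bad₁ ≤ Real.exp (-c₁ * H) * P.real (connected J 0 x) :=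
    hcoarse x (height t) (height_sub t) ht htx hH0
  have hb₂ : ∀ o, P.real (bad₂ o) ≤ Real.exp (-(κ / 4 * H)) * P.real (connected J 0 x) := by
    intro o
    refine (hsel Cζ c θ t (boxClass N L o) x m T k hp hC0 habs (separated_boxClass hL1 o)
      (by linarith) (by omega)).trans ?_
    rw [div_eq_mul_inv, mul_comm]
    refine mul_le_mul_of_nonneg_right ?_ measureReal_nonneg
    have h1 : Real.exp (κ / 4 * H) ≤ 2 ^ (T - k) := by
      have h2 : κ / 4 * H ≤ (T - k : ℕ) * (1 / 2 : ℝ) := by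
        have : (k : ℝ) ≤ (T - k : ℕ) := by
          have : k ≤ T - k := by omega
          exact_mod_cast this
        linarith
      refine (Real.exp_le_exp.2 h2).trans ?_
      rw [Real.exp_nat_mul]
      refine pow_le_pow_left₀ (Real.exp_pos _).le ?_ _
      rw [← Real.le_log_iff_exp_le (by norm_num)]
      linarith [Real.log_two_gt_d9]
    rw [Real.exp_neg]
    exact inv_anti₀ (Real.exp_pos _) h1
  have hP0 : 0 ≤ P.real (connected J 0 x) := measureReal_nonneg
  calc _ ≤ P.real (bad₁ ∪ ⋃ o ∈ O, bad₂ o) := measureReal_mono hsub (measure_ne_top P _)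
    _ ≤ P.real bad₁ + ∑ o ∈ O, P.real (bad₂ o) :=
      (measureReal_union_le _ _).trans (add_le_add_right (measureReal_biUnion_finset_le _ _) _)
    _ ≤ Real.exp (-(c₂ * H)) * P.real (connected J 0 x) +
        ∑ o ∈ O, Real.exp (-(c₂ * H)) * P.real (connected J 0 x) := by
      refine add_le_add (hb₁.trans ?_) (Finset.sum_le_sum fun o _ => (hb₂ o).trans ?_)
      · refine mul_le_mul_of_nonneg_right (Real.exp_le_exp.2 ?_) hP0
        have : c₂ * H ≤ c₁ * H := mul_le_mul_of_nonneg_right (min_le_left _ _) hHpos.le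
        linarith
      · refine mul_le_mul_of_nonneg_right (Real.exp_le_exp.2 ?_) hP0
        have : c₂ * H ≤ κ / 4 * H := mul_le_mul_of_nonneg_right (min_le_right _ _) hHpos.le
        linarith
    _ = (D + 1) * Real.exp (-(c₂ * H)) * P.real (connected J 0 x) := by
      rw [Finset.sum_const, nsmul_eq_mul, hOcard]; ring
    _ ≤ Real.exp (-(c₂ * ν₁ / 2) * ‖x‖) * P.real (connected J 0 x) := by
      refine mul_le_mul_of_nonneg_right ?_ hP0
      calc (D + 1) * Real.exp (-(c₂ * H))
          ≤ Real.exp (c₂ * H / 2) * Real.exp (-(c₂ * H)) := by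
            refine mul_le_mul_of_nonneg_right ?_ (Real.exp_pos _).le
            exact (add_le_add_left hH4 1).trans (Real.add_one_le_exp _)
        _ = Real.exp (-(c₂ / 2 * H)) := by rw [← Real.exp_add]; congr 1; ring
        _ ≤ _ := by
            refine Real.exp_le_exp.2 ?_
            have : c₂ / 2 * (ν₁ * ‖x‖) ≤ c₂ / 2 * H := by gcongr
            linarith

end Subcritical

end

/-! ### Bounded endpoints and passage to cone points -/

section
variable {d : ℕ} {J : Coupling d} {β q : ℝ} {P : Measure (Config J)}

open Classical in
/-- Among the bonds that touch `B`, exactly those inside `W` are open. -/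
def isolate (B W : Set (Fin d → ℤ)) (ω : Config J) : Config J := fun e =>
  if ∃ a ∈ e.1, a ∈ B then decide (∀ a ∈ e.1, a ∈ W) else ω e

lemma isolate_adj {B W : Set (Fin d → ℤ)} {ω : Config J} {a b : Fin d → ℤ} (ha : a ∈ B) :
    (openGraph (isolate B W ω)).Adj a b ↔ (bondGraph J).Adj a b ∧ a ∈ W ∧ b ∈ W := by
  rw [openGraph_adj]
  simp [isolate, ha]
  tauto

lemma mem_of_mem_cluster_isolate {B W : Set (Fin d → ℤ)} {ω : Config J} (hWB : W ⊆ B)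
    {x y : Fin d → ℤ} (hx : x ∈ W) (hy : y ∈ cluster (isolate B W ω) x) : y ∈ W :=
  cluster_induction (p := (· ∈ W)) hx
    (fun _ _ _ ha hab => ((isolate_adj (hWB ha)).1 hab).2.2) hy

lemma mem_cluster_isolate_of_reflTransGen {B W : Set (Fin d → ℤ)} {ω : Config J} (hWB : W ⊆ B)
    {a b : Fin d → ℤ} (h : Relation.ReflTransGen (stepIn J W) a b) :
    a ∈ cluster (isolate B W ω) b := by
  rw [mem_cluster_comm]
  induction h with
  | refl => exact mem_cluster_self _ _
  | tail _ hbc ih => exact mem_cluster_of_adj ih ((isolate_adj (hWB hbc.2.1)).2 hbc)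

namespace Subcritical

variable {ν₀ ν₁ : ℝ} {R : ℕ} (h : Subcritical J β q P ν₀ ν₁ R)

include h

lemma sharpPoints_anti {t : EuclideanSpace ℝ (Fin d)} {θ θ' : ℝ} (hθ : θ ≤ θ')
    (C : Set (Fin d → ℤ)) : sharpPoints P t θ' C ⊆ sharpPoints P t θ C :=
  fun _ hu => ⟨hu.1, fun z hz hzu =>
    (mul_le_mul_of_nonneg_right hθ (h.zeta_nonneg _)).trans_lt (hu.2 z hz hzu)⟩

/-- The origin is a sharp point with a probability bounded below. -/
lemma exists_sharp_bound_near (M : ℝ) : ∃ θ p : ℝ, 0 < θ ∧ 0 < p ∧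
    ∀ (x : Fin d → ℤ) (t : EuclideanSpace ℝ (Fin d)), x ≠ 0 → height t x = zeta P x → ‖x‖ ≤ M →
      p ≤ P.real {ω | x ∈ cluster ω 0 ∧ 0 ∈ sharpPoints P t θ (cluster ω 0)} := by
  have := h.isProb
  have hν := h.hν₁
  obtain ⟨ec, hec0, hec⟩ := exists_energy_const J h.hβ h.hq
  obtain ⟨Cζ, hC0, -, hC⟩ := h.exists_zeta_le
  set N : ℕ := ⌈M⌉₊ with hN
  -- Since `x ≠ 0` has height `ζ(x) ≥ ν₁`, it is joined to the origin inside the spindle; isolating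
  -- the spindle confines the cluster to it and makes the origin sharp.
  set c : ℝ := ν₁ / (d * N + 1) with hc
  have hc0 : 0 < c := by positivity
  have hcd : c * (d * N) ≤ ν₁ := by
    rw [hc, div_mul_eq_mul_div, div_le_iff₀ (by positivity)]
    nlinarith
  have hθ0 : 0 < c / (2 * (Cζ * N + 1)) := by positivity
  refine ⟨c / (2 * (Cζ * N + 1)), ec ((2 * (N + R) + 1) ^ d), hθ0, hec0 _, ?_⟩
  intro x t hx0 htx hx
  have hxN : ‖x‖ ≤ (N : ℝ) := hx.trans (Nat.le_ceil M)
  have hxt : ν₁ ≤ |height t x| := by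
    rw [htx]
    refine le_trans ?_ (le_abs_self _)
    refine le_trans ?_ (h.nu_mul_norm_le_zeta x)
    have := one_le_norm hx0
    nlinarith
  have hW0 : (0 : Fin d → ℤ) ∈ spindle t N c 0 := ⟨by simp, Or.inl rfl⟩
  have hWB : spindle t N c 0 ⊆ {w : Fin d → ℤ | ‖w - 0‖ ≤ (N : ℝ)} := fun w hw => hw.1
  have key := hec P h.rc (translate 0 (box d (N + R))) Set.univ
    {ω | x ∈ cluster ω 0 ∧ 0 ∈ sharpPoints P t (c / (2 * (Cζ * N + 1))) (cluster ω 0)}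
    MeasurableSet.univ
    (measurableSet_setOfPred.2 ((measurable_mem_cluster 0 x).and (measurable_mem_sharpPoints 0)))
    fun ω _ => ?_
  · rwa [translate, Finset.card_map, card_box, probReal_univ, mul_one] at key
  · refine ⟨isolate {w : Fin d → ℤ | ‖w - 0‖ ≤ (N : ℝ)} (spindle t N c 0) ω,
      ⟨?_, mem_cluster_self _ _, fun z hz hz0 => ?_⟩, fun e he => ?_⟩
    · exact mem_cluster_isolate_of_reflTransGen hWB (reflTransGen_spindle_zero hc0 hcd hxN hxt)
    · obtain ⟨h1, h2⟩ := mem_of_mem_cluster_isolate hWB hW0 hz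
      refine lt_of_lt_of_le ?_ (h2.resolve_left hz0)
      have h3 : zeta P (z - 0) ≤ Cζ * N := (hC _).trans (mul_le_mul_of_nonneg_left h1 hC0)
      calc c / (2 * (Cζ * N + 1)) * zeta P (z - 0)
          ≤ c / (2 * (Cζ * N + 1)) * (Cζ * N) := mul_le_mul_of_nonneg_left h3 hθ0.le
        _ < c := by
          rw [div_mul_eq_mul_div, div_lt_iff₀ (by positivity)]
          have : 0 ≤ Cζ * N := by positivity
          nlinarith
    · rw [isolate, if_neg (h.not_touch_of_notMem_bondsIn he)]

/-- Clusters with few sharp points are exponentially unlikely. -/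
lemma exists_sharp_bound : ∃ θ a c : ℝ, 0 < θ ∧ 0 < a ∧ 0 < c ∧
    ∀ (x : Fin d → ℤ) (t : EuclideanSpace ℝ (Fin d)), (∀ z, height t z ≤ zeta P z) →
      height t x = zeta P x →
      P.real {ω | x ∈ cluster ω 0 ∧ ¬ ∃ F : Finset (Fin d → ℤ),
        ↑F ⊆ sharpPoints P t θ (cluster ω 0) ∧ a * ‖x‖ ≤ F.card} ≤
        Real.exp (-c * ‖x‖) * P.real (connected J 0 x) := by
  have := h.isProb
  obtain ⟨θ₁, a₁, c₁, M, hθ₁, ha₁, hc₁, hfar⟩ := h.exists_sharp_bound_far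
  obtain ⟨θ₂, p, hθ₂, hp, hnear⟩ := h.exists_sharp_bound_near M
  have hM : 0 < |M| + 1 := by positivity
  refine ⟨min θ₁ θ₂, min a₁ (1 / (|M| + 1)), min c₁ (p / (|M| + 1)), lt_min hθ₁ hθ₂,
    lt_min ha₁ (by positivity), lt_min hc₁ (by positivity), ?_⟩
  intro x t ht htx
  have hP0 : 0 ≤ P.real (connected J 0 x) := measureReal_nonneg
  have hx0 := norm_nonneg x
  rcases le_or_gt M ‖x‖ with hx | hx
  · refine (measureReal_mono ?_ (measure_ne_top P _)).trans
      ((hfar x t ht htx hx).trans (mul_le_mul_of_nonneg_right (Real.exp_le_exp.2 ?_) hP0))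
    · rintro ω ⟨h1, h2⟩
      refine ⟨h1, fun ⟨F, hF, hFx⟩ => h2 ⟨F, hF.trans (h.sharpPoints_anti (min_le_left _ _) _), ?_⟩⟩
      exact (mul_le_mul_of_nonneg_right (min_le_left _ _) hx0).trans hFx
    · have := mul_le_mul_of_nonneg_right (min_le_left c₁ (p / (|M| + 1))) hx0
      linarith
  · by_cases hx00 : x = 0
    · have hempty : {ω : Config J | x ∈ cluster ω 0 ∧ ¬ ∃ F : Finset (Fin d → ℤ),
          ↑F ⊆ sharpPoints P t (min θ₁ θ₂) (cluster ω 0) ∧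
            min a₁ (1 / (|M| + 1)) * ‖x‖ ≤ F.card} = ∅ :=
        Set.eq_empty_iff_forall_notMem.2 fun ω hω => hω.2 ⟨∅, by simp, by simp [hx00]⟩
      rw [hempty, measureReal_empty]
      positivity
    have hxM : ‖x‖ ≤ |M| + 1 := by linarith [le_abs_self M]
    set G := {ω : Config J | x ∈ cluster ω 0 ∧ 0 ∈ sharpPoints P t θ₂ (cluster ω 0)} with hG
    have mG : MeasurableSet G :=
      measurableSet_setOfPred.2 ((measurable_mem_cluster 0 x).and (measurable_mem_sharpPoints 0))
    have hGc : G ⊆ connected J 0 x := fun ω hω => hω.1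
    have hsub : {ω : Config J | x ∈ cluster ω 0 ∧ ¬ ∃ F : Finset (Fin d → ℤ),
          ↑F ⊆ sharpPoints P t (min θ₁ θ₂) (cluster ω 0) ∧
            min a₁ (1 / (|M| + 1)) * ‖x‖ ≤ F.card} ⊆ connected J 0 x \ G := by
      rintro ω ⟨h1, h2⟩
      refine ⟨h1, fun hω => h2 ⟨{0}, ?_, ?_⟩⟩
      · rw [Finset.coe_singleton, Set.singleton_subset_iff]
        exact h.sharpPoints_anti (min_le_right _ _) _ hω.2
      · rw [Finset.card_singleton, Nat.cast_one]
        refine (mul_le_mul_of_nonneg_right (min_le_right _ _) hx0).trans ?_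
        rw [div_mul_eq_mul_div, one_mul]
        exact (div_le_one hM).2 hxM
    refine (measureReal_mono hsub (measure_ne_top P _)).trans ?_
    -- Here one sharp point is enough, as `‖x‖ / (|M| + 1) ≤ 1`. The bad event has probability at
    -- most `P (0 ↔ x) - p ≤ (1 - p) P (0 ↔ x)`, and the rate is chosen so small that `1 - p` is
    -- below the exponential.
    rw [measureReal_sdiff hGc mG]
    have h1 := hnear x t hx00 htx hx.le
    have h2 : P.real (connected J 0 x) ≤ 1 := measureReal_le_one
    have h3 : min c₁ (p / (|M| + 1)) * ‖x‖ ≤ p := by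
      refine (mul_le_mul (min_le_right _ _) hxM hx0 (by positivity)).trans (le_of_eq ?_)
      exact div_mul_cancel₀ _ hM.ne'
    have h4 := Real.add_one_le_exp (-(min c₁ (p / (|M| + 1))) * ‖x‖)
    have h5 : 1 - p ≤ Real.exp (-(min c₁ (p / (|M| + 1))) * ‖x‖) := by linarith
    calc P.real (connected J 0 x) - P.real G ≤ (1 - p) * P.real (connected J 0 x) := by
          nlinarith
      _ ≤ _ := mul_le_mul_of_nonneg_right h5 hP0

/-- Sharp points are cone points. -/
lemma sharpPoints_subset_conePoints {t : EuclideanSpace ℝ (Fin d)} {θ δ : ℝ}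
    (hθ : 1 - 3 * δ ≤ θ) (C : Set (Fin d → ℤ)) : sharpPoints P t θ C ⊆ conePoints P δ t C := by
  rintro y ⟨hy, hyC⟩
  refine ⟨hy, fun z hz hzy => ?_⟩
  have h1 := hyC z hz hzy
  have h2 := mul_le_mul_of_nonneg_right hθ (h.zeta_nonneg (z - y))
  rcases lt_abs.1 h1 with h3 | h3
  · right
    change xi P (emb (z - y)) - inner ℝ t (emb (z - y)) < 3 * δ * xi P (emb (z - y))
    change (1 - 3 * δ) * xi P (emb (z - y)) ≤ θ * zeta P (z - y) at h2
    change θ * zeta P (z - y) < inner ℝ t (emb (z - y)) at h3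
    linarith
  · left
    have h4 : height t (y - z) = -height t (z - y) := by simp only [height_sub]; ring
    rw [← h4] at h3
    rw [h.zeta_sub_comm z y] at h2 h3
    change xi P (emb (y - z)) - inner ℝ t (emb (y - z)) < 3 * δ * xi P (emb (y - z))
    change (1 - 3 * δ) * xi P (emb (y - z)) ≤ θ * zeta P (y - z) at h2
    change θ * zeta P (y - z) < inner ℝ t (emb (y - z)) at h3
    linarith

end Subcritical

end

end FK

end

theorem theorem2p2 (d : ℕ) (hd : 1 ≤ d) (J : FK.Coupling d) (q β : ℝ) (hq : 1 ≤ q) (hβ : 0 < β)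
    (hβc : (β : EReal) < FK.betaHat J q) :
    ∃ δ ν₅ ν₆ : ℝ, 0 < δ ∧ δ < 1 / 3 ∧ 0 < ν₅ ∧ 0 < ν₆ ∧
      ∀ P : Measure (FK.Config J), FK.IsRandomCluster J β q P →
        ∀ (x : Fin d → ℤ) (t : EuclideanSpace ℝ (Fin d)),
          t ∈ frontier (FK.wulff P) → inner ℝ t (FK.emb x) = FK.xi P (FK.emb x) →
            (ProbabilityTheory.cond P (FK.connected J 0 x)).real
                {ω | ((FK.conePoints P δ t (FK.cluster ω 0)).encard : ENNReal)
                  < ENNReal.ofReal (ν₅ * ‖FK.emb x‖)}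
              ≤ Real.exp (-ν₆ * ‖FK.emb x‖) := by
  -- The constants must not depend on the measure. They are extracted from one random cluster
  -- measure and serve for all of them by uniqueness; if there is none, any constants do.
  by_cases hex : ∃ P₀ : Measure (FK.Config J), FK.IsRandomCluster J β q P₀
  swap
  · exact ⟨1 / 6, 1, 1, by norm_num, by norm_num, one_pos, one_pos,
      fun P hP => absurd ⟨P, hP⟩ hex⟩
  obtain ⟨P₀, hP₀⟩ := hex
  obtain ⟨ν₀, ν₁, -, hν₁, hdecay⟩ := FK.wiredDecay_of_lt_betaHat hβ hq hβc
  obtain ⟨R, hR⟩ := FK.exists_range J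
  have h : FK.Subcritical J β q P₀ ν₀ ν₁ R := ⟨hβ, hq, hP₀, hν₁, hdecay, hR⟩
  obtain ⟨θ, a, c, hθ, ha, hc, hbound⟩ := h.exists_sharp_bound
  have hd0 : (0 : ℝ) < d := by exact_mod_cast hd
  have hθ' : 0 < min θ (1 / 2) := lt_min hθ (by norm_num)
  have hθ'' : min θ (1 / 2) ≤ 1 / 2 := min_le_right _ _
  -- This makes `1 - 3 * δ` equal to `min θ (1 / 2)`, the parameter of the sharp points; the cap `1
  -- / 2` keeps `δ` positive. Division by `d` converts the supremum norm to the Euclidean one.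
  refine ⟨(1 - min θ (1 / 2)) / 3, a / d, c / d, by linarith, by linarith, by positivity,
    by positivity, ?_⟩
  intro P hP x t ht htx
  obtain rfl := h.unique hP
  have := h.isProb
  have hxd := FK.norm_emb_le x
  have hpos := h.connected_pos x
  rw [measureReal_def, ProbabilityTheory.cond_apply (FK.measurableSet_connected 0 x),
    ENNReal.toReal_mul, ENNReal.toReal_inv, ← measureReal_def, ← measureReal_def,
    inv_mul_le_iff₀ hpos, mul_comm _ (Real.exp _)]
  refine (measureReal_mono ?_ (measure_ne_top _ _)).trans
    ((hbound x t (h.inner_le_zeta ht) htx).trans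
      (mul_le_mul_of_nonneg_right (Real.exp_le_exp.2 ?_) hpos.le))
  · rintro ω ⟨hω, hlt⟩
    refine ⟨hω, fun ⟨F, hF, hFx⟩ => ?_⟩
    rw [Set.mem_ofPred_eq] at hlt
    refine hlt.not_ge ?_
    have h1 : (F : Set (Fin d → ℤ)) ⊆
        FK.conePoints P₀ ((1 - min θ (1 / 2)) / 3) t (FK.cluster ω 0) :=
      hF.trans (h.sharpPoints_subset_conePoints (by linarith [min_le_left θ (1 / 2)]) _)
    have h2 := Set.encard_le_encard h1
    rw [Set.encard_coe_eq_coe_finsetCard] at h2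
    have h3 : a / d * ‖FK.emb x‖ ≤ F.card := by
      refine le_trans ?_ hFx
      rw [div_mul_eq_mul_div, div_le_iff₀ hd0]
      nlinarith
    calc ENNReal.ofReal (a / d * ‖FK.emb x‖) ≤ ENNReal.ofReal F.card :=
          ENNReal.ofReal_le_ofReal h3
      _ = ((F.card : ENat) : ENNReal) := by simp
      _ ≤ _ := ENat.toENNReal_le.2 h2
  · have h1 : c / d * ‖FK.emb x‖ ≤ c * ‖x‖ := by
      rw [div_mul_eq_mul_div, div_le_iff₀ hd0]
      nlinarith
    linarith
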